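/- Conventions. $S^k\subset\mathbb R^{k+1}$ is the unit sphere with base point $e=(0,\dots,0,1)$, so $S^k=\mathbb R^k\cup\{\infty\}$ with $e=\infty$ by stereographic projection; $\iota: SO(k)\to SO(k+1)$ is $A\mapsto \mathrm{diag}(A,1)$, and $SO(k)$ acts on $S^k=\mathbb R^k\cup\{\infty\}$ through $\iota$, fixing $\infty$. Fix homeomorphisms $I^k/\partial I^k\cong S^k$ compatible with reduced suspension, the suspension coordinate being the last one, so that $\Sigma:\pi_N(S^k)\to\pi_{N+1}(S^{k+1})$ is $(\Sigma f)(z,t)=[f(z),t]$; $\mathrm{Id}_{S^k}\in\pi_k(S^k)$ is the resulting class. Boundaries of cubes are oriented with the outward normal first, and a map $\partial I^{N+1}\to X$ sending the vertex $0$ to the base point is thereby regarded as an element of $\pi_N(X)$. * The Whitehead product $[f,g]\in\pi_{k+l-1}(X)$ of $f\in\pi_k(X)$, $g\in\pi_l(X)$ is the class of $f\cup g:\partial(I^k\times I^l)=I^k\times\partial I^l\cup\partial I^k\times I^l\to X$. * The $J$-homomorphism $J:\pi_{n-1}(SO(k))\to\pi_{n+k-1}(S^k)$ sends $[\rho]$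 to the class of the map on $\partial(I^n\times I^k)$ that sends $I^n\times\partial I^k$ to $\infty$ and $(x,y)\in\partial I^n\times I^k$ to $\rho(x)\cdot[y]$, where $[y]\in I^k/\partial I^k\cong S^k$, and $\rho:I^{n-1}\to SO(k)$ is placed on the face $\{x_n=1\}$ of $I^n$ and extended by $1$ to the rest of $\partial I^n$. * For a based map $\rho:S^{n-1}\to SO(q+1)$, the sphere bundle characterized by $\rho$ is $S^q\overset{i}{\hookrightarrow}E_\rho\overset{p}{\to}S^n$ with $E_\rho=D^n_+\times S^q\cup_\rho D^n_-\times S^q$, obtained by gluing $(x,y)\in D^n_+\times S^q$ to $(x,\rho(x)y)\in D^n_-\times S^q$ for $x$ in the equator $S^{n-1}$. Here $D^n_+$ is the image of $S^{n-1}\times[0,\tfrac12]$ and $D^n_-$ that of $S^{n-1}\times[\tfrac12,1]$ under $S^{n-1}\times I\to\Sigma S^{n-1}\cong S^n$; the base point lies on the equator, and $i$ is the inclusion of the fibre over it. A based section is a continuous $s:S^n\to E_\rho$ with $p s=\mathrm{Id}$ and $s(e)=i(e)$. * For such $s$, the brace product $\{\alpha,\beta\}_s\in\pi_{k+l-1}(S^q)$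 of $\alpha\in\pi_k(S^n)$, $\beta\in\pi_l(S^q)$ is the unique element with $i_*\{\alpha,\beta\}_s=[s_*\alpha,i_*\beta]$. Proposition. Let $n,q\ge 2$ and let $a\in\pi_{n-1}(SO(q+1))$ be in the image of $\iota_*:\pi_{n-1}(SO(q))\to\pi_{n-1}(SO(q+1))$. Then $J(a)\in\pi_{n+q}(S^{q+1})$ lies in the image of $\Sigma:\pi_{n+q-1}(S^q)\to\pi_{n+q}(S^{q+1})$. More precisely, for every based map $\rho:S^{n-1}\to SO(q+1)$ that represents $a$, the sphere bundle $S^q\hookrightarrow E_\rho\to S^n$ characterized by $\rho$ admits a based section, and for every based section $s$ the brace product $\{\mathrm{Id}_{S^n},\mathrm{Id}_{S^q}\}_s\in\pi_{n+q-1}(S^q)$ is defined (there is exactly one class whose image under $i_*$ is $[s_*\mathrm{Id}_{S^n},i_*\mathrm{Id}_{S^q}]$), and $$J(a)=-\Sigma\{\mathrm{Id}_{S^n},\mathrm{Id}_{S^q}\}_s .$$ -/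

import Mathlib

open scoped unitInterval Topology Topology.Homotopy

noncomputable section

/-! ### Spheres and special orthogonal groups -/

/-- The unit sphere `S^k` of `ℝ^(k+1)`. -/
abbrev Sph (k : ℕ) : Type := Metric.sphere (0 : EuclideanSpace ℝ (Fin (k + 1))) 1

/-- The base point `e = (0, …, 0, 1)` of `S^k`. Via stereographic projection from `e`,
`S^k = ℝ^k ∪ {∞}` with `e = ∞`. -/
def sphBase (k : ℕ) : Sph k := ⟨EuclideanSpace.single (Fin.last k) 1, by simp⟩

/-- The topological group `SO(k)`. -/
abbrev SOGrp (k : ℕ) : Type := Matrix.specialOrthogonalGroup (Fin k) ℝ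

/-- The standard inclusion `ι : SO(k) → SO(k+1)`, `A ↦ diag(A, 1)`. -/
def soIncl (k : ℕ) (A : SOGrp k) : SOGrp (k + 1) :=
  ⟨Matrix.reindex finSumFinEquiv finSumFinEquiv
      (Matrix.fromBlocks A.1 0 0 (1 : Matrix (Fin 1) (Fin 1) ℝ)), by
    have hA := Matrix.mem_specialOrthogonalGroup_iff.1 A.2
    have h1 := (Matrix.mem_orthogonalGroup_iff (Fin k) ℝ).1 hA.1
    rw [Matrix.mem_specialOrthogonalGroup_iff]
    constructor
    · rw [Matrix.mem_orthogonalGroup_iff]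
      simp only [Matrix.reindex_apply, Matrix.transpose_submatrix,
        Matrix.fromBlocks_transpose, Matrix.submatrix_mul_equiv, Matrix.fromBlocks_multiply]
      simp [h1]
    · rw [Matrix.det_reindex_self, Matrix.det_fromBlocks_zero₂₁, hA.2]
      simp⟩

theorem soIncl_one (k : ℕ) : soIncl k 1 = 1 := by
  apply Subtype.ext
  simp [soIncl]

theorem continuous_soIncl (k : ℕ) : Continuous (soIncl k) := by
  refine Continuous.subtype_mk ?_ _
  simp only [Matrix.reindex_apply]
  refine Continuous.matrix_submatrix ?_ _ _
  exact Continuous.matrix_fromBlocks continuous_subtype_val continuous_const continuous_const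
    continuous_const

/-- The standard action of `SO(k+1)` on `S^k ⊆ ℝ^(k+1)`, `v ↦ A v`. -/
def rot {k : ℕ} (A : SOGrp (k + 1)) (v : Sph k) : Sph k :=
  ⟨WithLp.toLp 2 (A.1.mulVec v.1.ofLp), by
    have hA := (Matrix.mem_orthogonalGroup_iff' (Fin (k + 1)) ℝ).1
      (Matrix.mem_specialOrthogonalGroup_iff.1 A.2).1
    have hv : ‖v.1‖ = 1 := by simp
    rw [EuclideanSpace.norm_eq, Real.sqrt_eq_one] at hv
    rw [mem_sphere_zero_iff_norm, EuclideanSpace.norm_eq, Real.sqrt_eq_one]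
    have h : ∀ w : Fin (k + 1) → ℝ, ∑ i, ‖w i‖ ^ 2 = w ⬝ᵥ w := fun w => by
      simp [dotProduct, sq]
    rw [h] at hv ⊢
    rw [Matrix.dotProduct_mulVec, Matrix.vecMul_mulVec, ← Matrix.dotProduct_mulVec, hA]
    simpa using hv⟩

theorem rot_one {k : ℕ} (v : Sph k) : rot 1 v = v := by
  apply Subtype.ext
  simp [rot]

theorem continuous_rot {k : ℕ} : Continuous fun z : SOGrp (k + 1) × Sph k => rot z.1 z.2 := by
  refine Continuous.subtype_mk ?_ _
  refine (PiLp.continuous_toLp 2 _).comp ?_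
  refine Continuous.matrix_mulVec (by fun_prop) ?_
  exact (PiLp.continuous_ofLp 2 _).comp (by fun_prop)

theorem rot_soIncl_base {k : ℕ} (A : SOGrp k) : rot (soIncl k A) (sphBase k) = sphBase k := by
  apply Subtype.ext
  ext i
  refine Fin.lastCases ?_ (fun j => ?_) i <;>
    simp [rot, soIncl, sphBase, finSumFinEquiv_symm_last]

/-- The index of the last-but-one coordinate of `ℝ^(k+2)`. -/
abbrev newIdx (k : ℕ) : Fin (k + 2) := (Fin.last k).castSucc

/-- The reduced suspension `S^k ∧ S^1 ≅ S^(k+1)`, as a map `S^k × I → S^(k+1)` which collapses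
`S^k × {0, 1} ∪ {e} × I` to `e`. Here `ℝ^(k+1)` sits in `ℝ^(k+2)` as the hyperplane on which the
last-but-one coordinate vanishes, and `t ↦ suspPt v t` runs once around the circle through `e`
and `v` which is orthogonal to that hyperplane. -/
def suspPt {k : ℕ} (v : Sph k) (t : I) : Sph (k + 1) :=
  ⟨WithLp.toLp 2 ((newIdx k).insertNth (α := fun _ => ℝ)
      (Real.sin (2 * Real.pi * t) * (‖(sphBase k).1 - v.1‖ / 2))
      ((1 / 2 : ℝ) • ((sphBase k).1 + v.1) +
        (Real.cos (2 * Real.pi * t) / 2) • ((sphBase k).1 - v.1)).ofLp), by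
    rw [mem_sphere_zero_iff_norm, EuclideanSpace.norm_eq, Real.sqrt_eq_one,
      Fin.sum_univ_succAbove _ (newIdx k)]
    simp only [Fin.insertNth_apply_same, Fin.insertNth_apply_succAbove]
    rw [← EuclideanSpace.norm_sq_eq]
    have he : ‖(sphBase k).1‖ = 1 := by simp
    have hv : ‖v.1‖ = 1 := by simp
    generalize (sphBase k).1 = e at *
    generalize v.1 = v at *
    have hcs := Real.sin_sq_add_cos_sq (2 * Real.pi * t)
    generalize Real.sin (2 * Real.pi * t) = s at *
    generalize Real.cos (2 * Real.pi * t) = c at *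
    have h1 : ‖e - v‖ ^ 2 = 2 - 2 * inner ℝ e v := by
      rw [norm_sub_sq_real, he, hv]; ring
    have h2 : ‖(1 / 2 : ℝ) • (e + v) + (c / 2) • (e - v)‖ ^ 2
        = (1 + inner ℝ e v) / 2 + c ^ 2 * (1 - inner ℝ e v) / 2 := by
      have hee : inner ℝ e e = (1 : ℝ) := by rw [real_inner_self_eq_norm_sq, he]; norm_num
      have hvv : inner ℝ v v = (1 : ℝ) := by rw [real_inner_self_eq_norm_sq, hv]; norm_num
      rw [← real_inner_self_eq_norm_sq]
      simp only [inner_add_left, inner_add_right, inner_sub_left, inner_sub_right,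
        real_inner_smul_left, real_inner_smul_right, hee, hvv, real_inner_comm e v]
      ring
    rw [h2, Real.norm_eq_abs, sq_abs, mul_pow, div_pow, h1]
    linear_combination (1 - inner ℝ e v) / 2 * hcs⟩

theorem continuous_suspPt {k : ℕ} : Continuous fun z : Sph k × I => suspPt z.1 z.2 := by
  refine Continuous.subtype_mk ?_ _
  refine (PiLp.continuous_toLp 2 _).comp ?_
  refine Continuous.finInsertNth (A := fun _ => ℝ) (newIdx k) (by fun_prop) ?_
  exact (PiLp.continuous_ofLp 2 _).comp (by fun_prop)

theorem insertNth_base (k : ℕ) :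
    WithLp.toLp 2 ((newIdx k).insertNth (α := fun _ => ℝ) (0 : ℝ) (sphBase k).1.ofLp) =
      (sphBase (k + 1)).1 := by
  ext i
  refine (newIdx k).succAboveCases ?_ (fun j => ?_) i
  · simp [sphBase, Fin.castSucc_ne_last]
  · refine Fin.lastCases ?_ (fun j => ?_) j
    · rw [WithLp.ofLp_toLp, Fin.insertNth_apply_succAbove]
      simp [sphBase]
    · rw [WithLp.ofLp_toLp, Fin.insertNth_apply_succAbove]
      simp [sphBase, Fin.castSucc_ne_last, Fin.succAbove_of_castSucc_lt]

theorem suspPt_zero {k : ℕ} (v : Sph k) : suspPt v 0 = sphBase (k + 1) := by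
  apply Subtype.ext
  rw [← insertNth_base]
  simp only [suspPt, Set.Icc.coe_zero, mul_zero, Real.sin_zero, zero_mul, Real.cos_zero]
  congr 3
  module

theorem suspPt_one {k : ℕ} (v : Sph k) : suspPt v 1 = sphBase (k + 1) := by
  apply Subtype.ext
  rw [← insertNth_base]
  simp only [suspPt, Set.Icc.coe_one, mul_one, Real.sin_two_pi, zero_mul, Real.cos_two_pi]
  congr 3
  module

theorem suspPt_base {k : ℕ} (t : I) : suspPt (sphBase k) t = sphBase (k + 1) := by
  apply Subtype.ext
  rw [← insertNth_base]
  simp only [suspPt, sub_self, norm_zero, zero_div, mul_zero, smul_zero, add_zero]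
  congr 3
  module

/-! ### Homotopy groups: induced maps, suspension, fundamental classes -/

/-- Composition of a generalized loop with a based map. -/
def loopMap {N X Y : Type*} [TopologicalSpace X] [TopologicalSpace Y] {x : X} {y : Y}
    (f : C(X, Y)) (hf : f x = y) (a : Ω^ N X x) : Ω^ N Y y :=
  ⟨f.comp a.1, fun z hz => by
    rw [ContinuousMap.comp_apply, a.2 z hz, hf]⟩

/-- The map `f_* : π_N(X, x) → π_N(Y, y)` induced by a based map `f`. -/
def piMap {N X Y : Type*} [TopologicalSpace X] [TopologicalSpace Y] {x : X} {y : Y}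
    (f : C(X, Y)) (hf : f x = y) : HomotopyGroup N X x → HomotopyGroup N Y y :=
  Quotient.map (loopMap f hf) fun _ _ h =>
    ContinuousMap.HomotopicRel.comp_continuousMap h f

theorem boundary_cases {N : ℕ} {z : Fin (N + 1) → I} (hz : z ∈ Cube.boundary (Fin (N + 1))) :
    Fin.init z ∈ Cube.boundary (Fin N) ∨ z (Fin.last N) = 0 ∨ z (Fin.last N) = 1 := by
  obtain ⟨i, hi⟩ := hz
  revert hi
  refine Fin.lastCases (fun h => Or.inr h) (fun j h => Or.inl ⟨j, h⟩) i

/-- The suspension `(z, t) ↦ σ(f(z), t)` of a generalized loop `f` in `S^k`; the suspension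
coordinate `t` is the last one. -/
def suspLoop {N k : ℕ} (f : Ω^ (Fin N) (Sph k) (sphBase k)) :
    Ω^ (Fin (N + 1)) (Sph (k + 1)) (sphBase (k + 1)) :=
  ⟨⟨fun z => suspPt (f (Fin.init z)) (z (Fin.last N)), by
      refine continuous_suspPt.comp (f := fun z : Fin (N + 1) → I =>
        (f.1 (Fin.init z), z (Fin.last N))) ?_
      have : Continuous fun z : Fin (N + 1) → I => (Fin.init z : Fin N → I) := by
        unfold Fin.init; fun_prop
      fun_prop⟩, fun z hz => by
    change suspPt _ _ = _
    rcases boundary_cases hz with h | h | h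
    · rw [GenLoop.boundary f _ h, suspPt_base]
    · rw [h, suspPt_zero]
    · rw [h, suspPt_one]⟩

/-- The suspension homomorphism `Σ : π_N(S^k) → π_(N+1)(S^(k+1))`. -/
def suspension {N k : ℕ} :
    π_ N (Sph k) (sphBase k) → π_ (N + 1) (Sph (k + 1)) (sphBase (k + 1)) :=
  Quotient.map suspLoop fun f g h => by
    obtain ⟨H⟩ := h
    have hini : Continuous fun z : I × (Fin (N + 1) → I) => (Fin.init z.2 : Fin N → I) := by
      unfold Fin.init; fun_prop
    refine ⟨⟨⟨⟨fun z => suspPt (H (z.1, Fin.init z.2)) (z.2 (Fin.last N)), ?_⟩, ?_, ?_⟩, ?_⟩⟩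
    · exact continuous_suspPt.comp (f := fun z : I × (Fin (N + 1) → I) =>
        (H (z.1, Fin.init z.2), z.2 (Fin.last N))) (by fun_prop)
    · intro z
      change suspPt (H (0, Fin.init z)) _ = suspPt (f (Fin.init z)) _
      rw [H.apply_zero]; rfl
    · intro z
      change suspPt (H (1, Fin.init z)) _ = suspPt (g (Fin.init z)) _
      rw [H.apply_one]; rfl
    · intro t z hz
      change suspPt (H (t, Fin.init z)) (z _) = suspPt (f (Fin.init z)) (z _)
      rcases boundary_cases hz with h | h | h
      · rw [H.eq_fst t h]; rfl
      · rw [h, suspPt_zero, suspPt_zero]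
      · rw [h, suspPt_one, suspPt_one]

/-- The identification `I^k / ∂I^k ≅ S^k`, as a generalized loop: `I^0` goes to the point `-e` of
`S^0 = {e, -e}`, and `I^(k+1) / ∂ = (I^k / ∂) ∧ S^1 ≅ S^k ∧ S^1 ≅ S^(k+1)`. -/
def idLoop : (k : ℕ) → Ω^ (Fin k) (Sph k) (sphBase k)
  | 0 => ⟨ContinuousMap.const _ (-sphBase 0), fun _ ⟨i, _⟩ => i.elim0⟩
  | k + 1 => suspLoop (idLoop k)

/-- The class of `Id_{S^k}` in `π_k(S^k)`. -/
def idClass (k : ℕ) : π_ k (Sph k) (sphBase k) := Quotient.mk _ (idLoop k)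

/-- The class in `π_k(X, x)` of a based map `S^k → X`. -/
def mapClass {k : ℕ} {X : Type*} [TopologicalSpace X] {x : X} (f : C(Sph k, X))
    (hf : f (sphBase k) = x) : π_ k X x := piMap f hf (idClass k)

/-! ### The boundary of a product of two cubes as a sphere

`∂I^(N+1)` is an `N`-sphere, oriented as a boundary (outward normal first), so that its face
`{x_0 = 1} = I^N` is positively oriented. The map
`I^N → ∂I^(N+1)`, `z ↦ (bdFst z, bdRest z)`, has degree one and sends `∂I^N` to the vertex `0`:
with `r` the distance to the centre (scaled to `r = 1` on `∂I^N`), the cube `{r ≤ 1/3}` is mapped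
affinely onto the face `{x_0 = 1}`, the shell `{1/3 ≤ r ≤ 2/3}` onto `I × ∂I^N`, and the shell
`{2/3 ≤ r ≤ 1}` is sent into the face `{x_0 = 0}`, by radial contraction to its vertex `0`.
-/

/-- Twice the sup-norm distance from the centre of the cube; it is `1` exactly on the boundary. -/
def cubeRad {N : ℕ} (z : Fin N → I) : ℝ := 2 * ‖fun i => (z i : ℝ) - 1 / 2‖

/-- The coordinate `x_0` of the map `I^N → ∂I^(N+1)`. -/
def bdFst {N : ℕ} (z : Fin N → I) : I := Set.projIcc 0 1 zero_le_one (2 - 3 * cubeRad z)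

/-- The coordinates `(x_1, …, x_N)` of the map `I^N → ∂I^(N+1)`. -/
def bdRest {N : ℕ} (z : Fin N → I) : Fin N → I := fun i =>
  Set.projIcc 0 1 zero_le_one
    (min 1 (3 - 3 * cubeRad z) * (1 / 2 + ((z i : ℝ) - 1 / 2) / max (cubeRad z) (1 / 3)))

/-- The first component of the map
`I^(m+l) → ∂I^(m+1+l) = ∂(I^(m+1) × I^l) ⊆ I^(m+1) × I^l`. -/
def bdX {m l : ℕ} (z : Fin (m + l) → I) : Fin (m + 1) → I :=
  Fin.cons (bdFst z) fun i => bdRest z (Fin.castAdd l i)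

/-- The second component of the map
`I^(m+l) → ∂I^(m+1+l) = ∂(I^(m+1) × I^l) ⊆ I^(m+1) × I^l`. -/
def bdY {m l : ℕ} (z : Fin (m + l) → I) : Fin l → I := fun j => bdRest z (Fin.natAdd m j)

theorem continuous_cubeRad {N : ℕ} : Continuous (cubeRad (N := N)) := by
  unfold cubeRad; fun_prop

theorem continuous_bdFst {N : ℕ} : Continuous (bdFst (N := N)) := by
  have := continuous_cubeRad (N := N)
  exact continuous_projIcc.comp (by fun_prop)

theorem continuous_bdRest {N : ℕ} : Continuous (bdRest (N := N)) := by
  have := continuous_cubeRad (N := N)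
  refine continuous_pi fun i => continuous_projIcc.comp ?_
  refine Continuous.mul (by fun_prop) (Continuous.add continuous_const ?_)
  refine Continuous.div (by fun_prop) (by fun_prop) fun z => ?_
  have : (1 / 3 : ℝ) ≤ max (cubeRad z) (1 / 3) := le_max_right _ _
  intro h
  rw [h] at this
  norm_num at this

theorem continuous_bdX {m l : ℕ} : Continuous (bdX (m := m) (l := l)) := by
  have h1 := continuous_bdFst (N := m + l)
  have h2 := continuous_bdRest (N := m + l)
  exact Continuous.finCons (A := fun _ => I) h1
    (continuous_pi fun i => (continuous_apply _).comp h2)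

theorem continuous_bdY {m l : ℕ} : Continuous (bdY (m := m) (l := l)) :=
  continuous_pi fun _ => (continuous_apply _).comp continuous_bdRest

theorem bd_mem {m l : ℕ} (z : Fin (m + l) → I) :
    bdX z ∈ Cube.boundary (Fin (m + 1)) ∨ bdY z ∈ Cube.boundary (Fin l) := by
  by_cases h1 : cubeRad z ≤ 1 / 3
  · refine Or.inl ⟨0, Or.inr ?_⟩
    simp only [bdX, Fin.cons_zero]
    exact Set.projIcc_of_right_le _ (by linarith)
  by_cases h2 : 2 / 3 ≤ cubeRad z
  · refine Or.inl ⟨0, Or.inl ?_⟩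
    simp only [bdX, Fin.cons_zero]
    exact Set.projIcc_of_le_left _ (by linarith)
  push Not at h1 h2
  have hex : ∃ i, 2 * |(z i : ℝ) - 1 / 2| = cubeRad z := by
    have hne : Nonempty (Fin (m + l)) := by
      by_contra hcon
      rw [not_nonempty_iff] at hcon
      have : cubeRad z = 0 := by
        unfold cubeRad
        rw [Subsingleton.elim (fun i => (z i : ℝ) - 1 / 2) 0]
        simp
      linarith
    obtain ⟨i, hi⟩ := Finite.exists_max fun i => |(z i : ℝ) - 1 / 2|
    refine ⟨i, ?_⟩
    unfold cubeRad
    congr 1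
    refine le_antisymm (norm_le_pi_norm (fun i => (z i : ℝ) - 1 / 2) i) ?_
    exact (pi_norm_le_iff_of_nonneg (abs_nonneg _)).2 hi
  obtain ⟨i, hi⟩ := hex
  have hv : bdRest z i = 0 ∨ bdRest z i = 1 := by
    unfold bdRest
    rw [min_eq_left (by linarith), max_eq_left (by linarith), one_mul]
    have hpos : 0 < cubeRad z := by linarith
    rcases abs_cases ((z i : ℝ) - 1 / 2) with ⟨h, _⟩ | ⟨h, _⟩
    · right
      refine Set.projIcc_of_right_le _ (le_of_eq ?_)
      have hz : (z i : ℝ) - 1 / 2 = cubeRad z / 2 := by linarith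
      rw [hz]
      field_simp
      ring
    · left
      refine Set.projIcc_of_le_left _ (le_of_eq ?_)
      have hz : (z i : ℝ) - 1 / 2 = -(cubeRad z / 2) := by linarith
      rw [hz]
      field_simp
      ring
  revert hv
  refine Fin.addCases (fun j hv => ?_) (fun j hv => ?_) i
  · exact Or.inl ⟨j.succ, by simpa only [bdX, Fin.cons_succ] using hv⟩
  · exact Or.inr ⟨j, hv⟩

theorem cubeRad_boundary {N : ℕ} {z : Fin N → I} (hz : z ∈ Cube.boundary (Fin N)) :
    1 ≤ cubeRad z := by
  obtain ⟨i, hi⟩ := hz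
  have h := norm_le_pi_norm (fun i => (z i : ℝ) - 1 / 2) i
  have h2 : ‖(z i : ℝ) - 1 / 2‖ = 1 / 2 := by
    rcases hi with hi | hi <;> rw [hi] <;> norm_num
  unfold cubeRad
  simp only [h2] at h
  linarith

theorem cubeRad_le {N : ℕ} (z : Fin N → I) : cubeRad z ≤ 1 := by
  have h : ‖fun i => (z i : ℝ) - 1 / 2‖ ≤ 1 / 2 := by
    refine (pi_norm_le_iff_of_nonneg (by norm_num)).2 fun i => ?_
    rw [Real.norm_eq_abs, abs_le]
    constructor <;> linarith [(z i).2.1, (z i).2.2]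
  unfold cubeRad
  linarith

theorem bdRest_boundary {N : ℕ} {z : Fin N → I} (hz : z ∈ Cube.boundary (Fin N)) (i : Fin N) :
    bdRest z i = 0 := by
  have h : cubeRad z = 1 := le_antisymm (cubeRad_le z) (cubeRad_boundary hz)
  refine Set.projIcc_of_le_left _ ?_
  rw [h]
  norm_num

theorem bdX_boundary {m l : ℕ} {z : Fin (m + l) → I} (hz : z ∈ Cube.boundary (Fin (m + l))) :
    bdX z = 0 := by
  have h := cubeRad_boundary hz
  funext i
  refine Fin.cases ?_ (fun j => ?_) i
  · simp only [bdX, Fin.cons_zero]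
    exact Set.projIcc_of_le_left _ (by linarith)
  · simp only [bdX, Fin.cons_succ]
    exact bdRest_boundary hz _

theorem bdY_boundary {m l : ℕ} {z : Fin (m + l) → I} (hz : z ∈ Cube.boundary (Fin (m + l))) :
    bdY z = 0 := funext fun _ => bdRest_boundary hz _

theorem zero_mem_boundary {N : ℕ} (h : 0 < N) : (0 : Fin N → I) ∈ Cube.boundary (Fin N) :=
  ⟨⟨0, h⟩, Or.inl rfl⟩

theorem isClosed_boundary (N : ℕ) : IsClosed (Cube.boundary (Fin N)) := by
  have : Cube.boundary (Fin N) = ⋃ i, {z : Fin N → I | z i = 0 ∨ z i = 1} := by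
    ext z; simp [Cube.boundary]
  rw [this]
  refine isClosed_iUnion_of_finite fun i => ?_
  exact (isClosed_eq (continuous_apply i) continuous_const).union
    (isClosed_eq (continuous_apply i) continuous_const)

/-- A map that agrees with continuous maps on two closed sets is continuous on their union. -/
theorem continuousOn_paste {Z X : Type*} [TopologicalSpace Z] [TopologicalSpace X] {A B : Set Z}
    (hA : IsClosed A) (hB : IsClosed B) {f g F : Z → X} (hf : ContinuousOn f A)
    (hg : ContinuousOn g B) (h1 : ∀ z ∈ A, F z = f z) (h2 : ∀ z ∈ B, F z = g z) :
    ContinuousOn F (A ∪ B) :=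
  ContinuousOn.union_of_isClosed (hf.congr h1) (hg.congr h2) hA hB

/-! ### The Whitehead product -/

open Classical in
/-- The map `f ∪ g : ∂(I^(m+1) × I^l) = I^(m+1) × ∂I^l ∪ ∂I^(m+1) × I^l → X`, equal to `f(x)` on
the first piece and to `g(y)` on the second one, as a map on the cube `I^(m+l)`. -/
def whiteheadFun {X : Type*} {m l : ℕ} (f : (Fin (m + 1) → I) → X) (g : (Fin l → I) → X)
    (z : Fin (m + l) → I) : X :=
  if bdY z ∈ Cube.boundary (Fin l) then f (bdX z) else g (bdY z)

theorem whiteheadFun_boundary {X : Type*} {m l : ℕ} (hl : 0 < l) {x₀ : X}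
    {f : (Fin (m + 1) → I) → X} {g : (Fin l → I) → X}
    (hf : ∀ x ∈ Cube.boundary (Fin (m + 1)), f x = x₀)
    {z : Fin (m + l) → I} (hz : z ∈ Cube.boundary (Fin (m + l))) :
    whiteheadFun f g z = x₀ := by
  unfold whiteheadFun
  rw [if_pos (by rw [bdY_boundary hz]; exact zero_mem_boundary hl), bdX_boundary hz]
  exact hf _ (zero_mem_boundary (Nat.succ_pos m))

theorem continuous_whiteheadFun {T X : Type*} [TopologicalSpace T] [TopologicalSpace X] {m l : ℕ}
    {x₀ : X} {f : T → (Fin (m + 1) → I) → X} {g : T → (Fin l → I) → X}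
    (hfc : Continuous fun p : T × (Fin (m + 1) → I) => f p.1 p.2)
    (hgc : Continuous fun p : T × (Fin l → I) => g p.1 p.2)
    (hf : ∀ t, ∀ x ∈ Cube.boundary (Fin (m + 1)), f t x = x₀)
    (hg : ∀ t, ∀ y ∈ Cube.boundary (Fin l), g t y = x₀) :
    Continuous fun p : T × (Fin (m + l) → I) => whiteheadFun (f p.1) (g p.1) p.2 := by
  have cX := continuous_bdX (m := m) (l := l)
  have cY := continuous_bdY (m := m) (l := l)
  have hA : IsClosed {p : T × (Fin (m + l) → I) | bdY p.2 ∈ Cube.boundary (Fin l)} :=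
    (isClosed_boundary l).preimage (cY.comp continuous_snd)
  have hB : IsClosed {p : T × (Fin (m + l) → I) | bdX p.2 ∈ Cube.boundary (Fin (m + 1))} :=
    (isClosed_boundary (m + 1)).preimage (cX.comp continuous_snd)
  have h := continuousOn_paste hA hB
    (F := fun p : T × (Fin (m + l) → I) => whiteheadFun (f p.1) (g p.1) p.2)
    (f := fun p => f p.1 (bdX p.2)) (g := fun p => g p.1 (bdY p.2))
    (hfc.comp (f := fun p : T × (Fin (m + l) → I) => (p.1, bdX p.2)) (by fun_prop)).continuousOn
    (hgc.comp (f := fun p : T × (Fin (m + l) → I) => (p.1, bdY p.2)) (by fun_prop)).continuousOn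
    (fun p hp => if_pos hp)
    (fun p hp => by
      by_cases hp' : bdY p.2 ∈ Cube.boundary (Fin l)
      · exact (if_pos hp').trans ((hf _ _ hp).trans (hg _ _ hp').symm)
      · exact if_neg hp')
  rw [← continuousOn_univ]
  exact h.mono fun p _ => (bd_mem p.2).symm

/-- The Whitehead product of generalized loops. -/
def whiteheadLoop {X : Type*} [TopologicalSpace X] {x₀ : X} {m l : ℕ} (hl : 0 < l)
    (f : Ω^ (Fin (m + 1)) X x₀) (g : Ω^ (Fin l) X x₀) : Ω^ (Fin (m + l)) X x₀ :=
  ⟨⟨whiteheadFun f g, (continuous_whiteheadFun (T := Unit) (f := fun _ => f) (g := fun _ => g)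
      (f.1.continuous.comp continuous_snd) (g.1.continuous.comp continuous_snd)
      (fun _ => GenLoop.boundary f) (fun _ => GenLoop.boundary g)).comp
      (f := fun z => ((), z)) (by fun_prop)⟩,
    fun _ hz => whiteheadFun_boundary hl (GenLoop.boundary f) hz⟩

/-- The Whitehead product `[·,·] : π_(m+1)(X) × π_l(X) → π_(m+l)(X)`, for `l ≥ 1`. -/
def whitehead {X : Type*} [TopologicalSpace X] {x₀ : X} {m l : ℕ} (hl : 0 < l) :
    π_ (m + 1) X x₀ → π_ l X x₀ → π_ (m + l) X x₀ :=
  Quotient.map₂ (whiteheadLoop hl) fun f f' ⟨F⟩ g g' ⟨G⟩ => by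
    have hF : ∀ t, ∀ x ∈ Cube.boundary (Fin (m + 1)), F (t, x) = x₀ := fun t x hx =>
      (F.eq_fst t hx).trans (GenLoop.boundary f x hx)
    have hG : ∀ t, ∀ x ∈ Cube.boundary (Fin l), G (t, x) = x₀ := fun t x hx =>
      (G.eq_fst t hx).trans (GenLoop.boundary g x hx)
    refine ⟨⟨⟨⟨fun p => whiteheadFun (fun x => F (p.1, x)) (fun y => G (p.1, y)) p.2,
      continuous_whiteheadFun (f := fun t x => F (t, x)) (g := fun t y => G (t, y))
        F.continuous G.continuous hF hG⟩, ?_, ?_⟩, ?_⟩⟩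
    · intro z
      simp only [F.apply_zero, G.apply_zero]
      rfl
    · intro z
      simp only [F.apply_one, G.apply_one]
      rfl
    · intro t z hz
      change whiteheadFun (fun x => F (t, x)) (fun y => G (t, y)) z = whiteheadFun f g z
      exact (whiteheadFun_boundary hl (hF t) hz).trans
        (whiteheadFun_boundary hl (GenLoop.boundary f) hz).symm

/-! ### The `J`-homomorphism -/

open Classical in
/-- A map `ρ : I^m → SO(k)`, extended to `∂I^(m+1)`: `(x, 1) ↦ ρ(x)`, and `1` on the other
faces. -/
def faceExt {m k : ℕ} (ρ : (Fin m → I) → SOGrp k) (x : Fin (m + 1) → I) : SOGrp k :=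
  if x (Fin.last m) = 1 then ρ (Fin.init x) else 1

open Classical in
/-- The map `∂(I^(m+1) × I^k) → S^k` which sends `I^(m+1) × ∂I^k` to the base point and
`(x, y) ∈ ∂I^(m+1) × I^k` to `ρ(x) · y`, as a map on the cube `I^(m+k)`. Here `y` stands for its
image in `S^k = I^k / ∂I^k`, and `SO(k)` acts on `S^k = ℝ^k ∪ {∞}` fixing `∞`. -/
def jFun {m k : ℕ} (ρ : (Fin m → I) → SOGrp k) (z : Fin (m + k) → I) : Sph k :=
  if bdY z ∈ Cube.boundary (Fin k) then sphBase k
  else rot (soIncl k (faceExt ρ (bdX z))) (idLoop k (bdY z))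

theorem jFun_boundary {m k : ℕ} (hk : 0 < k) (ρ : (Fin m → I) → SOGrp k)
    {z : Fin (m + k) → I} (hz : z ∈ Cube.boundary (Fin (m + k))) : jFun ρ z = sphBase k := by
  unfold jFun
  rw [if_pos (by rw [bdY_boundary hz]; exact zero_mem_boundary hk)]

theorem continuousOn_faceExt {T : Type*} [TopologicalSpace T] {m k : ℕ}
    {ρ : T → (Fin m → I) → SOGrp k} (hρc : Continuous fun p : T × (Fin m → I) => ρ p.1 p.2)
    (hρ : ∀ t, ∀ x ∈ Cube.boundary (Fin m), ρ t x = 1) :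
    ContinuousOn (fun p : T × (Fin (m + 1) → I) => faceExt (ρ p.1) p.2)
      {p | p.2 ∈ Cube.boundary (Fin (m + 1))} := by
  have hini : Continuous fun x : Fin (m + 1) → I => (Fin.init x : Fin m → I) := by
    unfold Fin.init; fun_prop
  have hlast : Continuous fun p : T × (Fin (m + 1) → I) => p.2 (Fin.last m) := by fun_prop
  have hA : IsClosed {p : T × (Fin (m + 1) → I) | p.2 (Fin.last m) = 1} :=
    isClosed_eq hlast continuous_const
  have hB : IsClosed {p : T × (Fin (m + 1) → I) |
      p.2 (Fin.last m) = 0 ∨ Fin.init p.2 ∈ Cube.boundary (Fin m)} :=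
    (isClosed_eq hlast continuous_const).union
      ((isClosed_boundary m).preimage (hini.comp continuous_snd))
  have h := continuousOn_paste hA hB
    (F := fun p : T × (Fin (m + 1) → I) => faceExt (ρ p.1) p.2)
    (f := fun p => ρ p.1 (Fin.init p.2)) (g := fun _ => 1)
    (hρc.comp (f := fun p : T × (Fin (m + 1) → I) => (p.1, (Fin.init p.2 : Fin m → I)))
      (by fun_prop)).continuousOn continuousOn_const
    (fun p hp => if_pos hp)
    (fun p hp => by
      by_cases hp' : p.2 (Fin.last m) = 1
      · refine (if_pos hp').trans ?_
        rcases hp with hp | hp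
        · exact absurd (hp.symm.trans hp') zero_ne_one
        · exact hρ _ _ hp
      · exact if_neg hp')
  refine h.mono fun p hp => ?_
  rcases boundary_cases hp with h | h | h
  · exact Or.inr (Or.inr h)
  · exact Or.inr (Or.inl h)
  · exact Or.inl h

theorem continuous_jFun {T : Type*} [TopologicalSpace T] {m k : ℕ}
    {ρ : T → (Fin m → I) → SOGrp k} (hρc : Continuous fun p : T × (Fin m → I) => ρ p.1 p.2)
    (hρ : ∀ t, ∀ x ∈ Cube.boundary (Fin m), ρ t x = 1) :
    Continuous fun p : T × (Fin (m + k) → I) => jFun (ρ p.1) p.2 := by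
  have cX := continuous_bdX (m := m) (l := k)
  have cY := continuous_bdY (m := m) (l := k)
  have hA : IsClosed {p : T × (Fin (m + k) → I) | bdY p.2 ∈ Cube.boundary (Fin k)} :=
    (isClosed_boundary k).preimage (cY.comp continuous_snd)
  have hB : IsClosed {p : T × (Fin (m + k) → I) | bdX p.2 ∈ Cube.boundary (Fin (m + 1))} :=
    (isClosed_boundary (m + 1)).preimage (cX.comp continuous_snd)
  have h1 : ContinuousOn (fun p : T × (Fin (m + k) → I) => faceExt (ρ p.1) (bdX p.2))
      {p | bdX p.2 ∈ Cube.boundary (Fin (m + 1))} :=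
    (continuousOn_faceExt hρc hρ).comp
      (f := fun p : T × (Fin (m + k) → I) => (p.1, bdX p.2)) (by fun_prop) fun _ hp => hp
  have h2 : ContinuousOn (fun p : T × (Fin (m + k) → I) =>
      rot (soIncl k (faceExt (ρ p.1) (bdX p.2))) (idLoop k (bdY p.2)))
      {p | bdX p.2 ∈ Cube.boundary (Fin (m + 1))} := by
    refine continuous_rot.comp_continuousOn (f := fun p : T × (Fin (m + k) → I) =>
      (soIncl k (faceExt (ρ p.1) (bdX p.2)), idLoop k (bdY p.2))) ?_
    refine ContinuousOn.prodMk ((continuous_soIncl k).comp_continuousOn h1) ?_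
    exact ((idLoop k).1.continuous.comp (cY.comp continuous_snd)).continuousOn
  have h := continuousOn_paste hA hB
    (F := fun p : T × (Fin (m + k) → I) => jFun (ρ p.1) p.2)
    (f := fun _ => sphBase k) continuousOn_const h2
    (fun p hp => if_pos hp)
    (fun p _ => by
      by_cases hp' : bdY p.2 ∈ Cube.boundary (Fin k)
      · rw [GenLoop.boundary (idLoop k) _ hp', rot_soIncl_base]
        exact if_pos hp'
      · exact if_neg hp')
  rw [← continuousOn_univ]
  exact h.mono fun p _ => (bd_mem p.2).symm

/-- The `J`-homomorphism on generalized loops. -/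
def jLoop {m k : ℕ} (hk : 0 < k) (ρ : Ω^ (Fin m) (SOGrp k) 1) :
    Ω^ (Fin (m + k)) (Sph k) (sphBase k) :=
  ⟨⟨jFun ρ, (continuous_jFun (T := Unit) (ρ := fun _ => ρ)
      (ρ.1.continuous.comp continuous_snd) (fun _ => GenLoop.boundary ρ)).comp
      (f := fun z => ((), z)) (by fun_prop)⟩,
    fun _ hz => jFun_boundary hk ρ hz⟩

/-- The `J`-homomorphism `J : π_m(SO(k)) → π_(m+k)(S^k)`, for `k ≥ 1`. -/
def jHom {m k : ℕ} (hk : 0 < k) : π_ m (SOGrp k) 1 → π_ (m + k) (Sph k) (sphBase k) :=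
  Quotient.map (jLoop hk) fun ρ ρ' ⟨H⟩ => by
    have hH : ∀ t, ∀ x ∈ Cube.boundary (Fin m), H (t, x) = 1 := fun t x hx =>
      (H.eq_fst t hx).trans (GenLoop.boundary ρ x hx)
    refine ⟨⟨⟨⟨fun p => jFun (fun x => H (p.1, x)) p.2,
      continuous_jFun (ρ := fun t x => H (t, x)) H.continuous hH⟩, ?_, ?_⟩, ?_⟩⟩
    · intro z
      simp only [H.apply_zero]
      rfl
    · intro z
      simp only [H.apply_one]
      rfl
    · intro t z hz
      exact (jFun_boundary hk _ hz).trans (jFun_boundary hk _ hz).symm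

/-! ### Sphere bundles over spheres by clutching -/

/-- The inclusion of `S^m` into `S^(m+1)` as the equator `{x_m = 0}`, where `x_m` is the
last-but-one coordinate of `ℝ^(m+2)`. -/
def equator {m : ℕ} (x : Sph m) : Sph (m + 1) :=
  ⟨WithLp.toLp 2 ((newIdx m).insertNth (α := fun _ => ℝ) (0 : ℝ) x.1.ofLp), by
    rw [mem_sphere_zero_iff_norm, EuclideanSpace.norm_eq, Real.sqrt_eq_one,
      Fin.sum_univ_succAbove _ (newIdx m)]
    simp only [Fin.insertNth_apply_same, Fin.insertNth_apply_succAbove]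
    rw [← EuclideanSpace.norm_sq_eq]
    simp⟩

/-- The closed hemisphere `D_+ = {x_m ≥ 0}` of `S^(m+1)`; it is the image of
`S^m × [0, 1/2]` under `suspPt`. -/
def hemiPos (m : ℕ) : Set (Sph (m + 1)) := {x | 0 ≤ x.1 (newIdx m)}

/-- The closed hemisphere `D_- = {x_m ≤ 0}` of `S^(m+1)`. -/
def hemiNeg (m : ℕ) : Set (Sph (m + 1)) := {x | x.1 (newIdx m) ≤ 0}

theorem equator_newIdx {m : ℕ} (x : Sph m) : (equator x).1 (newIdx m) = 0 := by
  simp [equator]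

/-- The point `x` of the equator, as a point of `D_+`. -/
def eqPos {m : ℕ} (x : Sph m) : hemiPos m := ⟨equator x, (equator_newIdx x).ge⟩

/-- The point `x` of the equator, as a point of `D_-`. -/
def eqNeg {m : ℕ} (x : Sph m) : hemiNeg m := ⟨equator x, (equator_newIdx x).le⟩

/-- The relation that glues `(x, y) ∈ D_+ × S^q` to `(x, ρ(x) y) ∈ D_- × S^q` for every `x` in the
equator. -/
def clutchRel {m q : ℕ} (ρ : C(Sph m, SOGrp (q + 1)))
    (a b : (hemiPos m × Sph q) ⊕ (hemiNeg m × Sph q)) : Prop :=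
  ∃ (x : Sph m) (y : Sph q), a = Sum.inl (eqPos x, y) ∧ b = Sum.inr (eqNeg x, rot (ρ x) y)

/-- The total space `E = D_+ × S^q ∪_ρ D_- × S^q` of the `S^q`-bundle over `S^(m+1)` with clutching
function `ρ : S^m → SO(q+1)`, with the quotient topology. -/
def SphBundle {m q : ℕ} (ρ : C(Sph m, SOGrp (q + 1))) : Type := Quot (clutchRel ρ)

instance {m q : ℕ} (ρ : C(Sph m, SOGrp (q + 1))) : TopologicalSpace (SphBundle ρ) :=
  inferInstanceAs (TopologicalSpace (Quot (clutchRel ρ)))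

/-- The bundle projection `p : E → S^(m+1)`. -/
def bundleProj {m q : ℕ} (ρ : C(Sph m, SOGrp (q + 1))) : C(SphBundle ρ, Sph (m + 1)) where
  toFun := Quot.lift (Sum.elim (fun a => a.1.1) (fun a => a.1.1)) (by
    rintro _ _ ⟨x, y, rfl, rfl⟩
    rfl)
  continuous_toFun := continuous_quot_lift _ (by fun_prop)

/-- The inclusion `i : S^q → E` of the fibre over the base point `e` of `S^(m+1)`. (The base point
lies on the equator; when `ρ(e) = 1`, both hemispheres give the same inclusion.) -/
def fibreIncl {m q : ℕ} (ρ : C(Sph m, SOGrp (q + 1))) : C(Sph q, SphBundle ρ) where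
  toFun y := Quot.mk _ (Sum.inr (eqNeg (sphBase m), y))
  continuous_toFun := continuous_quot_mk.comp (by fun_prop)

/-- `s : S^(m+1) → E` is a section of the bundle, and it is based: `s(e) = i(e)`. -/
def IsBasedSection {m q : ℕ} (ρ : C(Sph m, SOGrp (q + 1)))
    (s : C(Sph (m + 1), SphBundle ρ)) : Prop :=
  (∀ x, bundleProj ρ (s x) = x) ∧ s (sphBase (m + 1)) = fibreIncl ρ (sphBase q)

/-! ### The brace product -/

/-- `γ` is the brace product `{α, β}_s = i_*⁻¹ [s_* α, i_* β]`, for based maps `s : B → E` and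
`i : F → E`: the class `[s_* α, i_* β]` lies in the image of `i_*`, and `γ` is its only preimage
under `i_*`. -/
def IsBraceProduct {B E F : Type*} [TopologicalSpace B] [TopologicalSpace E] [TopologicalSpace F]
    {b : B} {e : E} {f : F} (s : C(B, E)) (hs : s b = e) (i : C(F, E)) (hi : i f = e)
    {m l : ℕ} (hl : 0 < l) (α : π_ (m + 1) B b) (β : π_ l F f) (γ : π_ (m + l) F f) : Prop :=
  ∀ γ' : π_ (m + l) F f,
    piMap i hi γ' = whitehead hl (piMap s hs α) (piMap i hi β) ↔ γ' = γ

end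

/-! ### Maps on the boundary of a product of two cubes -/

/-! Write n = m + 1, let i be the inclusion of the fibre, and let ρ̂ be ρ on the face x_m = 1 of
I^n, extended by 1 over the rest of ∂I^n. Pulled back to the cube along I^n → S^n, reflected in the
last coordinate, the bundle has a trivialization which is (x, v) ↦ i(ρ̂(x)⁻¹v) over ∂I^n (`triv`,
`triv_boundary`). In it a based section s becomes a map w : I^n → S^q with w(x) = ρ̂(x)e on ∂I^n.
Let θ be the class of the map on ∂(I^n × I^q) which is w(x) on I^n × ∂I^q and ρ̂(x)[y] on ∂I^n × I^q
(`twist`). Applying the trivialization over x to its values gives s ∪ i precomposed with the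
reflection. Applying instead the trivialization over tx, with t going to 0, deforms this to i ∘
`twist`. A reflection inverts the class, so i_*θ = -[s_*Id, i_*Id] (`piMap_twistLoop`).

The section makes i_* injective. Let a null-homotopy in E of a loop in the fibre be followed by the
section over its reversed projection. The projection then runs forwards and back, so it can be
contracted, and homotopy lifting pushes everything into the fibre (`homotopic_const_of_fibreIncl`).
The lifting property comes from orthogonal projection between nearby fibres inside a trivial vector
bundle (`exists_homotopy_lift`). Hence the brace product exists, is unique and equals -θ.

It remains to see that Σθ = J(a). A homotopy from ρ to ι ∘ ρ' carries w along
(`homotopic_suspLoop_of_characteristic`), and since SO(q) fixes e, the new w is constant on ∂I^n.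
The map is now the union of w on I^n × ∂I^q and of a representative of J(ρ') on ∂I^n × I^q. After
one suspension such a union becomes a product, because the two parts are never both away from the
base point (`homotopic_suspLoop_union`). The part given by w factors through the cube I^n, so it is
trivial, and Σθ = ΣJ(ρ'). Finally ΣJ(ρ') = J(ι ∘ ρ') = J(a), because suspension commutes with the
action of SO(q) (`jHom_soIncl`). The homotopy from ρ to ι ∘ ρ' also yields a section
(`exists_basedSection`). -/

theorem homotopic_of_family {N X : Type*} [TopologicalSpace X] {x₀ : X} {f g : Ω^ N X x₀}
    (H : I × (N → I) → X) (hH : Continuous H) (h0 : ∀ z, H (0, z) = f z)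
    (h1 : ∀ z, H (1, z) = g z) (hb : ∀ t, ∀ z ∈ Cube.boundary N, H (t, z) = x₀) :
    GenLoop.Homotopic f g :=
  ⟨⟨⟨⟨H, hH⟩, h0, h1⟩, fun t z hz => (hb t z hz).trans (f.2 z hz).symm⟩⟩

/-- The boundary of `I^a × I^b`. -/
def prodBoundary (a b : ℕ) : Set ((Fin a → I) × (Fin b → I)) :=
  {p | p.1 ∈ Cube.boundary (Fin a) ∨ p.2 ∈ Cube.boundary (Fin b)}

theorem bd_mem_prodBoundary {m l : ℕ} (z : Fin (m + l) → I) :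
    (bdX z, bdY z) ∈ prodBoundary (m + 1) l := bd_mem z

theorem continuous_comp_bd {T X : Type*} [TopologicalSpace T] [TopologicalSpace X] {m l : ℕ}
    {G : T → (Fin (m + 1) → I) → (Fin l → I) → X}
    (hG : ContinuousOn (fun p : T × ((Fin (m + 1) → I) × (Fin l → I)) => G p.1 p.2.1 p.2.2)
      {p | p.2 ∈ prodBoundary (m + 1) l}) :
    Continuous fun p : T × (Fin (m + l) → I) => G p.1 (bdX p.2) (bdY p.2) := by
  have cX := continuous_bdX (m := m) (l := l)
  have cY := continuous_bdY (m := m) (l := l)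
  exact hG.comp_continuous (f := fun p : T × (Fin (m + l) → I) => (p.1, (bdX p.2, bdY p.2)))
    (by fun_prop) fun p => bd_mem p.2

/-- The whole boundary of I^(m+l) goes to the vertex (0, 0), so a family of maps on ∂(I^(m+1) × I^l)
has to keep only that one point at the base point. -/
theorem homotopic_of_bdFamily {X : Type*} [TopologicalSpace X] {x₀ : X} {m l : ℕ}
    {f g : Ω^ (Fin (m + l)) X x₀} (G : I → (Fin (m + 1) → I) → (Fin l → I) → X)
    (hG : ContinuousOn (fun p : I × ((Fin (m + 1) → I) × (Fin l → I)) => G p.1 p.2.1 p.2.2)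
      {p | p.2 ∈ prodBoundary (m + 1) l})
    (hbase : ∀ t, G t 0 0 = x₀) (h0 : ∀ z, G 0 (bdX z) (bdY z) = f z)
    (h1 : ∀ z, G 1 (bdX z) (bdY z) = g z) : GenLoop.Homotopic f g :=
  homotopic_of_family (fun p => G p.1 (bdX p.2) (bdY p.2)) (continuous_comp_bd hG) h0 h1
    fun t z hz => by
      change G t (bdX z) (bdY z) = x₀
      rw [bdX_boundary hz, bdY_boundary hz, hbase]

open Classical in
/-- The map on the boundary of `I^a × I^b` which is `f` on `I^a × ∂I^b` and `g` on
`∂I^a × I^b`. -/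
noncomputable def glue {X A : Type*} {l : ℕ} (f : A → X) (g : A → (Fin l → I) → X)
    (x : A) (y : Fin l → I) : X :=
  if y ∈ Cube.boundary (Fin l) then f x else g x y

theorem glue_left {X A : Type*} {l : ℕ} (f : A → X) (g : A → (Fin l → I) → X) (x : A)
    {y : Fin l → I} (hy : y ∈ Cube.boundary (Fin l)) : glue f g x y = f x := if_pos hy

theorem glue_right {X A : Type*} {l : ℕ} {f : A → X} {g : A → (Fin l → I) → X} {x : A}
    (h : ∀ y ∈ Cube.boundary (Fin l), f x = g x y) (y : Fin l → I) :
    glue f g x y = g x y := by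
  by_cases hy : y ∈ Cube.boundary (Fin l)
  · rw [glue_left _ _ _ hy, h y hy]
  · exact if_neg hy

theorem continuousOn_glue {T X : Type*} [TopologicalSpace T] [TopologicalSpace X] {k l : ℕ}
    {f : T → (Fin k → I) → X} {g : T → (Fin k → I) → (Fin l → I) → X}
    (hf : Continuous fun p : T × (Fin k → I) => f p.1 p.2)
    (hg : ContinuousOn (fun p : T × ((Fin k → I) × (Fin l → I)) => g p.1 p.2.1 p.2.2)
      {p | p.2.1 ∈ Cube.boundary (Fin k)})
    (hfg : ∀ t, ∀ x ∈ Cube.boundary (Fin k), ∀ y ∈ Cube.boundary (Fin l), f t x = g t x y) :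
    ContinuousOn (fun p : T × ((Fin k → I) × (Fin l → I)) => glue (f p.1) (g p.1) p.2.1 p.2.2)
      {p | p.2 ∈ prodBoundary k l} := by
  have h := continuousOn_paste
    (A := {p : T × ((Fin k → I) × (Fin l → I)) | p.2.1 ∈ Cube.boundary (Fin k)})
    (B := {p : T × ((Fin k → I) × (Fin l → I)) | p.2.2 ∈ Cube.boundary (Fin l)})
    ((isClosed_boundary k).preimage (by fun_prop)) ((isClosed_boundary l).preimage (by fun_prop))
    (F := fun p : T × ((Fin k → I) × (Fin l → I)) => glue (f p.1) (g p.1) p.2.1 p.2.2) hg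
    (hf.comp (f := fun p : T × ((Fin k → I) × (Fin l → I)) => (p.1, p.2.1))
      (by fun_prop)).continuousOn
    (fun p hp => glue_right (hfg p.1 p.2.1 hp) p.2.2)
    (fun p hp => glue_left _ _ _ hp)
  exact h

/-! ### Collapsing the face `x_0 = 0` -/

/-- The nearest point of the unit interval. -/
noncomputable abbrev clamp (t : ℝ) : I := Set.projIcc 0 1 zero_le_one t

theorem continuous_clamp : Continuous clamp := continuous_projIcc

theorem clamp_of_nonpos {t : ℝ} (h : t ≤ 0) : clamp t = 0 := Set.projIcc_of_le_left _ h

theorem clamp_of_one_le {t : ℝ} (h : 1 ≤ t) : clamp t = 1 := Set.projIcc_of_right_le _ h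

theorem clamp_coe (t : I) : clamp t = t := Set.projIcc_val _ t

/-- Stretching of the coordinate `x_0`. -/
noncomputable def collX {m : ℕ} (t : I) (x : Fin (m + 1) → I) : Fin (m + 1) → I :=
  Function.update x 0 (clamp ((1 + t) * x 0 - t))

/-- Contraction of the coordinate `y_0` where `x_0` is small. -/
noncomputable def collY {l : ℕ} (t a : I) (y : Fin (l + 1) → I) : Fin (l + 1) → I :=
  Function.update y 0 (clamp (1 - t + (1 + t) * a) * y 0)

theorem continuous_collX {m : ℕ} :
    Continuous fun p : I × (Fin (m + 1) → I) => collX p.1 p.2 := by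
  refine Continuous.update (by fun_prop) 0 (continuous_clamp.comp ?_)
  fun_prop

theorem continuous_collY {l : ℕ} :
    Continuous fun p : I × I × (Fin (l + 1) → I) => collY p.1 p.2.1 p.2.2 := by
  refine Continuous.update (by fun_prop) 0 (Continuous.mul (continuous_clamp.comp ?_) ?_) <;>
    fun_prop

theorem collX_zero {m : ℕ} (x : Fin (m + 1) → I) : collX 0 x = x := by
  simp [collX]

theorem collY_zero {l : ℕ} (a : I) (y : Fin (l + 1) → I) : collY 0 a y = y := by
  have : clamp (1 - (0 : I) + (1 + (0 : I)) * a) = 1 :=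
    clamp_of_one_le (by simpa using a.2.1)
  rw [collY, this, one_mul, Function.update_eq_self]

/-- Either the stretched x_0 has reached 0, and the point is on the face x_0 = 0 whatever became of
y, or (1 + t)x_0 > t, and then the factor contracting y_0 is 1. -/
theorem coll_mem {m l : ℕ} (t : I) {x : Fin (m + 1) → I} {y : Fin (l + 1) → I}
    (h : (x, y) ∈ prodBoundary (m + 1) (l + 1)) :
    (collX t x, collY t (x 0) y) ∈ prodBoundary (m + 1) (l + 1) := by
  by_cases hs : (1 + (t : ℝ)) * x 0 - t ≤ 0
  · exact Or.inl ⟨0, Or.inl (by simp [collX, clamp_of_nonpos hs])⟩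
  have hY : collY t (x 0) y = y := by
    have : clamp (1 - t + (1 + t) * (x 0 : ℝ)) = 1 := clamp_of_one_le (by linarith)
    simp [collY, this]
  rw [hY]
  rcases h with ⟨i, hi⟩ | h
  · left
    by_cases h0 : i = 0
    · subst h0
      dsimp only at hi
      rcases hi with hi | hi
      · rw [hi] at hs
        exact absurd (by simpa using t.2.1) hs
      · refine ⟨0, Or.inr ?_⟩
        simp only [collX, Function.update_self]
        exact clamp_of_one_le (by rw [hi]; simp)
    · exact ⟨i, by simpa [collX, h0] using hi⟩
  · exact Or.inr h

/-- The map `G` on `∂(I^(m+1) × I^(l+1))`, precomposed with a self-map homotopic to the identity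
which sends the face `{x_0 = 0}` into `{x_0 = 0, y_0 = 0}`. -/
noncomputable def coll {X : Type*} {m l : ℕ} (G : (Fin (m + 1) → I) → (Fin (l + 1) → I) → X)
    (x : Fin (m + 1) → I) (y : Fin (l + 1) → I) : X :=
  G (collX 1 x) (collY 1 (x 0) y)

/-- This is the purpose of `coll`. The outer shell of the cube is sent into the face x_0 = 0 by a
contraction to a vertex, which does not commute with reflections or suspension. Once the map is
constant on that face, the parametrization of the shell is irrelevant. -/
theorem coll_base {X : Type*} {x₀ : X} {m l : ℕ}
    {G : (Fin (m + 1) → I) → (Fin (l + 1) → I) → X}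
    (hbase : ∀ x y, x 0 = 0 → y 0 = 0 → G x y = x₀) {x : Fin (m + 1) → I} (hx : x 0 = 0)
    (y : Fin (l + 1) → I) : coll G x y = x₀ := by
  refine hbase _ _ ?_ ?_
  · simp only [collX, Function.update_self, hx]
    exact clamp_of_nonpos (by simp)
  · have : clamp (1 - (1 : I) + (1 + (1 : I)) * (0 : I)) = 0 := clamp_of_nonpos (by simp)
    simp [collY, hx]

theorem continuousOn_coll_family {X : Type*} [TopologicalSpace X] {m l : ℕ}
    {G : (Fin (m + 1) → I) → (Fin (l + 1) → I) → X}
    (hG : ContinuousOn (Function.uncurry G) (prodBoundary (m + 1) (l + 1))) :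
    ContinuousOn (fun p : I × ((Fin (m + 1) → I) × (Fin (l + 1) → I)) =>
      G (collX p.1 p.2.1) (collY p.1 (p.2.1 0) p.2.2))
      {p | p.2 ∈ prodBoundary (m + 1) (l + 1)} := by
  refine hG.comp (f := fun p : I × ((Fin (m + 1) → I) × (Fin (l + 1) → I)) =>
      (collX p.1 p.2.1, collY p.1 (p.2.1 0) p.2.2)) (Continuous.continuousOn ?_)
      fun p hp => coll_mem p.1 hp
  have h1 := continuous_collX.comp (f := fun p : I × ((Fin (m + 1) → I) × (Fin (l + 1) → I)) =>
    (p.1, p.2.1)) (by fun_prop)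
  have h2 := continuous_collY.comp (f := fun p : I × ((Fin (m + 1) → I) × (Fin (l + 1) → I)) =>
    (p.1, p.2.1 0, p.2.2)) (by fun_prop)
  exact h1.prodMk h2

theorem continuousOn_coll {X : Type*} [TopologicalSpace X] {m l : ℕ}
    {G : (Fin (m + 1) → I) → (Fin (l + 1) → I) → X}
    (hG : ContinuousOn (Function.uncurry G) (prodBoundary (m + 1) (l + 1))) :
    ContinuousOn (Function.uncurry (coll G)) (prodBoundary (m + 1) (l + 1)) :=
  (continuousOn_coll_family hG).comp
    (f := fun p : (Fin (m + 1) → I) × (Fin (l + 1) → I) => ((1 : I), p)) (by fun_prop)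
    fun _ hp => hp

theorem exists_coll_homotopic {X : Type*} [TopologicalSpace X] {x₀ : X} {m l : ℕ}
    {G : (Fin (m + 1) → I) → (Fin (l + 1) → I) → X}
    (hG : ContinuousOn (Function.uncurry G) (prodBoundary (m + 1) (l + 1)))
    (hbase : ∀ x y, x 0 = 0 → y 0 = 0 → G x y = x₀)
    (f : Ω^ (Fin (m + (l + 1))) X x₀) (hf : ∀ z, f z = G (bdX z) (bdY z)) :
    ∃ f' : Ω^ (Fin (m + (l + 1))) X x₀, (∀ z, f' z = coll G (bdX z) (bdY z)) ∧
      GenLoop.Homotopic f f' := by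
  have hb : ∀ t : I, G (collX t 0) (collY t ((0 : Fin (m + 1) → I) 0) 0) = x₀ := fun t => by
    refine hbase _ _ ?_ ?_
    · simp only [collX, Function.update_self]
      exact clamp_of_nonpos (by simpa using t.2.1)
    · simp [collY]
  have hc := continuous_comp_bd (G := fun t x y => G (collX t x) (collY t (x 0) y))
    (continuousOn_coll_family hG)
  refine ⟨⟨⟨fun z => coll G (bdX z) (bdY z), hc.comp (f := fun z => ((1 : I), z)) (by fun_prop)⟩,
    fun z hz => ?_⟩, fun _ => rfl,
    homotopic_of_bdFamily (fun t x y => G (collX t x) (collY t (x 0) y))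
      (continuousOn_coll_family hG) hb (fun z => ?_) fun _ => rfl⟩
  · change coll G (bdX z) (bdY z) = x₀
    rw [bdX_boundary hz, bdY_boundary hz]
    exact hb 1
  · rw [collX_zero, collY_zero, hf]

/-! ### Reversing a coordinate -/

/-- Reversal of the coordinate `i` of a point of the cube. -/
noncomputable def cubeFlip {N : ℕ} (i : Fin N) (x : Fin N → I) : Fin N → I :=
  fun j => if j = i then σ (x i) else x j

theorem continuous_cubeFlip {N : ℕ} (i : Fin N) : Continuous (cubeFlip i) := by
  refine continuous_pi fun j => ?_
  unfold cubeFlip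
  split_ifs <;> fun_prop

theorem cubeFlip_mem {N : ℕ} (i : Fin N) {x : Fin N → I} (hx : x ∈ Cube.boundary (Fin N)) :
    cubeFlip i x ∈ Cube.boundary (Fin N) := by
  obtain ⟨j, hj⟩ := hx
  refine ⟨j, ?_⟩
  by_cases h : j = i
  · subst h
    simpa [cubeFlip, or_comm] using hj
  · simpa [cubeFlip, h] using hj

theorem cubeRad_flip {N : ℕ} (i : Fin N) (z : Fin N → I) : cubeRad (cubeFlip i z) = cubeRad z := by
  have h : ∀ j, ‖(cubeFlip i z j : ℝ) - 1 / 2‖ = ‖(z j : ℝ) - 1 / 2‖ := fun j => by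
    by_cases hj : j = i
    · subst hj
      rw [← norm_neg]
      simp only [cubeFlip, if_true, unitInterval.coe_symm_eq]
      congr 1; ring
    · simp [cubeFlip, hj]
  unfold cubeRad
  simp only [Pi.norm_def]
  congr 3
  funext j
  exact NNReal.eq (h j)

theorem bdFst_flip {N : ℕ} (i : Fin N) (z : Fin N → I) : bdFst (cubeFlip i z) = bdFst z := by
  simp only [bdFst, cubeRad_flip]

/-- Beyond radius 2/3 the coordinates are contracted to the vertex 0, which reflections do not fix;
hence the bound on the radius. -/
theorem bdRest_flip {N : ℕ} (i : Fin N) (z : Fin N → I) (hz : cubeRad z ≤ 2 / 3) :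
    bdRest (cubeFlip i z) = cubeFlip i (bdRest z) := by
  have key : ∀ a : ℝ, clamp (1 / 2 + -a) = σ (clamp (1 / 2 + a)) := fun a => by
    apply Subtype.ext
    simp only [clamp, Set.coe_projIcc, unitInterval.coe_symm_eq]
    rcases le_total (1/2 + a) 1 with h1 | h1 <;> rcases le_total (1/2 + -a) 1 with h2 | h2 <;>
      rcases le_total 0 (1/2 + a) with h3 | h3 <;> rcases le_total 0 (1/2 + -a) with h4 | h4 <;>
      simp only [min_eq_left, min_eq_right, max_eq_left, max_eq_right, h1, h2, h3, h4,
        zero_le_one] <;> linarith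
  funext j
  by_cases hj : j = i
  · subst hj
    simp only [bdRest, cubeFlip, cubeRad_flip, if_true, unitInterval.coe_symm_eq]
    rw [min_eq_left (by linarith), one_mul, one_mul, ← key]
    congr 1
    ring
  · simp only [bdRest, cubeFlip, cubeRad_flip, if_neg hj]

theorem bdX_flip {m l : ℕ} (i : Fin m) (z : Fin (m + l) → I) (hz : cubeRad z ≤ 2 / 3) :
    bdX (cubeFlip (Fin.castAdd l i) z) = cubeFlip i.succ (bdX z) := by
  funext j
  refine Fin.cases ?_ (fun j => ?_) j
  · simp [bdX, cubeFlip, bdFst_flip, (Fin.succ_ne_zero i).symm]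
  · simp only [bdX, cubeFlip, Fin.cons_succ, bdRest_flip _ _ hz, Fin.succ_inj, Fin.castAdd_inj]

theorem bdY_flip {m l : ℕ} (i : Fin m) (z : Fin (m + l) → I) (hz : cubeRad z ≤ 2 / 3) :
    bdY (cubeFlip (Fin.castAdd l i) z) = bdY z := by
  funext j
  have : Fin.natAdd m j ≠ Fin.castAdd l i := by
    intro h
    have := congrArg Fin.val h
    simp at this
    omega
  simp [bdY, bdRest_flip _ _ hz, cubeFlip, this]

theorem collX_flip {m : ℕ} (t : I) (i : Fin m) (x : Fin (m + 1) → I) :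
    collX t (cubeFlip i.succ x) = cubeFlip i.succ (collX t x) := by
  funext j
  refine Fin.cases ?_ (fun j => ?_) j
  · simp [collX, cubeFlip, (Fin.succ_ne_zero i).symm]
  · simp [collX, cubeFlip]

/-- Reversing a coordinate of `I^(m+1)` other than `x_0` inverts the class of a map on
`∂(I^(m+1) × I^(l+1))`. -/
theorem homotopic_symmAt_of_flip {X : Type*} [TopologicalSpace X] {x₀ : X} {m l : ℕ} (i : Fin m)
    {G : (Fin (m + 1) → I) → (Fin (l + 1) → I) → X}
    (hG : ContinuousOn (Function.uncurry G) (prodBoundary (m + 1) (l + 1)))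
    (hbase : ∀ x y, x 0 = 0 → y 0 = 0 → G x y = x₀)
    (f g : Ω^ (Fin (m + (l + 1))) X x₀) (hf : ∀ z, f z = G (bdX z) (bdY z))
    (hg : ∀ z, g z = G (cubeFlip i.succ (bdX z)) (bdY z)) :
    ∃ f' : Ω^ (Fin (m + (l + 1))) X x₀, GenLoop.Homotopic f f' ∧
      GenLoop.Homotopic g (GenLoop.symmAt (Fin.castAdd (l + 1) i) f') := by
  obtain ⟨f', hf', hff'⟩ := exists_coll_homotopic hG hbase f hf
  have hG' : ContinuousOn (Function.uncurry fun x y => G (cubeFlip i.succ x) y)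
      (prodBoundary (m + 1) (l + 1)) :=
    hG.comp (f := fun p : (Fin (m + 1) → I) × (Fin (l + 1) → I) => (cubeFlip i.succ p.1, p.2))
      (((continuous_cubeFlip _).comp continuous_fst).prodMk continuous_snd).continuousOn
      fun p hp => hp.imp_left (cubeFlip_mem _)
  have h0 : ∀ x : Fin (m + 1) → I, cubeFlip i.succ x 0 = x 0 := fun x => by
    simp [cubeFlip, (Fin.succ_ne_zero i).symm]
  obtain ⟨g', hg', hgg'⟩ := exists_coll_homotopic hG'
    (fun x y hx hy => hbase _ _ (by rw [h0, hx]) hy) g hg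
  have hcoll : ∀ x y, coll (fun x y => G (cubeFlip i.succ x) y) x y = coll G (cubeFlip i.succ x) y :=
    fun x y => by
      unfold coll
      rw [collX_flip, h0]
  refine ⟨f', hff', hgg'.trans ?_⟩
  have : g' = GenLoop.symmAt (Fin.castAdd (l + 1) i) f' := by
    ext z
    change g' z = f' (cubeFlip (Fin.castAdd (l + 1) i) z)
    rw [hg', hf', hcoll]
    -- Up to radius 2/3 the parametrization commutes with the reflection; beyond it x_0 = 0 and both
    -- sides are the base point.
    rcases le_total (cubeRad z) (2 / 3) with hz | hz
    · rw [bdX_flip _ _ hz, bdY_flip _ _ hz]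
    · have hb : bdFst z = 0 := clamp_of_nonpos (by linarith)
      rw [coll_base hbase (by rw [h0]; exact hb),
        coll_base hbase ((bdFst_flip _ z).trans hb)]
  rw [this]

/-! ### Linear algebra of the action of `SO(k)` -/

/-- The action of matrices on Euclidean space. -/
noncomputable def matAct {n : ℕ} (A : Matrix (Fin n) (Fin n) ℝ) (v : EuclideanSpace ℝ (Fin n)) :
    EuclideanSpace ℝ (Fin n) := WithLp.toLp 2 (A.mulVec v.ofLp)

theorem matAct_add {n : ℕ} (A : Matrix (Fin n) (Fin n) ℝ) (v w : EuclideanSpace ℝ (Fin n)) :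
    matAct A (v + w) = matAct A v + matAct A w := by
  simp [matAct, Matrix.mulVec_add]

theorem matAct_sub {n : ℕ} (A : Matrix (Fin n) (Fin n) ℝ) (v w : EuclideanSpace ℝ (Fin n)) :
    matAct A (v - w) = matAct A v - matAct A w := by
  simp [matAct, Matrix.mulVec_sub]

theorem matAct_smul {n : ℕ} (A : Matrix (Fin n) (Fin n) ℝ) (c : ℝ)
    (v : EuclideanSpace ℝ (Fin n)) : matAct A (c • v) = c • matAct A v := by
  simp [matAct, Matrix.mulVec_smul]

theorem smul_matAct {n : ℕ} (A : Matrix (Fin n) (Fin n) ℝ) (c : ℝ)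
    (v : EuclideanSpace ℝ (Fin n)) : matAct (c • A) v = c • matAct A v := by
  simp [matAct, Matrix.smul_mulVec]

theorem matAct_matAct {n : ℕ} (A B : Matrix (Fin n) (Fin n) ℝ) (v : EuclideanSpace ℝ (Fin n)) :
    matAct A (matAct B v) = matAct (A * B) v := by
  simp [matAct, Matrix.mulVec_mulVec]

theorem one_matAct {n : ℕ} (v : EuclideanSpace ℝ (Fin n)) : matAct 1 v = v := by
  simp [matAct]

theorem continuous_matAct {n : ℕ} : Continuous fun p : Matrix (Fin n) (Fin n) ℝ ×
    EuclideanSpace ℝ (Fin n) => matAct p.1 p.2 := by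
  refine (PiLp.continuous_toLp 2 _).comp (Continuous.matrix_mulVec (by fun_prop) ?_)
  exact (PiLp.continuous_ofLp 2 _).comp (by fun_prop)

theorem coe_rot {k : ℕ} (A : SOGrp (k + 1)) (v : Sph k) : (rot A v).1 = matAct A.1 v.1 := rfl

theorem transpose_mul_self {n : ℕ} (A : SOGrp n) : A.1.transpose * A.1 = 1 :=
  (Matrix.mem_orthogonalGroup_iff' (Fin n) ℝ).1 (Matrix.mem_specialOrthogonalGroup_iff.1 A.2).1

theorem mul_transpose_self {n : ℕ} (A : SOGrp n) : A.1 * A.1.transpose = 1 :=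
  (Matrix.mem_orthogonalGroup_iff (Fin n) ℝ).1 (Matrix.mem_specialOrthogonalGroup_iff.1 A.2).1

theorem norm_matAct {n : ℕ} (A : SOGrp n) (v : EuclideanSpace ℝ (Fin n)) :
    ‖matAct A.1 v‖ = ‖v‖ := by
  have h : ∀ w : EuclideanSpace ℝ (Fin n), ‖w‖ ^ 2 = w.ofLp ⬝ᵥ w.ofLp := fun w => by
    rw [EuclideanSpace.norm_sq_eq]
    simp [dotProduct, sq]
  have : ‖matAct A.1 v‖ ^ 2 = ‖v‖ ^ 2 := by
    rw [h, h, matAct, Matrix.dotProduct_mulVec, Matrix.vecMul_mulVec, ← Matrix.dotProduct_mulVec,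
      transpose_mul_self, Matrix.one_mulVec]
  exact (sq_eq_sq₀ (norm_nonneg _) (norm_nonneg _)).1 this

theorem continuous_inv_SO {n : ℕ} : Continuous fun A : SOGrp n => A⁻¹ :=
  Continuous.subtype_mk (f := fun A : SOGrp n => A.1.transpose) (by fun_prop) fun A => (A⁻¹).2

theorem rot_mul {k : ℕ} (A B : SOGrp (k + 1)) (v : Sph k) : rot (A * B) v = rot A (rot B v) :=
  Subtype.ext (matAct_matAct A.1 B.1 v.1).symm

theorem rot_inv_rot {k : ℕ} (A : SOGrp (k + 1)) (v : Sph k) : rot A⁻¹ (rot A v) = v := by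
  rw [← rot_mul, inv_mul_cancel, rot_one]

theorem rot_rot_inv {k : ℕ} (A : SOGrp (k + 1)) (v : Sph k) : rot A (rot A⁻¹ v) = v := by
  rw [← rot_mul, mul_inv_cancel, rot_one]

theorem soIncl_mulVec_castSucc {k : ℕ} (A : SOGrp k) (w : Fin (k + 1) → ℝ) (i : Fin k) :
    ((soIncl k A).1.mulVec w) i.castSucc = A.1.mulVec (fun j => w j.castSucc) i := by
  have h : (finSumFinEquiv.symm (Fin.castSucc i) : Fin k ⊕ Fin 1) = Sum.inl i :=
    finSumFinEquiv_symm_apply_castAdd i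
  have h' : ∀ j : Fin k, (finSumFinEquiv.symm (Fin.castSucc j) : Fin k ⊕ Fin 1) = Sum.inl j :=
    fun j => finSumFinEquiv_symm_apply_castAdd j
  simp [soIncl, Matrix.mulVec, dotProduct, Fin.sum_univ_castSucc, h, h', finSumFinEquiv_symm_last]

theorem soIncl_mulVec_last {k : ℕ} (A : SOGrp k) (w : Fin (k + 1) → ℝ) :
    ((soIncl k A).1.mulVec w) (Fin.last k) = w (Fin.last k) := by
  have h' : ∀ j : Fin k, (finSumFinEquiv.symm (Fin.castSucc j) : Fin k ⊕ Fin 1) = Sum.inl j :=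
    fun j => finSumFinEquiv_symm_apply_castAdd j
  simp [soIncl, Matrix.mulVec, dotProduct, Fin.sum_univ_castSucc, h', finSumFinEquiv_symm_last]

/-- The inserted coordinate is the last but one, hence among those fixed by diag(A, 1, 1). -/
theorem soIncl_soIncl_mulVec_insertNth {k : ℕ} (A : SOGrp k) (b : ℝ) (w : Fin (k + 1) → ℝ) :
    (soIncl (k + 1) (soIncl k A)).1.mulVec ((newIdx k).insertNth (α := fun _ => ℝ) b w) =
      (newIdx k).insertNth (α := fun _ => ℝ) b ((soIncl k A).1.mulVec w) := by
  have h1 : ∀ i : Fin k, (newIdx k).succAbove i.castSucc = i.castSucc.castSucc := fun i =>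
    Fin.succAbove_of_castSucc_lt _ _ (by simp [Fin.lt_def])
  have h2 : (newIdx k).succAbove (Fin.last k) = Fin.last (k + 1) := by
    simp [newIdx]
  have e1 : ∀ v : Fin (k + 1) → ℝ, ∀ i : Fin k,
      (newIdx k).insertNth (α := fun _ => ℝ) b v i.castSucc.castSucc = v i.castSucc := fun v i => by
    rw [← h1, Fin.insertNth_apply_succAbove]
  have e2 : ∀ v : Fin (k + 1) → ℝ,
      (newIdx k).insertNth (α := fun _ => ℝ) b v (Fin.last (k + 1)) = v (Fin.last k) := fun v => by
    rw [← h2, Fin.insertNth_apply_succAbove]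
  have e3 : ∀ v : Fin (k + 1) → ℝ,
      (newIdx k).insertNth (α := fun _ => ℝ) b v (Fin.last k).castSucc = b := fun v =>
    Fin.insertNth_apply_same (α := fun _ => ℝ) (newIdx k) b v
  funext i
  refine Fin.lastCases ?_ (fun j => ?_) i
  · rw [soIncl_mulVec_last, e2, e2, soIncl_mulVec_last]
  · rw [soIncl_mulVec_castSucc]
    refine Fin.lastCases ?_ (fun j => ?_) j
    · rw [soIncl_mulVec_last, e3, e3]
    · rw [soIncl_mulVec_castSucc, e1, soIncl_mulVec_castSucc]
      simp only [e1]

/-- The formula for `suspPt` involves only e, v and ‖e - v‖, while diag(A, 1) fixes e and preserves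
norms. This is the geometric content of J ∘ ι_* = Σ ∘ J. -/
theorem rot_suspPt {k : ℕ} (A : SOGrp k) (v : Sph k) (t : I) :
    rot (soIncl (k + 1) (soIncl k A)) (suspPt v t) = suspPt (rot (soIncl k A) v) t := by
  have he : matAct (soIncl k A).1 (sphBase k).1 = (sphBase k).1 :=
    congrArg Subtype.val (rot_soIncl_base A)
  have hs : (sphBase k).1 - (rot (soIncl k A) v).1 =
      matAct (soIncl k A).1 ((sphBase k).1 - v.1) := by
    rw [matAct_sub, he, coe_rot]
  have ha : (sphBase k).1 + (rot (soIncl k A) v).1 =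
      matAct (soIncl k A).1 ((sphBase k).1 + v.1) := by
    rw [matAct_add, he, coe_rot]
  apply Subtype.ext
  rw [coe_rot]
  simp only [suspPt]
  rw [hs, ha, norm_matAct, ← matAct_smul, ← matAct_smul, ← matAct_add]
  simp only [matAct, soIncl_soIncl_mulVec_insertNth]

/-! ### Suspensions -/

theorem suspLoop_apply {N k : ℕ} (f : Ω^ (Fin N) (Sph k) (sphBase k)) (z : Fin (N + 1) → I) :
    suspLoop f z = suspPt (f (Fin.init z)) (z (Fin.last N)) := rfl

theorem homotopic_suspLoop {N k : ℕ} {f g : Ω^ (Fin N) (Sph k) (sphBase k)}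
    (h : GenLoop.Homotopic f g) : GenLoop.Homotopic (suspLoop f) (suspLoop g) :=
  Quotient.exact (congrArg suspension (Quotient.sound h))

theorem continuous_init {N : ℕ} : Continuous fun z : Fin (N + 1) → I => (Fin.init z : Fin N → I) := by
  unfold Fin.init; fun_prop

/-- If two generalized loops in `S^k` are nowhere both different from the base point, the
suspension of their union is the product of their suspensions. -/
theorem homotopic_suspLoop_union {N k : ℕ} (f g h : Ω^ (Fin N) (Sph k) (sphBase k))
    (hfg : ∀ z, (f z = sphBase k ∧ h z = g z) ∨ (g z = sphBase k ∧ h z = f z)) :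
    GenLoop.Homotopic (suspLoop h) (GenLoop.transAt (Fin.last N) (suspLoop f) (suspLoop g)) := by
  classical
  -- The suspension coordinates of `f` and `g` are reparametrized independently, until `f` occupies
  -- the first half of the interval and `g` the second. There is no conflict, since over each point
  -- at most one of them is off the base point.
  let F : I × (Fin (N + 1) → I) → Sph (k + 1) := fun p =>
    suspPt (f (Fin.init p.2)) (clamp ((1 + p.1) * p.2 (Fin.last N)))
  let G : I × (Fin (N + 1) → I) → Sph (k + 1) := fun p =>
    suspPt (g (Fin.init p.2)) (clamp ((1 + p.1) * p.2 (Fin.last N) - p.1))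
  have cf : Continuous fun p : I × (Fin (N + 1) → I) => f (Fin.init p.2) :=
    f.1.continuous.comp (continuous_init.comp continuous_snd)
  have cg : Continuous fun p : I × (Fin (N + 1) → I) => g (Fin.init p.2) :=
    g.1.continuous.comp (continuous_init.comp continuous_snd)
  have cF : Continuous F := continuous_suspPt.comp (f := fun p : I × (Fin (N + 1) → I) =>
    (f (Fin.init p.2), clamp ((1 + p.1) * p.2 (Fin.last N))))
    (cf.prodMk (continuous_clamp.comp (by fun_prop)))
  have cG : Continuous G := continuous_suspPt.comp (f := fun p : I × (Fin (N + 1) → I) =>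
    (g (Fin.init p.2), clamp ((1 + p.1) * p.2 (Fin.last N) - p.1)))
    (cg.prodMk (continuous_clamp.comp (by fun_prop)))
  let H : I × (Fin (N + 1) → I) → Sph (k + 1) := fun p =>
    if g (Fin.init p.2) = sphBase k then F p else G p
  have hF : ∀ p, f (Fin.init p.2) = sphBase k → F p = sphBase (k + 1) := fun p hp => by
    simp only [F, hp, suspPt_base]
  have hG : ∀ p, g (Fin.init p.2) = sphBase k → G p = sphBase (k + 1) := fun p hp => by
    simp only [G, hp, suspPt_base]
  have hH1 : ∀ p, g (Fin.init p.2) = sphBase k → H p = F p := fun p hp => if_pos hp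
  have hH2 : ∀ p, f (Fin.init p.2) = sphBase k → H p = G p := fun p hp => by
    by_cases hp' : g (Fin.init p.2) = sphBase k
    · rw [hH1 p hp', hF p hp, hG p hp']
    · exact if_neg hp'
  have cH : Continuous H := by
    rw [← continuousOn_univ]
    refine (continuousOn_paste (isClosed_eq cg continuous_const) (isClosed_eq cf continuous_const)
      cF.continuousOn cG.continuousOn hH1 hH2).mono fun p _ => ?_
    exact (hfg (Fin.init p.2)).symm.imp And.left And.left
  refine homotopic_of_family H cH (fun z => ?_) (fun z => ?_) fun t z hz => ?_
  · rcases hfg (Fin.init z) with ⟨h1, h2⟩ | ⟨h1, h2⟩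
    · rw [hH2 _ h1, suspLoop_apply, h2]
      simp only [G, Set.Icc.coe_zero, add_zero, one_mul, sub_zero, clamp_coe]
    · rw [hH1 _ h1, suspLoop_apply, h2]
      simp only [F, Set.Icc.coe_zero, add_zero, one_mul, clamp_coe]
  · have hini : ∀ a : I, Fin.init (Function.update z (Fin.last N) a) = Fin.init z :=
      fun a => Fin.init_update_last _ _
    have hT : GenLoop.transAt (Fin.last N) (suspLoop f) (suspLoop g) z =
        if (z (Fin.last N) : ℝ) ≤ 1 / 2
        then suspPt (f (Fin.init z)) (clamp (2 * z (Fin.last N)))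
        else suspPt (g (Fin.init z)) (clamp (2 * z (Fin.last N) - 1)) := by
      change (if _ then _ else _) = _
      simp only [suspLoop_apply, hini, Function.update_self]
    rw [hT]
    have e2 : (1 : ℝ) + ((1 : I) : ℝ) = 2 := by norm_num
    rcases hfg (Fin.init z) with ⟨h1, h2⟩ | ⟨h1, h2⟩
    · rw [hH2 _ h1]
      simp only [G, e2]
      split_ifs with hz
      · rw [h1, suspPt_base, clamp_of_nonpos (by simp; linarith), suspPt_zero]
      · rfl
    · rw [hH1 _ h1]
      simp only [F, e2]
      split_ifs with hz
      · rfl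
      · rw [h1, suspPt_base, clamp_of_one_le (by linarith), suspPt_one]
  · have hb : f (Fin.init z) = sphBase k ∨ z (Fin.last N) = 0 ∨ z (Fin.last N) = 1 :=
      (boundary_cases hz).imp_left (f.2 _)
    have hb' : g (Fin.init z) = sphBase k ∨ z (Fin.last N) = 0 ∨ z (Fin.last N) = 1 :=
      (boundary_cases hz).imp_left (g.2 _)
    rcases hfg (Fin.init z) with ⟨h1, h2⟩ | ⟨h1, h2⟩
    · rw [hH2 _ h1]
      rcases hb' with h | h | h
      · exact hG _ h
      · simp only [G, h]
        rw [clamp_of_nonpos (by simpa using t.2.1), suspPt_zero]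
      · simp only [G, h]
        rw [clamp_of_one_le (by simp), suspPt_one]
    · rw [hH1 _ h1]
      rcases hb with h | h | h
      · exact hF _ h
      · simp only [F, h]
        rw [clamp_of_nonpos (by simp), suspPt_zero]
      · simp only [F, h]
        rw [clamp_of_one_le (by simpa using t.2.1), suspPt_one]

theorem suspLoop_symmAt {N k : ℕ} (i : Fin N) (f : Ω^ (Fin N) (Sph k) (sphBase k)) :
    suspLoop (GenLoop.symmAt i f) = GenLoop.symmAt i.castSucc (suspLoop f) := by
  refine GenLoop.ext _ _ fun z => ?_
  change suspPt (f _) _ = suspPt (f _) _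
  have h : Fin.last N ≠ i.castSucc := (Fin.castSucc_ne_last i).symm
  dsimp only
  rw [if_neg h]
  congr 2
  funext j
  simp [Fin.init]

theorem suspLoop_const {N k : ℕ} :
    suspLoop (GenLoop.const : Ω^ (Fin N) (Sph k) (sphBase k)) = GenLoop.const := by
  refine GenLoop.ext _ _ fun z => ?_
  change suspPt (sphBase k) _ = _
  rw [suspPt_base]
  rfl

/-! ### Suspension of maps on the boundary of a product of cubes -/

/-- The radius is a sup norm, and |2t - 1| is the radius of the one-dimensional cube. -/
theorem cubeRad_succ {N : ℕ} (w : Fin (N + 1) → I) :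
    cubeRad w = max (cubeRad (Fin.init w)) (|2 * (w (Fin.last N) : ℝ) - 1|) := by
  have e : |2 * (w (Fin.last N) : ℝ) - 1| = 2 * |(w (Fin.last N) : ℝ) - 1 / 2| := by
    rw [show 2 * (w (Fin.last N) : ℝ) - 1 = 2 * ((w (Fin.last N) : ℝ) - 1 / 2) by ring, abs_mul,
      abs_two]
  have h2 : |(w (Fin.last N) : ℝ) - 1 / 2| ≤ ‖fun i => (w i : ℝ) - 1 / 2‖ :=
    norm_le_pi_norm (fun i => (w i : ℝ) - 1 / 2) (Fin.last N)
  have h1 : ‖fun i => (Fin.init w i : ℝ) - 1 / 2‖ ≤ ‖fun i => (w i : ℝ) - 1 / 2‖ :=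
    (pi_norm_le_iff_of_nonneg (norm_nonneg _)).2 fun i =>
      norm_le_pi_norm (fun i => (w i : ℝ) - 1 / 2) i.castSucc
  have h3 : ‖fun i => (w i : ℝ) - 1 / 2‖ ≤
      max ‖fun i => (Fin.init w i : ℝ) - 1 / 2‖ |(w (Fin.last N) : ℝ) - 1 / 2| := by
    refine (pi_norm_le_iff_of_nonneg (le_max_of_le_left (norm_nonneg _))).2 fun i => ?_
    refine Fin.lastCases ?_ (fun j => ?_) i
    · exact le_max_right _ _
    · exact le_max_of_le_left (norm_le_pi_norm (fun i => (Fin.init w i : ℝ) - 1 / 2) j)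
  rw [e, cubeRad, cubeRad, ← mul_max_of_nonneg _ _ (by norm_num : (0 : ℝ) ≤ 2)]
  congr 1
  exact le_antisymm h3 (max_le h1 h2)

/-- The coordinate `x_i`, `i ≥ 1`, of the map `I^N → ∂I^(N+1)`, with `D` in place of the radius. -/
noncomputable def bdCoord (D : ℝ) (a : I) : I := clamp (1 / 2 + ((a : ℝ) - 1 / 2) / max D (1 / 3))

theorem continuous_bdCoord : Continuous fun p : ℝ × I => bdCoord p.1 p.2 := by
  refine continuous_clamp.comp (Continuous.add continuous_const ?_)
  refine Continuous.div (by fun_prop) (by fun_prop) fun p => ?_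
  exact (lt_of_lt_of_le (by norm_num) (le_max_right p.1 (1 / 3))).ne'

theorem bdRest_eq_bdCoord {N : ℕ} {z : Fin N → I} (hz : cubeRad z ≤ 2 / 3) (i : Fin N) :
    bdRest z i = bdCoord (cubeRad z) (z i) := by
  unfold bdRest bdCoord
  rw [min_eq_left (by linarith), one_mul]

/-- Dividing t - 1/2 by |2t - 1| leaves ±1/2. -/
theorem bdCoord_abs {a : I} (ha : 1 / 3 ≤ |2 * (a : ℝ) - 1|) :
    bdCoord (|2 * (a : ℝ) - 1|) a = 0 ∨ bdCoord (|2 * (a : ℝ) - 1|) a = 1 := by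
  unfold bdCoord
  rw [max_eq_left ha]
  have hpos : 0 < |2 * (a : ℝ) - 1| := by linarith
  rcases abs_cases (2 * (a : ℝ) - 1) with ⟨h, _⟩ | ⟨h, _⟩
  · right
    apply clamp_of_one_le
    have : ((a : ℝ) - 1 / 2) / |2 * (a : ℝ) - 1| = 1 / 2 := by
      rw [div_eq_iff hpos.ne', h]; ring
    rw [this]; norm_num
  · left
    apply clamp_of_nonpos
    have : ((a : ℝ) - 1 / 2) / |2 * (a : ℝ) - 1| = -(1 / 2) := by
      rw [div_eq_iff hpos.ne', h]; ring
    rw [this]; norm_num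

/-- The first component of the map `I^(m+l) → ∂(I^(m+1) × I^l)`, with `D` in place of the
radius, and with the outer shell sent into the face `{x_0 = 0}` in a different way. -/
noncomputable def ptX {m l : ℕ} (D : ℝ) (w : Fin (m + l) → I) : Fin (m + 1) → I :=
  Fin.cons (clamp (2 - 3 * D)) fun i => bdCoord D (w (Fin.castAdd l i))

/-- The second component of the map `I^(m+l) → ∂(I^(m+1) × I^l)`, with `D` in place of the
radius. -/
noncomputable def ptY {m l : ℕ} (D : ℝ) (w : Fin (m + l) → I) : Fin l → I :=
  fun j => bdCoord D (w (Fin.natAdd m j))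

theorem continuous_ptX {m l : ℕ} :
    Continuous fun p : ℝ × (Fin (m + l) → I) => ptX p.1 p.2 := by
  refine Continuous.finCons (A := fun _ => I) (continuous_clamp.comp (by fun_prop))
    (continuous_pi fun i => ?_)
  exact continuous_bdCoord.comp (f := fun p : ℝ × (Fin (m + l) → I) =>
    (p.1, p.2 (Fin.castAdd l i))) (by fun_prop)

theorem continuous_ptY {m l : ℕ} :
    Continuous fun p : ℝ × (Fin (m + l) → I) => ptY p.1 p.2 := by
  refine continuous_pi fun i => ?_
  exact continuous_bdCoord.comp (f := fun p : ℝ × (Fin (m + l) → I) =>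
    (p.1, p.2 (Fin.natAdd m i))) (by fun_prop)

theorem bdX_eq_ptX {m l : ℕ} {z : Fin (m + l) → I} (hz : cubeRad z ≤ 2 / 3) :
    bdX z = ptX (cubeRad z) z := by
  funext i
  refine Fin.cases rfl (fun j => ?_) i
  exact bdRest_eq_bdCoord hz _

theorem bdY_eq_ptY {m l : ℕ} {z : Fin (m + l) → I} (hz : cubeRad z ≤ 2 / 3) :
    bdY z = ptY (cubeRad z) z := funext fun _ => bdRest_eq_bdCoord hz _

/-- The two parametrizations differ only beyond radius 2/3, where both land in the face x_0 = 0. -/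
theorem apply_bd_eq_apply_pt {X : Type*} {x₀ : X} {m l : ℕ}
    {G : (Fin (m + 1) → I) → (Fin l → I) → X} (hG : ∀ x y, x 0 = 0 → G x y = x₀)
    (z : Fin (m + l) → I) :
    G (bdX z) (bdY z) = G (ptX (cubeRad z) z) (ptY (cubeRad z) z) := by
  rcases le_total (cubeRad z) (2 / 3) with hz | hz
  · rw [bdX_eq_ptX hz, bdY_eq_ptY hz]
  · have h : clamp (2 - 3 * cubeRad z) = 0 := clamp_of_nonpos (by linarith)
    rw [hG _ _ h, hG _ _ h]

theorem pt_mem {m l : ℕ} (z : Fin (m + l) → I) :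
    (ptX (cubeRad z) z, ptY (cubeRad z) z) ∈ prodBoundary (m + 1) l := by
  rcases le_total (cubeRad z) (2 / 3) with hz | hz
  · rw [← bdX_eq_ptX hz, ← bdY_eq_ptY hz]
    exact bd_mem z
  · exact Or.inl ⟨0, Or.inl (clamp_of_nonpos (by linarith))⟩

theorem snoc_mem_boundary {N : ℕ} {y : Fin N → I} {t : I}
    (h : y ∈ Cube.boundary (Fin N) ∨ t = 0 ∨ t = 1) :
    (Fin.snoc y t : Fin (N + 1) → I) ∈ Cube.boundary (Fin (N + 1)) := by
  rcases h with ⟨i, hi⟩ | h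
  · exact ⟨i.castSucc, by simpa using hi⟩
  · exact ⟨Fin.last N, by simpa using h⟩

/-- The suspension coordinate passes through a self-map of I fixing 0 and 1, and linear
interpolation deforms that map to the identity. This is the form in which the suspension arises in
`homotopic_suspLoop_bd`. -/
theorem exists_suspLoop_reparam {N k : ℕ} (f : Ω^ (Fin N) (Sph k) (sphBase k)) :
    ∃ g : Ω^ (Fin (N + 1)) (Sph (k + 1)) (sphBase (k + 1)),
      (∀ w, g w = suspPt (f (Fin.init w))
        (bdCoord (|2 * (w (Fin.last N) : ℝ) - 1|) (w (Fin.last N)))) ∧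
      GenLoop.Homotopic g (suspLoop f) := by
  let b : I → I := fun a => bdCoord (|2 * (a : ℝ) - 1|) a
  have cb : Continuous b := continuous_bdCoord.comp (f := fun a : I => (|2 * (a : ℝ) - 1|, a))
    (by fun_prop)
  have hb0 : b 0 = 0 := clamp_of_nonpos (by norm_num)
  have hb1 : b 1 = 1 := clamp_of_one_le (by norm_num)
  let B : I → I → I := fun t a => clamp ((1 - t) * b a + t * a)
  have cB : Continuous fun p : I × (Fin (N + 1) → I) => B p.1 (p.2 (Fin.last N)) :=
    continuous_clamp.comp (by fun_prop)
  let S : I × (Fin (N + 1) → I) → Sph (k + 1) := fun p =>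
    suspPt (f (Fin.init p.2)) (B p.1 (p.2 (Fin.last N)))
  have cf : Continuous fun p : I × (Fin (N + 1) → I) => f (Fin.init p.2) :=
    f.1.continuous.comp (continuous_init.comp continuous_snd)
  have cS : Continuous S := continuous_suspPt.comp (f := fun p : I × (Fin (N + 1) → I) =>
    (f (Fin.init p.2), B p.1 (p.2 (Fin.last N)))) (cf.prodMk cB)
  have hSb : ∀ t, ∀ w ∈ Cube.boundary (Fin (N + 1)), S (t, w) = sphBase (k + 1) := by
    intro t w hw
    simp only [S]
    rcases boundary_cases hw with h | h | h
    · rw [GenLoop.boundary f _ h, suspPt_base]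
    · have : B t 0 = 0 := by simp only [B, hb0]; exact clamp_of_nonpos (by simp)
      rw [h, this, suspPt_zero]
    · have : B t 1 = 1 := by simp only [B, hb1]; exact clamp_of_one_le (by simp)
      rw [h, this, suspPt_one]
  have hB0 : ∀ a, B 0 a = b a := fun a => by simp [B]
  have hB1 : ∀ a, B 1 a = a := fun a => by simp [B]
  refine ⟨⟨⟨fun w => S (0, w), cS.comp (f := fun w => ((0 : I), w)) (by fun_prop)⟩, hSb 0⟩,
    fun w => ?_, homotopic_of_family S cS (fun w => rfl) (fun w => ?_) hSb⟩
  · change suspPt _ _ = _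
    rw [hB0]
  · change suspPt _ _ = suspPt _ _
    rw [hB1]

/-- The suspension of a map on `∂(I^(m+1) × I^(l+1))`, as a map on `∂(I^(m+1) × I^(l+2))`. -/
theorem homotopic_suspLoop_bd {k m l : ℕ} {G : (Fin (m + 1) → I) → (Fin (l + 1) → I) → Sph k}
    (hG : ContinuousOn (Function.uncurry G) (prodBoundary (m + 1) (l + 1)))
    (hbase : ∀ x y, x 0 = 0 → y 0 = 0 → G x y = sphBase k)
    {F : (Fin (m + 1) → I) → (Fin (l + 1 + 1) → I) → Sph (k + 1)}
    (hF : ContinuousOn (Function.uncurry F) (prodBoundary (m + 1) (l + 1 + 1)))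
    (hFG : ∀ x y, F x y = suspPt (G x (Fin.init y)) (y (Fin.last (l + 1))))
    (f : Ω^ (Fin (m + (l + 1))) (Sph k) (sphBase k)) (hf : ∀ z, f z = G (bdX z) (bdY z))
    (g : Ω^ (Fin (m + (l + 1 + 1))) (Sph (k + 1)) (sphBase (k + 1)))
    (hg : ∀ z, g z = F (bdX z) (bdY z)) :
    GenLoop.Homotopic g (suspLoop f) := by
  obtain ⟨f', hf', hff'⟩ := exists_coll_homotopic hG hbase f hf
  have hFbase : ∀ x y, x 0 = 0 → y 0 = 0 → F x y = sphBase (k + 1) := fun x y hx hy => by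
    rw [hFG, hbase x (Fin.init y) hx hy, suspPt_base]
  obtain ⟨g', hg', hgg'⟩ := exists_coll_homotopic hF hFbase g hg
  -- The collapse touches only x_0 and y_0, so it commutes with adjoining a last coordinate.
  have hcoll : ∀ x (y : Fin (l + 1) → I) (t : I),
      coll F x (Fin.snoc y t : Fin (l + 1 + 1) → I) = suspPt (coll G x y) t := fun x y t => by
    unfold coll
    rw [hFG]
    congr 2
    · funext j
      refine Fin.cases ?_ (fun j => ?_) j
      · have h : (Fin.snoc y t : Fin (l + 1 + 1) → I) 0 = y 0 :=
          Fin.snoc_castSucc (α := fun _ => I) t y 0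
        simp [collY, Fin.init, h]
      · have h : (Fin.snoc y t : Fin (l + 1 + 1) → I) j.succ.castSucc = y j.succ :=
          Fin.snoc_castSucc (α := fun _ => I) t y j.succ
        have h' : j.succ.castSucc ≠ 0 := by
          rw [← Fin.succ_castSucc]; exact Fin.succ_ne_zero _
        simp only [collY, Fin.init, Function.update_of_ne h',
          Function.update_of_ne (Fin.succ_ne_zero j), h]
    · simp [collY]
  have hGb : ∀ x y, x 0 = 0 → coll G x y = sphBase k := fun x y hx => coll_base hbase hx y
  have hFb : ∀ x y, x 0 = 0 → coll F x y = sphBase (k + 1) := fun x y hx => coll_base hFbase hx y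
  let r : (Fin (m + (l + 1) + 1) → I) → ℝ := fun w => cubeRad (Fin.init w)
  let u : (Fin (m + (l + 1) + 1) → I) → ℝ := fun w => |2 * (w (Fin.last (m + (l + 1))) : ℝ) - 1|
  have hR : ∀ w : Fin (m + (l + 1) + 1) → I, cubeRad w = max (r w) (u w) := cubeRad_succ
  have cr : Continuous r := continuous_cubeRad.comp continuous_init
  have cu : Continuous u := by fun_prop
  have cR := continuous_cubeRad (N := m + (l + 1) + 1)
  -- The radius of `w` is max(r, u). `D` moves the radius used for all coordinates but the last to
  -- r, and `D'` moves the one used for the last coordinate to u. At time 1 the two decouple, which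
  -- is the shape of a suspension.
  let D : I → (Fin (m + (l + 1) + 1) → I) → ℝ := fun t w => (1 - t) * cubeRad w + t * r w
  let D' : I → (Fin (m + (l + 1) + 1) → I) → ℝ := fun t w => (1 - t) * cubeRad w + t * u w
  have hD : ∀ t w, D t w ≤ cubeRad w := fun t w => by
    have h : r w ≤ cubeRad w := by rw [hR]; exact le_max_left _ _
    have := mul_le_mul_of_nonneg_left h t.2.1
    simp only [D]; linarith
  have hDr : ∀ t w, cubeRad w = r w → D t w = r w := fun t w h => by simp only [D, h]; ring
  have hDu : ∀ t w, cubeRad w = u w → D' t w = u w := fun t w h => by simp only [D', h]; ring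
  let ini : (Fin (m + (l + 1) + 1) → I) → Fin (m + (l + 1)) → I := Fin.init
  let X : I × (Fin (m + (l + 1) + 1) → I) → Fin (m + 1) → I := fun p => ptX (D p.1 p.2) (ini p.2)
  let Y : I × (Fin (m + (l + 1) + 1) → I) → Fin (l + 1 + 1) → I := fun p =>
    Fin.snoc (ptY (D p.1 p.2) (ini p.2)) (bdCoord (D' p.1 p.2) (p.2 (Fin.last (m + (l + 1)))))
  have cD : Continuous fun p : I × (Fin (m + (l + 1) + 1) → I) => D p.1 p.2 := by
    simp only [D]; fun_prop
  have cD' : Continuous fun p : I × (Fin (m + (l + 1) + 1) → I) => D' p.1 p.2 := by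
    simp only [D']; fun_prop
  have cX : Continuous X := continuous_ptX.comp (cD.prodMk (continuous_init.comp continuous_snd))
  have cY : Continuous Y :=
    Continuous.finSnoc (A := fun _ => I)
      (continuous_ptY.comp (cD.prodMk (continuous_init.comp continuous_snd)))
      (continuous_bdCoord.comp (cD'.prodMk (by fun_prop)))
  -- The moving point stays on the boundary. Up to radius 1/3 it has x_0 = 1. Beyond that, whichever
  -- of r and u is the maximum is left unmoved, and the coordinates that it governs lie on the
  -- boundary.
  have hmem : ∀ p, (X p, Y p) ∈ prodBoundary (m + 1) (l + 1 + 1) := fun p => by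
    by_cases h3 : cubeRad p.2 ≤ 1 / 3
    · have := hD p.1 p.2
      exact Or.inl ⟨0, Or.inr (clamp_of_one_le (by linarith))⟩
    rcases le_total (u p.2) (r p.2) with h | h
    · have hr : cubeRad p.2 = r p.2 := by rw [hR, max_eq_left h]
      have := pt_mem (ini p.2)
      change (ptX (r p.2) _, ptY (r p.2) _) ∈ _ at this
      rw [← hDr p.1 p.2 hr] at this
      exact this.imp_right fun h => snoc_mem_boundary (Or.inl h)
    · have hu : cubeRad p.2 = u p.2 := by rw [hR, max_eq_right h]
      refine Or.inr (snoc_mem_boundary (Or.inr ?_))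
      rw [hDu _ _ hu]
      exact bdCoord_abs (by push Not at h3; rw [hu] at h3; exact h3.le)
  obtain ⟨g'', hg'', hS⟩ := exists_suspLoop_reparam f'
  have hgg'' : GenLoop.Homotopic g' g'' := by
    refine homotopic_of_family (fun p => coll F (X p) (Y p))
      ((continuousOn_coll hF).comp_continuous (cX.prodMk cY) hmem) (fun w => ?_) (fun w => ?_)
      fun t w hw => ?_
    · have h0 : D 0 w = cubeRad w := by simp [D]
      have h0' : D' 0 w = cubeRad w := by simp [D']
      refine Eq.trans ?_ ((hg' w).trans (apply_bd_eq_apply_pt hFb w)).symm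
      congr 1
      · simp only [X, h0]; rfl
      · simp only [Y, h0, h0']
        funext j
        refine Fin.lastCases ?_ (fun j => ?_) j
        · simp [ptY]
        · simp [ptY]
          rfl
    · have h0 : D 1 w = r w := by simp [D]
      have h0' : D' 1 w = u w := by simp [D']
      have h1 : coll F (X (1, w)) (Y (1, w)) = suspPt (coll G (ptX (r w) (ini w))
          (ptY (r w) (ini w))) (bdCoord (u w) (w (Fin.last (m + (l + 1))))) := by
        simp only [X, Y, hcoll, h0, h0']
      change coll F (X (1, w)) (Y (1, w)) = g'' w
      rw [h1, hg'', hf', apply_bd_eq_apply_pt hGb]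
    -- Here max(r, u) = 1. If r = 1 then x_0 = 0, where the collapsed map is constant; if u = 1 the
    -- suspension coordinate is 0 or 1.
    · have hw1 : cubeRad w = 1 := le_antisymm (cubeRad_le w) (cubeRad_boundary hw)
      rcases le_total (u w) (r w) with h | h
      · have hr : cubeRad w = r w := by rw [hR, max_eq_left h]
        refine hFb _ _ ?_
        change clamp (2 - 3 * D t w) = 0
        rw [hDr t w hr, ← hr, hw1]
        exact clamp_of_nonpos (by norm_num)
      · have hu : cubeRad w = u w := by rw [hR, max_eq_right h]
        have hb := bdCoord_abs (a := w (Fin.last (m + (l + 1)))) (by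
          change 1 / 3 ≤ u w; rw [← hu, hw1]; norm_num)
        change bdCoord (u w) _ = 0 ∨ bdCoord (u w) _ = 1 at hb
        simp only [Y, hcoll, hDu _ _ hu]
        rcases hb with hb | hb
        · rw [hb, suspPt_zero]
        · rw [hb, suspPt_one]
  exact ((hgg'.trans hgg'').trans hS).trans (homotopic_suspLoop hff').symm

/-! ### The suspension coordinates of a sphere -/

/-- The orthogonal projection of `ℝ^(k+2)` to the hyperplane `ℝ^(k+1)`. -/
noncomputable def dropNew {k : ℕ} (b : Sph (k + 1)) : EuclideanSpace ℝ (Fin (k + 1)) :=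
  WithLp.toLp 2 fun j => b.1 ((newIdx k).succAbove j)

theorem continuous_dropNew {k : ℕ} : Continuous (dropNew (k := k)) := by
  refine (PiLp.continuous_toLp 2 _).comp (continuous_pi fun j => ?_)
  fun_prop

theorem continuous_newIdx {k : ℕ} : Continuous fun b : Sph (k + 1) => b.1 (newIdx k) := by
  fun_prop

theorem norm_dropNew_sq {k : ℕ} (b : Sph (k + 1)) :
    b.1 (newIdx k) ^ 2 + ‖dropNew b‖ ^ 2 = 1 := by
  have h : ‖b.1‖ ^ 2 = 1 := by simp
  rw [EuclideanSpace.norm_sq_eq, Fin.sum_univ_succAbove _ (newIdx k)] at h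
  rw [EuclideanSpace.norm_sq_eq]
  simpa [dropNew] using h

theorem sph_ext {k : ℕ} {b b' : Sph (k + 1)} (h1 : b.1 (newIdx k) = b'.1 (newIdx k))
    (h2 : dropNew b = dropNew b') : b = b' := by
  apply Subtype.ext
  ext i
  refine (newIdx k).succAboveCases h1 (fun j => ?_) i
  exact congrFun (congrArg WithLp.ofLp h2) j

/-- Off the base point, the ratio of the new coordinate (`suspPt_newIdx`) to the length of this
vector is cot πt. It determines t, and then the vector determines v. -/
theorem dropNew_suspPt {k : ℕ} (v : Sph k) (t : I) :
    (sphBase k).1 - dropNew (suspPt v t) =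
      (Real.sin (Real.pi * t) ^ 2) • ((sphBase k).1 - v.1) := by
  have h : dropNew (suspPt v t) = (1 / 2 : ℝ) • ((sphBase k).1 + v.1) +
      (Real.cos (2 * Real.pi * t) / 2) • ((sphBase k).1 - v.1) := by
    ext j
    simp only [dropNew, suspPt, Fin.insertNth_apply_succAbove]
  have hc : Real.cos (2 * Real.pi * t) = 1 - 2 * Real.sin (Real.pi * t) ^ 2 := by
    rw [mul_assoc, Real.cos_two_mul, Real.cos_sq']; ring
  rw [h, hc]
  module

theorem suspPt_newIdx {k : ℕ} (v : Sph k) (t : I) :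
    (suspPt v t).1 (newIdx k) =
      Real.sin (Real.pi * t) * Real.cos (Real.pi * t) * ‖(sphBase k).1 - v.1‖ := by
  simp only [suspPt, Fin.insertNth_apply_same]
  rw [mul_assoc, Real.sin_two_mul]
  ring

theorem dropNew_base {k : ℕ} : dropNew (sphBase (k + 1)) = (sphBase k).1 := by
  have h := dropNew_suspPt (sphBase k) 0
  rw [suspPt_zero, sub_self, smul_zero, sub_eq_zero] at h
  exact h.symm

theorem base_newIdx {k : ℕ} : (sphBase (k + 1)).1 (newIdx k) = 0 := by
  have h := suspPt_newIdx (sphBase k) 0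
  rw [suspPt_zero] at h
  simpa using h

theorem eq_base_of_dropNew {k : ℕ} {b : Sph (k + 1)} (h : dropNew b = (sphBase k).1) :
    b = sphBase (k + 1) := by
  refine sph_ext ?_ (h.trans dropNew_base.symm)
  have h1 := norm_dropNew_sq b
  rw [h, base_newIdx] at *
  simpa using h1

theorem sin_pi_mul_pos {t : I} (h0 : t ≠ 0) (h1 : t ≠ 1) : 0 < Real.sin (Real.pi * t) := by
  have h0' : (0 : ℝ) < t := unitInterval.pos_iff_ne_zero.2 h0
  have h1' : (t : ℝ) < 1 := unitInterval.lt_one_iff_ne_one.2 h1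
  refine Real.sin_pos_of_pos_of_lt_pi (by positivity) ?_
  nlinarith [Real.pi_pos]

theorem suspPt_ne_base {k : ℕ} {v : Sph k} {t : I} (hv : v ≠ sphBase k) (h0 : t ≠ 0)
    (h1 : t ≠ 1) : suspPt v t ≠ sphBase (k + 1) := by
  intro h
  have h2 := dropNew_suspPt v t
  rw [h, dropNew_base, sub_self, eq_comm, smul_eq_zero] at h2
  rcases h2 with h2 | h2
  · exact (pow_pos (sin_pi_mul_pos h0 h1) 2).ne' h2
  · exact hv (Subtype.ext (sub_eq_zero.1 h2).symm)

theorem suspPt_inj {k : ℕ} {v v' : Sph k} {t t' : I} (h : suspPt v t = suspPt v' t')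
    (hb : suspPt v t ≠ sphBase (k + 1)) : v = v' ∧ t = t' := by
  have hv : v ≠ sphBase k := fun h' => hb (by rw [h', suspPt_base])
  have h0 : t ≠ 0 := fun h' => hb (by rw [h', suspPt_zero])
  have h1 : t ≠ 1 := fun h' => hb (by rw [h', suspPt_one])
  rw [h] at hb
  have hv' : v' ≠ sphBase k := fun h' => hb (by rw [h', suspPt_base])
  have h0' : t' ≠ 0 := fun h' => hb (by rw [h', suspPt_zero])
  have h1' : t' ≠ 1 := fun h' => hb (by rw [h', suspPt_one])
  have hn : ∀ w : Sph k, w ≠ sphBase k → 0 < ‖(sphBase k).1 - w.1‖ := fun w hw =>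
    norm_pos_iff.2 fun h => hw (Subtype.ext (sub_eq_zero.1 h).symm)
  have hS := sin_pi_mul_pos h0 h1
  have hS' := sin_pi_mul_pos h0' h1'
  have e1 := suspPt_newIdx v t
  rw [h, suspPt_newIdx] at e1
  have e2 := dropNew_suspPt v t
  rw [h, dropNew_suspPt] at e2
  have e3 := congrArg norm e2
  rw [norm_smul, norm_smul, Real.norm_of_nonneg (by positivity),
    Real.norm_of_nonneg (by positivity)] at e3
  have hN := hn v hv
  have hN' := hn v' hv'
  -- Equality of the two cotangents, cross-multiplied. Both angles lie in (0, π), so their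
  -- difference must vanish.
  have key : Real.sin (Real.pi * (t' - t)) = 0 := by
    rw [mul_sub, Real.sin_sub]
    have hne : Real.sin (Real.pi * t) * Real.sin (Real.pi * t') * ‖(sphBase k).1 - v.1‖ *
      ‖(sphBase k).1 - v'.1‖ ≠ 0 := by positivity
    apply mul_left_cancel₀ hne
    linear_combination (-Real.sin (Real.pi * t) * Real.cos (Real.pi * t) *
      ‖(sphBase k).1 - v.1‖) * (-e3) - (Real.sin (Real.pi * t) ^ 2 * ‖(sphBase k).1 - v.1‖) * e1
  have ht : (t' : ℝ) - t = 0 := by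
    have b0 : (0 : ℝ) < t := unitInterval.pos_iff_ne_zero.2 h0
    have b1 : (t : ℝ) < 1 := unitInterval.lt_one_iff_ne_one.2 h1
    have b0' : (0 : ℝ) < t' := unitInterval.pos_iff_ne_zero.2 h0'
    have b1' : (t' : ℝ) < 1 := unitInterval.lt_one_iff_ne_one.2 h1'
    have := (Real.sin_eq_zero_iff_of_lt_of_lt (by nlinarith [Real.pi_pos])
      (by nlinarith [Real.pi_pos])).1 key
    exact (mul_eq_zero.1 this).resolve_left Real.pi_ne_zero
  have htt : t = t' := Subtype.ext (sub_eq_zero.1 ht).symm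
  subst htt
  refine ⟨Subtype.ext ?_, rfl⟩
  have := smul_right_injective _ (pow_pos hS 2).ne' e2
  exact (sub_right_injective this).symm

theorem exists_suspPt {k : ℕ} {b : Sph (k + 1)} (hb : b ≠ sphBase (k + 1)) :
    ∃ v t, suspPt v t = b := by
  set e := (sphBase k).1 with he
  set d := ‖e - dropNew b‖ with hd
  have hdpos : 0 < d := norm_pos_iff.2 fun h => hb (eq_base_of_dropNew (sub_eq_zero.1 h).symm)
  -- The value of cot πt for the t to be found. Hence 1 + x² = 1/sin² πt, which dictates both `v`
  -- and `t` below.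
  set x := b.1 (newIdx k) / d with hx
  have hxd : b.1 (newIdx k) = x * d := by rw [hx]; field_simp
  -- The equation ‖b‖ = 1, in the form which gives ‖v‖ = 1.
  have hsq : (1 + x ^ 2) * d ^ 2 = 2 * inner ℝ e (e - dropNew b) := by
    have h1 := norm_dropNew_sq b
    have h2 : d ^ 2 = 1 - 2 * inner ℝ e (dropNew b) + ‖dropNew b‖ ^ 2 := by
      rw [hd, norm_sub_sq_real]
      simp [he]
    have h3 : inner ℝ e e = (1 : ℝ) := by rw [real_inner_self_eq_norm_sq]; simp [he]
    rw [inner_sub_right, h3]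
    rw [hxd] at h1
    linear_combination h1 + h2
  let v : EuclideanSpace ℝ (Fin (k + 1)) := e - (1 + x ^ 2) • (e - dropNew b)
  have hv : ‖v‖ = 1 := by
    have : ‖v‖ ^ 2 = 1 := by
      simp only [v]
      rw [norm_sub_sq_real, norm_smul, real_inner_smul_right, mul_pow, ← hd, Real.norm_eq_abs,
        sq_abs]
      have h3 : ‖e‖ ^ 2 = 1 := by simp [he]
      rw [h3]
      linear_combination (1 + x ^ 2) * hsq
    exact (pow_eq_one_iff_of_nonneg (norm_nonneg v) two_ne_zero).1 this
  have ha1 := Real.arctan_lt_pi_div_two x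
  have ha2 := Real.neg_pi_div_two_lt_arctan x
  have hpi := Real.pi_pos
  let t : I := ⟨(Real.pi / 2 - Real.arctan x) / Real.pi, by
    constructor
    · apply div_nonneg <;> linarith
    · rw [div_le_one hpi]; linarith⟩
  have ht : Real.pi * t = Real.pi / 2 - Real.arctan x := by simp only [t]; field_simp
  have hS : Real.sin (Real.pi * t) ^ 2 = 1 / (1 + x ^ 2) := by
    rw [ht, Real.sin_pi_div_two_sub, Real.cos_sq_arctan]
  have hSC : Real.sin (Real.pi * t) * Real.cos (Real.pi * t) = x / (1 + x ^ 2) := by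
    rw [ht, Real.sin_pi_div_two_sub, Real.cos_pi_div_two_sub, Real.sin_arctan, Real.cos_arctan]
    rw [div_mul_div_comm, one_mul, Real.mul_self_sqrt (by positivity)]
  have hpos : (1 + x ^ 2) ≠ 0 := by positivity
  refine ⟨⟨v, by simpa using hv⟩, t, sph_ext ?_ ?_⟩
  · rw [suspPt_newIdx, hSC, ← he, hxd]
    simp only [v, sub_sub_cancel]
    rw [norm_smul, ← hd, Real.norm_of_nonneg (by positivity)]
    field_simp
  · apply sub_right_injective (b := e)
    dsimp only
    rw [he, dropNew_suspPt, hS, ← he]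
    simp only [v, sub_sub_cancel]
    rw [smul_smul, one_div, inv_mul_cancel₀ hpos, one_smul]

/-! ### The sphere as a quotient of the cube. -/

theorem idLoop_succ_apply {k : ℕ} (z : Fin (k + 1) → I) :
    idLoop (k + 1) z = suspPt (idLoop k (Fin.init z)) (z (Fin.last k)) := rfl

theorem mem_boundary_of_init {N : ℕ} {z : Fin (N + 1) → I}
    (h : Fin.init z ∈ Cube.boundary (Fin N) ∨ z (Fin.last N) = 0 ∨ z (Fin.last N) = 1) :
    z ∈ Cube.boundary (Fin (N + 1)) := by
  rcases h with ⟨i, hi⟩ | h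
  · exact ⟨i.castSucc, hi⟩
  · exact ⟨Fin.last N, h⟩

theorem idLoop_ne_base : ∀ {k : ℕ} {z : Fin k → I}, z ∉ Cube.boundary (Fin k) →
    idLoop k z ≠ sphBase k
  | 0, z, _ => by
    intro h
    have h1 : -(sphBase 0) = sphBase 0 := h
    have h2 := congrArg (fun v : Sph 0 => v.1 0) h1
    simp [sphBase] at h2
    norm_num at h2
  | k + 1, z, hz => by
    have h1 := fun h => hz (mem_boundary_of_init (Or.inl h))
    have h2 := fun h => hz (mem_boundary_of_init (Or.inr (Or.inl h)))
    have h3 := fun h => hz (mem_boundary_of_init (Or.inr (Or.inr h)))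
    exact suspPt_ne_base (idLoop_ne_base h1) h2 h3

theorem idLoop_inj : ∀ {k : ℕ} {z z' : Fin k → I}, idLoop k z = idLoop k z' →
    z ∉ Cube.boundary (Fin k) → z = z'
  | 0, _, _, _, _ => Subsingleton.elim _ _
  | k + 1, z, z', h, hz => by
    have h1 := fun h => hz (mem_boundary_of_init (Or.inl h))
    obtain ⟨e1, e2⟩ := suspPt_inj h (idLoop_ne_base hz)
    rw [← Fin.snoc_init_self z, ← Fin.snoc_init_self z', idLoop_inj e1 h1, e2]

theorem exists_idLoop : ∀ {k : ℕ} {v : Sph k}, v ≠ sphBase k → ∃ z, idLoop k z = v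
  | 0, v, hv => by
    refine ⟨0, ?_⟩
    have hn : ∀ w : Sph 0, w.1 0 = 1 ∨ w.1 0 = -1 := fun w => by
      have h : ‖w.1‖ ^ 2 = 1 := by simp
      rw [EuclideanSpace.norm_sq_eq] at h
      have h' : w.1 0 ^ 2 = 1 := by simpa using h
      exact mul_self_eq_one_iff.1 (by rw [← sq]; exact h')
    have hext : ∀ w w' : Sph 0, w.1 0 = w'.1 0 → w = w' := fun w w' h => by
      apply Subtype.ext
      ext i
      fin_cases i
      exact h
    have hb : (sphBase 0).1 0 = 1 := by simp [sphBase]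
    have hv' : v.1 0 = -1 := (hn v).resolve_left fun h => hv (hext _ _ (h.trans hb.symm))
    refine hext _ _ ?_
    change -((sphBase 0).1 0) = _
    rw [hb, hv']
  | k + 1, b, hb => by
    obtain ⟨v, t, h⟩ := exists_suspPt hb
    have hv : v ≠ sphBase k := fun h' => hb (by rw [← h, h', suspPt_base])
    obtain ⟨z, hz⟩ := exists_idLoop hv
    refine ⟨Fin.snoc z t, ?_⟩
    rw [idLoop_succ_apply, Fin.init_snoc, Fin.snoc_last, hz, h]

/-- A continuous surjection from a compact space to a Hausdorff space is a quotient map. For k = 0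
the base point is not in the image. -/
theorem isQuotientMap_idLoop {k : ℕ} (hk : 0 < k) : Topology.IsQuotientMap (idLoop k) := by
  refine (idLoop k).1.continuous.isClosedMap.isQuotientMap (idLoop k).1.continuous fun v => ?_
  by_cases hv : v = sphBase k
  · exact ⟨0, by rw [hv]; exact (idLoop k).2 _ (zero_mem_boundary hk)⟩
  · exact exists_idLoop hv

/-- A map on the cube which is constant on the boundary descends to the sphere. -/
theorem exists_comp_idLoop {k : ℕ} (hk : 0 < k) {X : Type*} [TopologicalSpace X] {x₀ : X}
    (f : Ω^ (Fin k) X x₀) : ∃ g : C(Sph k, X), ∀ z, g (idLoop k z) = f z := by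
  have hf : ∀ z z', idLoop k z = idLoop k z' → f.1 z = f.1 z' := fun z z' h => by
    by_cases hz : z ∈ Cube.boundary (Fin k)
    · by_cases hz' : z' ∈ Cube.boundary (Fin k)
      · rw [f.2 z hz, f.2 z' hz']
      · rw [idLoop_inj h.symm hz']
    · rw [idLoop_inj h hz]
  have hq : Topology.IsQuotientMap (idLoop k).1 := isQuotientMap_idLoop hk
  refine ⟨hq.lift f.1 hf, fun z => ?_⟩
  exact congrArg (fun g : C(Fin k → I, X) => g z) (hq.lift_comp f.1 hf)

/-! ### Radial projection to the sphere -/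

open Classical in
/-- Radial projection to the unit sphere (and the base point at the origin). -/
noncomputable def radial {k : ℕ} (v : EuclideanSpace ℝ (Fin (k + 1))) : Sph k :=
  if h : v = 0 then sphBase k else
    ⟨‖v‖⁻¹ • v, by
      rw [mem_sphere_zero_iff_norm, norm_smul, norm_inv, norm_norm,
        inv_mul_cancel₀ (norm_ne_zero_iff.2 h)]⟩

theorem coe_radial {k : ℕ} {v : EuclideanSpace ℝ (Fin (k + 1))} (h : v ≠ 0) :
    (radial v).1 = ‖v‖⁻¹ • v := by
  rw [radial, dif_neg h]

theorem continuousOn_radial {k : ℕ} :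
    ContinuousOn (radial (k := k)) {v | v ≠ 0} := by
  rw [Topology.IsInducing.subtypeVal.continuousOn_iff]
  refine ContinuousOn.congr (f := fun v => ‖v‖⁻¹ • v) ?_ fun v hv => coe_radial hv
  exact (continuous_norm.continuousOn.inv₀ fun v hv => norm_ne_zero_iff.2 hv).smul
    continuousOn_id

theorem radial_smul {k : ℕ} {c : ℝ} (hc : 0 < c) (v : Sph k) : radial (c • v.1) = v := by
  have hv : ‖v.1‖ = 1 := by simp
  have hv0 : v.1 ≠ 0 := norm_ne_zero_iff.1 (by rw [hv]; norm_num)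
  apply Subtype.ext
  rw [coe_radial (smul_ne_zero hc.ne' hv0), norm_smul, hv, mul_one, Real.norm_of_nonneg hc.le,
    smul_smul, inv_mul_cancel₀ hc.ne', one_smul]

theorem radial_coe {k : ℕ} (v : Sph k) : radial v.1 = v := by
  simpa using radial_smul one_pos v

theorem rot_radial {k : ℕ} (A : SOGrp (k + 1)) {v : EuclideanSpace ℝ (Fin (k + 1))}
    (hv : v ≠ 0) : rot A (radial v) = radial (matAct A.1 v) := by
  have h : matAct A.1 v ≠ 0 := norm_ne_zero_iff.1 (by rw [norm_matAct]; exact norm_ne_zero_iff.2 hv)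
  apply Subtype.ext
  rw [coe_rot, coe_radial hv, coe_radial h, matAct_smul, norm_matAct]

/-! ### Embedding of a sphere bundle into a trivial vector bundle -/

theorem dropNew_equator {m : ℕ} (x : Sph m) : dropNew (equator x) = x.1 := by
  ext j
  simp only [dropNew, equator, Fin.insertNth_apply_succAbove]

theorem exists_equator {m : ℕ} {b : Sph (m + 1)} (hb : b.1 (newIdx m) = 0) :
    ∃ x, equator x = b := by
  have h := norm_dropNew_sq b
  rw [hb] at h
  have h1 : ‖dropNew b‖ = 1 :=
    (pow_eq_one_iff_of_nonneg (norm_nonneg _) two_ne_zero).1 (by simpa using h)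
  refine ⟨⟨dropNew b, by simpa using h1⟩, sph_ext ?_ ?_⟩
  · rw [equator_newIdx, hb]
  · rw [dropNew_equator]

theorem equator_base {m : ℕ} : equator (sphBase m) = sphBase (m + 1) :=
  sph_ext (by rw [equator_newIdx, base_newIdx]) (by rw [dropNew_equator, dropNew_base])

/-- The radial extension of a clutching function to a map from `S^(m+1)` to matrices. -/
noncomputable def clutchMat {m q : ℕ} (ρ : C(Sph m, SOGrp (q + 1))) (b : Sph (m + 1)) :
    Matrix (Fin (q + 1)) (Fin (q + 1)) ℝ :=
  ‖dropNew b‖ • (ρ (radial (dropNew b))).1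

theorem abs_entry_le_one {n : ℕ} (A : SOGrp n) (i j : Fin n) : |A.1 i j| ≤ 1 := by
  have h := PiLp.norm_apply_le (matAct A.1 (EuclideanSpace.single j 1)) i
  rw [norm_matAct] at h
  simpa [matAct] using h

/-- At the poles the direction has no limit, but the factor ‖dropNew b‖ tends to 0 and orthogonal
matrices have bounded entries. -/
theorem continuous_clutchMat {m q : ℕ} (ρ : C(Sph m, SOGrp (q + 1))) :
    Continuous (clutchMat ρ) := by
  refine continuous_matrix fun i j => continuous_iff_continuousAt.2 fun b => ?_
  have hn : Continuous fun b : Sph (m + 1) => ‖dropNew b‖ := continuous_dropNew.norm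
  obtain ⟨E, hE⟩ : ∃ E : SOGrp (q + 1) → ℝ, ∀ A, E A = A.1 i j := ⟨_, fun _ => rfl⟩
  have he : (fun b => clutchMat ρ b i j) =
      fun b => ‖dropNew b‖ * E (ρ (radial (dropNew b))) := funext fun b => by rw [hE]; rfl
  rw [he]
  by_cases hb : dropNew b = 0
  · have h0 : Filter.Tendsto (fun b : Sph (m + 1) => ‖dropNew b‖) (𝓝 b) (𝓝 0) := by
      have := hn.tendsto b
      rwa [hb, norm_zero] at this
    have h1 : ‖dropNew b‖ * E (ρ (radial (dropNew b))) = 0 := by rw [hb, norm_zero, zero_mul]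
    unfold ContinuousAt
    dsimp only
    rw [h1]
    refine squeeze_zero_norm (a := fun b => ‖dropNew b‖) (fun b => ?_) h0
    rw [norm_mul, norm_norm, hE]
    exact mul_le_of_le_one_right (norm_nonneg _) (abs_entry_le_one _ i j)
  · refine hn.continuousAt.mul ?_
    have h1 : ContinuousAt (fun b : Sph (m + 1) => radial (dropNew b)) b :=
      ContinuousAt.comp (g := radial) (continuousOn_radial.continuousAt
        (isOpen_ne.mem_nhds hb)) continuous_dropNew.continuousAt
    have h2 : Continuous E := by
      rw [funext hE]
      exact (continuous_apply_apply i j).comp continuous_subtype_val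
    exact ContinuousAt.comp (g := fun x => E (ρ x)) (h2.comp ρ.continuous).continuousAt h1

theorem clutchMat_equator {m q : ℕ} (ρ : C(Sph m, SOGrp (q + 1))) (x : Sph m) :
    clutchMat ρ (equator x) = (ρ x).1 := by
  have : ‖x.1‖ = 1 := by simp
  rw [clutchMat, dropNew_equator, this, one_smul, radial_coe]

/-- Let C be the matrix at b. By this identity the adjoint of v ↦ (v, Cv) inverts that map up to a
positive scalar, so it serves as orthogonal projection to the fibre over b. -/
theorem clutchMat_transpose_mul {m q : ℕ} (ρ : C(Sph m, SOGrp (q + 1))) (b : Sph (m + 1))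
    (v : EuclideanSpace ℝ (Fin (q + 1))) :
    matAct (clutchMat ρ b).transpose (matAct (clutchMat ρ b) v) = (‖dropNew b‖ ^ 2) • v := by
  rw [matAct_matAct, clutchMat, Matrix.transpose_smul, Matrix.smul_mul, Matrix.mul_smul,
    transpose_mul_self, smul_smul, smul_matAct, one_matAct, sq]

theorem clutchMat_mul_transpose {m q : ℕ} (ρ : C(Sph m, SOGrp (q + 1))) (b : Sph (m + 1))
    (v : EuclideanSpace ℝ (Fin (q + 1))) :
    matAct (clutchMat ρ b) (matAct (clutchMat ρ b).transpose v) = (‖dropNew b‖ ^ 2) • v := by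
  rw [matAct_matAct, clutchMat, Matrix.transpose_smul, Matrix.smul_mul, Matrix.mul_smul,
    mul_transpose_self, smul_smul, smul_matAct, one_matAct, sq]

section Bundle

variable {m q : ℕ} (ρ : C(Sph m, SOGrp (q + 1)))

/-- The point of the bundle with coordinates `(b, y)` over `D_+`. -/
def posPt (b : hemiPos m) (y : Sph q) : SphBundle ρ := Quot.mk _ (Sum.inl (b, y))

/-- The point of the bundle with coordinates `(b, y)` over `D_-`. -/
def negPt (b : hemiNeg m) (y : Sph q) : SphBundle ρ := Quot.mk _ (Sum.inr (b, y))

theorem continuous_posPt : Continuous fun p : hemiPos m × Sph q => posPt ρ p.1 p.2 :=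
  continuous_quot_mk.comp continuous_inl

theorem continuous_negPt : Continuous fun p : hemiNeg m × Sph q => negPt ρ p.1 p.2 :=
  continuous_quot_mk.comp continuous_inr

theorem posPt_eqPos (x : Sph m) (y : Sph q) :
    posPt ρ (eqPos x) y = negPt ρ (eqNeg x) (rot (ρ x) y) := Quot.sound ⟨x, y, rfl, rfl⟩

theorem fibreIncl_apply (y : Sph q) : fibreIncl ρ y = negPt ρ (eqNeg (sphBase m)) y := rfl

theorem bundleProj_posPt (b : hemiPos m) (y : Sph q) : bundleProj ρ (posPt ρ b y) = b.1 := rfl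

theorem bundleProj_negPt (b : hemiNeg m) (y : Sph q) : bundleProj ρ (negPt ρ b y) = b.1 := rfl

theorem bundleProj_fibreIncl (y : Sph q) : bundleProj ρ (fibreIncl ρ y) = sphBase (m + 1) :=
  equator_base

theorem sphBundle_cases (e : SphBundle ρ) :
    (∃ b y, posPt ρ b y = e) ∨ ∃ b y, negPt ρ b y = e := by
  induction e using Quot.ind with
  | mk a =>
    rcases a with a | a
    · exact Or.inl ⟨a.1, a.2, rfl⟩
    · exact Or.inr ⟨a.1, a.2, rfl⟩

/-- The bundle as a subspace of a trivial vector bundle of rank `2(q+1)`. -/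
noncomputable def bundleEmb : SphBundle ρ →
    EuclideanSpace ℝ (Fin (q + 1)) × EuclideanSpace ℝ (Fin (q + 1)) :=
  Quot.lift (Sum.elim (fun a => (a.2.1, matAct (clutchMat ρ a.1.1) a.2.1))
    (fun a => (matAct (clutchMat ρ a.1.1).transpose a.2.1, a.2.1))) (by
    rintro _ _ ⟨x, y, rfl, rfl⟩
    have h : matAct (ρ x).1.transpose (matAct (ρ x).1 y.1) = y.1 := by
      rw [matAct_matAct, transpose_mul_self, one_matAct]
    simp only [Sum.elim_inl, Sum.elim_inr, eqPos, eqNeg, clutchMat_equator, coe_rot, h])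

theorem bundleEmb_posPt (b : hemiPos m) (y : Sph q) :
    bundleEmb ρ (posPt ρ b y) = (y.1, matAct (clutchMat ρ b.1) y.1) := rfl

theorem bundleEmb_negPt (b : hemiNeg m) (y : Sph q) :
    bundleEmb ρ (negPt ρ b y) = (matAct (clutchMat ρ b.1).transpose y.1, y.1) := rfl

theorem continuous_bundleEmb : Continuous (bundleEmb ρ) := by
  have c := continuous_clutchMat ρ
  refine continuous_quot_lift _ (continuous_sum_dom.2 ⟨?_, ?_⟩)
  · refine Continuous.prodMk (by fun_prop) (continuous_matAct.comp (Continuous.prodMk ?_ ?_))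
    · exact c.comp (by fun_prop)
    · fun_prop
  · refine Continuous.prodMk (continuous_matAct.comp (Continuous.prodMk ?_ ?_)) (by fun_prop)
    · exact (c.comp (by fun_prop)).matrix_transpose
    · fun_prop

/-- In each chart one component of `bundleEmb` is the fibre coordinate itself. Points of different
charts with the same projection lie over the equator, where the clutching relation identifies them.
-/
theorem bundleEmb_injective {e e' : SphBundle ρ} (h : bundleEmb ρ e = bundleEmb ρ e')
    (hb : bundleProj ρ e = bundleProj ρ e') : e = e' := by
  have key : ∀ (b : hemiPos m) (b' : hemiNeg m) (y y' : Sph q),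
      bundleEmb ρ (posPt ρ b y) = bundleEmb ρ (negPt ρ b' y') → b.1 = b'.1 →
      posPt ρ b y = negPt ρ b' y' := by
    rintro ⟨b, hb⟩ ⟨b', hb'⟩ y y' h hbb
    dsimp only at hbb
    subst hbb
    obtain ⟨x, rfl⟩ := exists_equator (le_antisymm hb' hb)
    have h2 := congrArg Prod.snd h
    rw [bundleEmb_posPt, bundleEmb_negPt, clutchMat_equator] at h2
    have : y' = rot (ρ x) y := Subtype.ext h2.symm
    rw [this]
    exact posPt_eqPos ρ x y
  rcases sphBundle_cases ρ e with ⟨b, y, rfl⟩ | ⟨b, y, rfl⟩ <;>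
    rcases sphBundle_cases ρ e' with ⟨b', y', rfl⟩ | ⟨b', y', rfl⟩
  · have h1 : b = b' := Subtype.ext hb
    have h2 : y = y' := Subtype.ext (congrArg Prod.fst h)
    rw [h1, h2]
  · exact key _ _ _ _ h hb
  · exact (key _ _ _ _ h.symm hb.symm).symm
  · have h1 : b = b' := Subtype.ext hb
    have h2 : y = y' := Subtype.ext (congrArg Prod.snd h)
    rw [h1, h2]

/-- Together with compactness of the fibre, this makes the inclusion of the fibre a closed
embedding, so that maps into the fibre can be lifted continuously. -/
instance : T2Space (SphBundle ρ) :=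
  T2Space.of_injective_continuous (f := fun e => (bundleProj ρ e, bundleEmb ρ e))
    (fun _ _ h => bundleEmb_injective ρ (congrArg Prod.snd h) (congrArg Prod.fst h))
    ((bundleProj ρ).continuous.prodMk (continuous_bundleEmb ρ))

instance : CompactSpace (SphBundle ρ) := by
  have h1 : CompactSpace (hemiPos m) := isCompact_iff_compactSpace.1
    (isClosed_le continuous_const continuous_newIdx).isCompact
  have h2 : CompactSpace (hemiNeg m) := isCompact_iff_compactSpace.1
    (isClosed_le continuous_newIdx continuous_const).isCompact
  exact inferInstanceAs (CompactSpace (Quot (clutchRel ρ)))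

theorem fibreIncl_injective : Function.Injective (fibreIncl ρ) := fun _ _ h =>
  Subtype.ext (congrArg (fun e => (bundleEmb ρ e).2) h)

theorem exists_fibreIncl (hρ : ρ (sphBase m) = 1) {e : SphBundle ρ}
    (he : bundleProj ρ e = sphBase (m + 1)) : ∃ y, fibreIncl ρ y = e := by
  rcases sphBundle_cases ρ e with ⟨b, y, rfl⟩ | ⟨b, y, rfl⟩ <;> refine ⟨y, ?_⟩
  · have hb : b = eqPos (sphBase m) := Subtype.ext (he.trans equator_base.symm)
    rw [hb, posPt_eqPos, hρ, rot_one, fibreIncl_apply]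
  · have hb : b = eqNeg (sphBase m) := Subtype.ext (he.trans equator_base.symm)
    rw [hb, fibreIncl_apply]

/-- A map into the fibre over the base point factors through the inclusion of the fibre. -/
theorem exists_lift_fibre (hρ : ρ (sphBase m) = 1) {X : Type*} [TopologicalSpace X]
    (g : C(X, SphBundle ρ)) (hg : ∀ x, bundleProj ρ (g x) = sphBase (m + 1)) :
    ∃ k : C(X, Sph q), ∀ x, fibreIncl ρ (k x) = g x := by
  choose k hk using fun x => exists_fibreIncl ρ hρ (hg x)
  have hemb := (fibreIncl ρ).continuous.isClosedEmbedding (fibreIncl_injective ρ)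
  refine ⟨⟨k, hemb.continuous_iff.2 ?_⟩, hk⟩
  convert g.continuous using 1
  exact funext hk

end Bundle

/-! ### Transport to nearby fibres -/

section Transport

variable {m q : ℕ} (ρ : C(Sph m, SOGrp (q + 1)))

/-- The vector over `b ∈ D_+` closest to a point of the bundle, in the coordinates over `D_+`. -/
noncomputable def posVec (e : SphBundle ρ) (b : Sph (m + 1)) : EuclideanSpace ℝ (Fin (q + 1)) :=
  (bundleEmb ρ e).1 + matAct (clutchMat ρ b).transpose (bundleEmb ρ e).2

/-- The vector over `b ∈ D_-` closest to a point of the bundle, in the coordinates over `D_-`. -/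
noncomputable def negVec (e : SphBundle ρ) (b : Sph (m + 1)) : EuclideanSpace ℝ (Fin (q + 1)) :=
  matAct (clutchMat ρ b) (bundleEmb ρ e).1 + (bundleEmb ρ e).2

theorem continuous_posVec :
    Continuous fun p : SphBundle ρ × Sph (m + 1) => posVec ρ p.1 p.2 := by
  have c := continuous_bundleEmb ρ
  have c' := continuous_clutchMat ρ
  refine Continuous.add (by fun_prop) (continuous_matAct.comp (Continuous.prodMk ?_ (by fun_prop)))
  exact (c'.comp continuous_snd).matrix_transpose

theorem continuous_negVec :
    Continuous fun p : SphBundle ρ × Sph (m + 1) => negVec ρ p.1 p.2 := by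
  have c := continuous_bundleEmb ρ
  have c' := continuous_clutchMat ρ
  refine Continuous.add (continuous_matAct.comp (Continuous.prodMk ?_ (by fun_prop))) (by fun_prop)
  exact c'.comp continuous_snd

theorem mem_hemiPos_or_hemiNeg (b : Sph (m + 1)) : b ∈ hemiPos m ∨ b ∈ hemiNeg m := by
  unfold hemiPos hemiNeg
  exact le_total 0 (b.1 (newIdx m))

/-- The condition under which transport is defined. -/
def CanTransport (e : SphBundle ρ) (b : Sph (m + 1)) : Prop :=
  (b ∈ hemiPos m → posVec ρ e b ≠ 0) ∧ (b ∈ hemiNeg m → negVec ρ e b ≠ 0)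

open Classical in
/-- Transport of a point of the bundle to the fibre over `b`. -/
noncomputable def transport (e : SphBundle ρ) (b : Sph (m + 1)) : SphBundle ρ :=
  if h : b ∈ hemiPos m then posPt ρ ⟨b, h⟩ (radial (posVec ρ e b))
  else negPt ρ ⟨b, (not_le.1 (show ¬(0 : ℝ) ≤ b.1 (newIdx m) from h)).le⟩ (radial (negVec ρ e b))

variable {ρ}

/-- Over the equator the projections in the two charts correspond under clutching, which makes
`transport` independent of the chart. -/
theorem matAct_posVec {e : SphBundle ρ} {x : Sph m} :
    matAct (ρ x).1 (posVec ρ e (equator x)) = negVec ρ e (equator x) := by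
  rw [posVec, negVec, matAct_add, clutchMat_equator, matAct_matAct, mul_transpose_self,
    one_matAct]

theorem transport_of_neg {e : SphBundle ρ} {b : Sph (m + 1)} (hc : CanTransport ρ e b)
    (h : b ∈ hemiNeg m) : transport ρ e b = negPt ρ ⟨b, h⟩ (radial (negVec ρ e b)) := by
  by_cases h' : b ∈ hemiPos m
  · rw [transport, dif_pos h']
    obtain ⟨x, rfl⟩ := exists_equator (le_antisymm h h')
    exact (posPt_eqPos ρ x _).trans (by rw [rot_radial _ (hc.1 h'), matAct_posVec]; rfl)
  · exact dif_neg h'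

theorem bundleProj_transport (e : SphBundle ρ) (b : Sph (m + 1)) :
    bundleProj ρ (transport ρ e b) = b := by
  unfold transport
  split_ifs <;> rfl

/-- If y is the coordinate of e in a chart containing its projection b, then projecting to the fibre
over b gives (1 + ‖dropNew b‖²)y, which is nonzero with radial projection y. -/
theorem canTransport_and_transport_self (e : SphBundle ρ) :
    CanTransport ρ e (bundleProj ρ e) ∧ transport ρ e (bundleProj ρ e) = e := by
  have hne : ∀ y : Sph q, y.1 ≠ 0 := fun y => norm_ne_zero_iff.1 (by simp)
  have hpos : ∀ b : Sph (m + 1), (0 : ℝ) < 1 + ‖dropNew b‖ ^ 2 := fun b => by positivity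
  have heq : ∀ x : Sph m, posVec ρ e (equator x) = 0 ↔ negVec ρ e (equator x) = 0 := fun x => by
    
    rw [← norm_eq_zero, ← norm_eq_zero (a := negVec ρ e (equator x)), ← matAct_posVec,
      norm_matAct]
  rcases sphBundle_cases ρ e with ⟨b, y, rfl⟩ | ⟨b, y, rfl⟩
  · rw [bundleProj_posPt]
    have h1 : posVec ρ (posPt ρ b y) b.1 = (1 + ‖dropNew b.1‖ ^ 2) • y.1 := by
      rw [posVec, bundleEmb_posPt, clutchMat_transpose_mul, add_smul, one_smul]
    have h2 : posVec ρ (posPt ρ b y) b.1 ≠ 0 := by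
      rw [h1]; exact smul_ne_zero (hpos _).ne' (hne y)
    refine ⟨⟨fun _ => h2, fun hn h => h2 ?_⟩, ?_⟩
    · obtain ⟨x, hx⟩ := exists_equator (le_antisymm hn b.2)
      rw [← hx] at h ⊢
      exact (heq x).2 h
    · rw [transport, dif_pos b.2, h1, radial_smul (hpos _)]
  · rw [bundleProj_negPt]
    have h1 : negVec ρ (negPt ρ b y) b.1 = (1 + ‖dropNew b.1‖ ^ 2) • y.1 := by
      rw [negVec, bundleEmb_negPt, clutchMat_mul_transpose, add_smul, one_smul]
      exact add_comm _ _
    have h2 : negVec ρ (negPt ρ b y) b.1 ≠ 0 := by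
      rw [h1]; exact smul_ne_zero (hpos _).ne' (hne y)
    have hc : CanTransport ρ (negPt ρ b y) b.1 := by
      refine ⟨fun hp h => h2 ?_, fun _ => h2⟩
      obtain ⟨x, hx⟩ := exists_equator (le_antisymm b.2 hp)
      rw [← hx] at h ⊢
      exact (heq x).1 h
    exact ⟨hc, by rw [transport_of_neg hc b.2, h1, radial_smul (hpos _)]⟩

theorem transport_self (e : SphBundle ρ) : transport ρ e (bundleProj ρ e) = e :=
  (canTransport_and_transport_self e).2

theorem continuous_transport {X : Type*} [TopologicalSpace X] {e : X → SphBundle ρ}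
    {b : X → Sph (m + 1)} (he : Continuous e) (hb : Continuous b)
    (hc : ∀ x, CanTransport ρ (e x) (b x)) : Continuous fun x => transport ρ (e x) (b x) := by
  have hA : IsClosed {x | b x ∈ hemiPos m} :=
    isClosed_le continuous_const (continuous_newIdx.comp hb)
  have hB : IsClosed {x | b x ∈ hemiNeg m} :=
    isClosed_le (continuous_newIdx.comp hb) continuous_const
  have cpos : Continuous fun x => posVec ρ (e x) (b x) :=
    (continuous_posVec ρ).comp (f := fun x => (e x, b x)) (he.prodMk hb)
  have cneg : Continuous fun x => negVec ρ (e x) (b x) :=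
    (continuous_negVec ρ).comp (f := fun x => (e x, b x)) (he.prodMk hb)
  have cA : ContinuousOn (fun x => transport ρ (e x) (b x)) {x | b x ∈ hemiPos m} := by
    rw [continuousOn_iff_continuous_domRestrict]
    have h : ({x | b x ∈ hemiPos m}).domRestrict (fun x => transport ρ (e x) (b x)) =
        fun x => posPt ρ ⟨b x.1, x.2⟩ (radial (posVec ρ (e x.1) (b x.1))) :=
      funext fun x => dif_pos x.2
    rw [h]
    refine (continuous_posPt ρ).comp (Continuous.prodMk
      ((hb.comp continuous_subtype_val).subtype_mk _) ?_)
    refine continuousOn_radial.comp_continuous ?_ fun x => (hc x.1).1 x.2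
    exact cpos.comp continuous_subtype_val
  have cB : ContinuousOn (fun x => transport ρ (e x) (b x)) {x | b x ∈ hemiNeg m} := by
    rw [continuousOn_iff_continuous_domRestrict]
    have h : ({x | b x ∈ hemiNeg m}).domRestrict (fun x => transport ρ (e x) (b x)) =
        fun x => negPt ρ ⟨b x.1, x.2⟩ (radial (negVec ρ (e x.1) (b x.1))) :=
      funext fun x => transport_of_neg (hc x.1) x.2
    rw [h]
    refine (continuous_negPt ρ).comp (Continuous.prodMk
      ((hb.comp continuous_subtype_val).subtype_mk _) ?_)
    refine continuousOn_radial.comp_continuous ?_ fun x => (hc x.1).2 x.2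
    exact cneg.comp continuous_subtype_val
  rw [← continuousOn_univ]
  refine (cA.union_of_isClosed cB hA hB).mono fun x _ => ?_
  exact mem_hemiPos_or_hemiNeg (b x)

variable (ρ) in
-- The pairs (e, b) for which a projected vector vanishes form a compact set containing no pair with
-- b = p(e). The distance from b to p(e) therefore has a positive minimum on it.
theorem exists_canTransport : ∃ ε > 0, ∀ (e : SphBundle ρ) (b : Sph (m + 1)),
    dist b (bundleProj ρ e) < ε → CanTransport ρ e b := by
  let K : Set (SphBundle ρ × Sph (m + 1)) :=
    {p | p.2 ∈ hemiPos m ∧ posVec ρ p.1 p.2 = 0} ∪ {p | p.2 ∈ hemiNeg m ∧ negVec ρ p.1 p.2 = 0}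
  have hnew : Continuous fun p : SphBundle ρ × Sph (m + 1) => p.2.1 (newIdx m) :=
    continuous_newIdx.comp continuous_snd
  have hK : IsCompact K := by
    refine IsClosed.isCompact (IsClosed.union (IsClosed.inter ?_ ?_) (IsClosed.inter ?_ ?_))
    · exact isClosed_le continuous_const hnew
    · exact isClosed_eq (continuous_posVec ρ) continuous_const
    · exact isClosed_le hnew continuous_const
    · exact isClosed_eq (continuous_negVec ρ) continuous_const
  have hKc : ∀ e b, (e, b) ∉ K → CanTransport ρ e b := fun e b h =>
    ⟨fun h1 h2 => h (Or.inl ⟨h1, h2⟩), fun h1 h2 => h (Or.inr ⟨h1, h2⟩)⟩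
  rcases K.eq_empty_or_nonempty with h | h
  · exact ⟨1, one_pos, fun e b _ => hKc e b (by simp [h])⟩
  · obtain ⟨p, hp, hmin⟩ := hK.exists_isMinOn h
      (f := fun p : SphBundle ρ × Sph (m + 1) => dist p.2 (bundleProj ρ p.1)) (by fun_prop)
    refine ⟨dist p.2 (bundleProj ρ p.1), dist_pos.2 fun h => ?_, fun e b hd => hKc e b fun h => ?_⟩
    swap
    · have h1 : dist p.2 (bundleProj ρ p.1) ≤ dist b (bundleProj ρ e) :=
        isMinOn_iff.1 hmin (e, b) h
      exact lt_irrefl _ (hd.trans_le h1)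
    have hc := (canTransport_and_transport_self p.1).1
    rw [← h] at hc
    rcases hp with hp | hp
    · exact hc.1 hp.1 hp.2
    · exact hc.2 hp.1 hp.2

/-! ### Homotopy lifting, and its use for the inclusion of the fibre. -/

variable (ρ) in
/-- Homotopy lifting for a sphere bundle; the lift is stationary wherever the homotopy is. -/
theorem exists_homotopy_lift {X : Type*} [PseudoMetricSpace X] [CompactSpace X]
    (H : C(X × I, Sph (m + 1))) (f : C(X, SphBundle ρ))
    (hf : ∀ x, bundleProj ρ (f x) = H (x, 0)) :
    ∃ F : C(X × I, SphBundle ρ), (∀ p, bundleProj ρ (F p) = H p) ∧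
      ∀ x, (∀ t, H (x, t) = H (x, 0)) → ∀ t, F (x, t) = f x := by
  obtain ⟨ε, hε, hT⟩ := exists_canTransport ρ
  obtain ⟨δ, hδ, hH⟩ := Metric.uniformContinuous_iff.1
    (CompactSpace.uniformContinuous_of_continuous H.continuous) ε hε
  obtain ⟨N, hN⟩ := exists_nat_one_div_lt hδ
  -- Time stopped at j/(N + 1). The j-th lift covers the homotopy run in this stopped time, and
  -- passing to the next one moves points of the base by less than ε.
  let c : ℕ → I → I := fun j t => ⟨min t (j / (N + 1)),
    le_min t.2.1 (by positivity), min_le_of_left_le t.2.2⟩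
  have hc0 : ∀ t, c 0 t = 0 := fun t => Subtype.ext (by simpa [c] using t.2.1)
  have hcN : ∀ t, c (N + 1) t = t := fun t => Subtype.ext (by
    have : ((N : ℝ) + 1) / (N + 1) = 1 := div_self (by positivity)
    simpa [c, this] using t.2.2)
  have hc : ∀ j t, dist (c (j + 1) t) (c j t) < δ := fun j t => by
    refine lt_of_le_of_lt ?_ hN
    change |min (t : ℝ) (((j + 1 : ℕ) : ℝ) / (N + 1)) - min (t : ℝ) (j / (N + 1))| ≤ _
    refine (abs_min_sub_min_le_max _ _ _ _).trans ?_
    rw [sub_self, abs_zero, Nat.cast_add, Nat.cast_one, add_div, add_sub_cancel_left,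
      abs_of_nonneg (by positivity)]
    exact max_le (by positivity) le_rfl
  have cc : ∀ j, Continuous (c j) := fun j => Continuous.subtype_mk (by fun_prop) _
  have key : ∀ j, ∃ F : C(X × I, SphBundle ρ),
      (∀ p, bundleProj ρ (F p) = H (p.1, c j p.2)) ∧
      ∀ x, (∀ t, H (x, t) = H (x, 0)) → ∀ t, F (x, t) = f x := by
    intro j
    induction j with
    | zero =>
      refine ⟨f.comp ContinuousMap.fst, fun p => ?_, fun x _ t => rfl⟩
      rw [hc0]
      exact hf p.1
    | succ j ih =>
      obtain ⟨F, hF1, hF2⟩ := ih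
      refine ⟨⟨fun p => transport ρ (F p) (H (p.1, c (j + 1) p.2)),
        continuous_transport F.continuous (H.continuous.comp
          (continuous_fst.prodMk ((cc _).comp continuous_snd))) fun p => hT _ _ ?_⟩,
        fun p => bundleProj_transport _ _, fun x hx t => ?_⟩
      · rw [hF1]
        refine hH ?_
        rw [Prod.dist_eq, dist_self]
        exact max_lt hδ (hc j p.2)
      -- Where the homotopy is stationary, a point is transported to its own fibre, hence to itself.
      · change transport ρ (F (x, t)) (H (x, c (j + 1) t)) = f x
        rw [hF2 x hx, hx, ← hf]
        exact transport_self _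
  obtain ⟨F, hF1, hF2⟩ := key (N + 1)
  exact ⟨F, fun p => by rw [hF1, hcN], hF2⟩

/-- If the bundle has a based section, the inclusion of the fibre detects null-homotopies. -/
theorem homotopic_const_of_fibreIncl (hρ : ρ (sphBase m) = 1)
    {s : C(Sph (m + 1), SphBundle ρ)} (hs : IsBasedSection ρ s) {N : ℕ}
    {f : Ω^ (Fin N) (Sph q) (sphBase q)}
    (h : GenLoop.Homotopic (loopMap (fibreIncl ρ) rfl f) GenLoop.const) :
    GenLoop.Homotopic f GenLoop.const := by
  obtain ⟨H⟩ := h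
  set e₀ := fibreIncl ρ (sphBase q) with he₀
  have hpe : bundleProj ρ e₀ = sphBase (m + 1) := bundleProj_fibreIncl ρ _
  have H0 : ∀ z, H (0, z) = fibreIncl ρ (f z) := fun z => H.apply_zero z
  have H1 : ∀ z, H (1, z) = e₀ := fun z => H.apply_one z
  have Hb : ∀ t, ∀ z ∈ Cube.boundary (Fin N), H (t, z) = e₀ := fun t z hz =>
    (H.eq_fst t hz).trans (GenLoop.boundary (loopMap (fibreIncl ρ) rfl f) z hz)
  let h : I × (Fin N → I) → Sph (m + 1) := fun p => bundleProj ρ (H p)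
  have ch : Continuous h := (bundleProj ρ).continuous.comp H.continuous
  -- The null-homotopy, followed by the section over its reversed projection. Its ends are still the
  -- given loop and a constant, but its projection is h run forwards and back (along the tent
  -- function `φ`), so shrinking `φ` contracts that projection.
  let S : I × (Fin N → I) → SphBundle ρ := fun p =>
    if (p.1 : ℝ) ≤ 1 / 2 then H (clamp (2 * p.1), p.2) else s (h (clamp (2 - 2 * p.1), p.2))
  have cl1 : Continuous fun p : I × (Fin N → I) => clamp (2 * p.1) :=
    continuous_clamp.comp (by fun_prop)
  have cl2 : Continuous fun p : I × (Fin N → I) => clamp (2 - 2 * p.1) :=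
    continuous_clamp.comp (by fun_prop)
  have cS : Continuous S := by
    refine Continuous.if_le (H.continuous.comp (cl1.prodMk continuous_snd))
      (s.continuous.comp (ch.comp (cl2.prodMk continuous_snd))) (by fun_prop) continuous_const ?_
    intro p hp
    dsimp only [h]
    rw [hp, clamp_of_one_le (by norm_num), clamp_of_one_le (by norm_num), H1, hpe, hs.2]
  let φ : I → I := fun t => clamp (min (2 * t) (2 - 2 * t))
  have cφ : Continuous φ := continuous_clamp.comp (by fun_prop)
  have hpS : ∀ p, bundleProj ρ (S p) = h (φ p.1, p.2) := fun p => by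
    simp only [S, φ]
    split_ifs with hp
    · rw [min_eq_left (by linarith)]
    · rw [min_eq_right (by linarith), hs.1]
  let B : C((I × (Fin N → I)) × I, Sph (m + 1)) :=
    ⟨fun p => h (φ p.1.1 * σ p.2, p.1.2), ch.comp (by fun_prop)⟩
  -- The lift ends in the fibre over the base point. The contraction `B` is stationary at both ends
  -- of the time interval and over the cube boundary, so the values of `S` survive there.
  obtain ⟨F, hF1, hF2⟩ := exists_homotopy_lift ρ B ⟨S, cS⟩ fun p => by
    change bundleProj ρ (S p) = h (φ p.1 * σ 0, p.2)
    rw [hpS, unitInterval.symm_zero, mul_one]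
  have h0 : ∀ z, h (0, z) = sphBase (m + 1) := fun z => by
    change bundleProj ρ (H (0, z)) = _
    rw [H0, bundleProj_fibreIncl]
  obtain ⟨k, hk⟩ := exists_lift_fibre ρ hρ
    (F.comp ((ContinuousMap.id _).prodMk (ContinuousMap.const _ 1))) fun p => by
      change bundleProj ρ (F (p, 1)) = _
      rw [hF1]
      change h (φ p.1 * σ 1, p.2) = _
      rw [unitInterval.symm_one, mul_zero, h0]
  have hk' : ∀ p, (∀ t, B (p, t) = sphBase (m + 1)) → fibreIncl ρ (k p) = S p := fun p hp => by
    rw [hk]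
    exact hF2 p (fun t => by rw [hp, hp]) 1
  have hφ : ∀ t z, φ t = 0 → ∀ r, B ((t, z), r) = sphBase (m + 1) := fun t z ht r => by
    change h (φ t * σ r, z) = _
    rw [ht, zero_mul, h0]
  refine homotopic_of_family k k.continuous (fun z => ?_) (fun z => ?_) fun t z hz => ?_
  · refine fibreIncl_injective ρ ((hk' _ (hφ 0 z (clamp_of_nonpos (by simp)))).trans ?_)
    simp only [S]
    rw [if_pos (by norm_num), clamp_of_nonpos (by simp), H0]
  · refine fibreIncl_injective ρ ((hk' _ (hφ 1 z (clamp_of_nonpos (by norm_num)))).trans ?_)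
    simp only [S]
    rw [if_neg (by norm_num), clamp_of_nonpos (by norm_num), h0, hs.2]
    rfl
  · refine fibreIncl_injective ρ ((hk' _ fun r => ?_).trans ?_)
    · change bundleProj ρ (H (_, z)) = _
      rw [Hb _ z hz, hpe]
    · simp only [S, h]
      rw [Hb _ z hz, Hb _ z hz, hpe, hs.2, ite_self]

end Transport

/-! ### Induced homomorphisms and inverses -/

theorem loopMap_transAt {N X Y : Type*} [DecidableEq N] [TopologicalSpace X] [TopologicalSpace Y]
    {x : X} {y : Y} (f : C(X, Y)) (hf : f x = y) (i : N) (a b : Ω^ N X x) :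
    loopMap f hf (GenLoop.transAt i a b) =
      GenLoop.transAt i (loopMap f hf a) (loopMap f hf b) := by
  refine GenLoop.ext _ _ fun z => ?_
  change f (if _ then _ else _) = if _ then f _ else f _
  rw [apply_ite f]
  rfl

theorem piMap_mul {N X Y : Type*} [DecidableEq N] [Nonempty N] [TopologicalSpace X]
    [TopologicalSpace Y] {x : X} {y : Y} (f : C(X, Y)) (hf : f x = y)
    (a b : HomotopyGroup N X x) : piMap f hf (a * b) = piMap f hf a * piMap f hf b := by
  induction a using Quotient.inductionOn with | _ a =>
  induction b using Quotient.inductionOn with | _ b =>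
  have i := Classical.arbitrary N
  have h1 := HomotopyGroup.mul_spec (i := i) (p := a) (q := b)
  have h2 := HomotopyGroup.mul_spec (i := i) (p := loopMap f hf a) (q := loopMap f hf b)
  refine (congrArg (piMap f hf) h1).trans (Eq.trans ?_ h2.symm)
  change (⟦loopMap f hf (GenLoop.transAt i b a)⟧ : HomotopyGroup N Y y) = _
  rw [loopMap_transAt]

/-- The homomorphism of homotopy groups induced by a based map. -/
noncomputable def piHom {N X Y : Type*} [DecidableEq N] [Nonempty N] [TopologicalSpace X]
    [TopologicalSpace Y] {x : X} {y : Y} (f : C(X, Y)) (hf : f x = y) :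
    HomotopyGroup N X x →* HomotopyGroup N Y y :=
  MonoidHom.mk' (piMap f hf) (piMap_mul f hf)

theorem suspension_inv {N k : ℕ} [Nonempty (Fin N)] (a : π_ N (Sph k) (sphBase k)) :
    suspension a⁻¹ = (suspension a)⁻¹ := by
  induction a using Quotient.inductionOn with | _ a =>
  have i := Classical.arbitrary (Fin N)
  have h1 := HomotopyGroup.inv_spec (i := i) (p := a)
  have h2 := HomotopyGroup.inv_spec (i := i.castSucc) (p := suspLoop a)
  refine (congrArg suspension h1).trans (Eq.trans ?_ h2.symm)
  change (⟦suspLoop (GenLoop.symmAt i a)⟧ : π_ (N + 1) (Sph (k + 1)) (sphBase (k + 1))) = _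
  rw [suspLoop_symmAt]

/-- The inclusion of the fibre of a sphere bundle with a based section is injective on homotopy
groups. -/
theorem piMap_fibreIncl_injective {m q : ℕ} {ρ : C(Sph m, SOGrp (q + 1))}
    (hρ : ρ (sphBase m) = 1) {s : C(Sph (m + 1), SphBundle ρ)} (hs : IsBasedSection ρ s) {N : ℕ}
    [Nonempty (Fin N)] : Function.Injective (piHom (N := Fin N) (fibreIncl ρ)
      (rfl : fibreIncl ρ (sphBase q) = fibreIncl ρ (sphBase q))) := by
  rw [injective_iff_map_eq_one]
  intro a ha
  induction a using Quotient.inductionOn with | _ a =>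
  exact Quotient.sound (homotopic_const_of_fibreIncl hρ hs (Quotient.exact ha))

/-! ### The extension of a map to the boundary of the cube -/

theorem faceExt_of_last {m k : ℕ} (r : (Fin m → I) → SOGrp k) {x : Fin (m + 1) → I}
    (hx : x (Fin.last m) = 1) : faceExt r x = r (Fin.init x) := if_pos hx

theorem faceExt_of_ne {m k : ℕ} (r : (Fin m → I) → SOGrp k) {x : Fin (m + 1) → I}
    (hx : x (Fin.last m) ≠ 1) : faceExt r x = 1 := if_neg hx

theorem faceExt_zero {m k : ℕ} (r : (Fin m → I) → SOGrp k) : faceExt r 0 = 1 :=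
  faceExt_of_ne r zero_ne_one

theorem faceExt_soIncl {m k : ℕ} (r : (Fin m → I) → SOGrp k) (x : Fin (m + 1) → I) :
    soIncl k (faceExt r x) = faceExt (fun z => soIncl k (r z)) x := by
  unfold faceExt
  rw [apply_ite (soIncl k), soIncl_one]

theorem continuousOn_rot_faceExt {T : Type*} [TopologicalSpace T] {m k : ℕ}
    {r : T → (Fin m → I) → SOGrp (k + 1)}
    (hrc : Continuous fun p : T × (Fin m → I) => r p.1 p.2)
    (hr : ∀ t, ∀ x ∈ Cube.boundary (Fin m), r t x = 1) :
    ContinuousOn (fun p : T × ((Fin (m + 1) → I) × (Fin k → I)) =>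
      rot (faceExt (r p.1) p.2.1) (idLoop k p.2.2))
      {p | p.2.1 ∈ Cube.boundary (Fin (m + 1))} := by
  have h1 : ContinuousOn (fun p : T × ((Fin (m + 1) → I) × (Fin k → I)) =>
      faceExt (r p.1) p.2.1) {p | p.2.1 ∈ Cube.boundary (Fin (m + 1))} :=
    (continuousOn_faceExt hrc hr).comp
      (f := fun p : T × ((Fin (m + 1) → I) × (Fin k → I)) => (p.1, p.2.1))
      (by fun_prop) fun _ hp => hp
  refine continuous_rot.comp_continuousOn (f := fun p : T × ((Fin (m + 1) → I) × (Fin k → I)) =>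
    (faceExt (r p.1) p.2.1, idLoop k p.2.2)) (h1.prodMk ?_)
  exact ((idLoop k).1.continuous.comp (by fun_prop)).continuousOn

theorem ContinuousOn.of_unit {A X : Type*} [TopologicalSpace A] [TopologicalSpace X]
    {f : A → X} {S : Set A}
    (h : ContinuousOn (fun p : Unit × A => f p.2) {p | p.2 ∈ S}) : ContinuousOn f S :=
  h.comp (f := fun a => ((), a)) (by fun_prop) fun _ ha => ha

theorem jLoop_apply {m k : ℕ} (hk : 0 < k) (ρ : Ω^ (Fin m) (SOGrp k) 1) (z : Fin (m + k) → I) :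
    jLoop hk ρ z = glue (fun _ => sphBase k)
      (fun x y => rot (faceExt (fun z => soIncl k (ρ z)) x) (idLoop k y)) (bdX z) (bdY z) := by
  have : (fun x y => rot (faceExt (fun z => soIncl k (ρ z)) x) (idLoop k y)) =
      fun (x : Fin (m + 1) → I) y => rot (soIncl k (faceExt ρ x)) (idLoop k y) := by
    funext x y
    rw [faceExt_soIncl]
  rw [this]
  rfl

theorem faceExt_soIncl_base {m k : ℕ} (r : (Fin m → I) → SOGrp k) (x : Fin (m + 1) → I) :
    rot (faceExt (fun z => soIncl k (r z)) x) (sphBase k) = sphBase k := by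
  rw [← faceExt_soIncl, rot_soIncl_base]

theorem continuousOn_jGlue {m k : ℕ} (ρ : Ω^ (Fin m) (SOGrp k) 1) :
    ContinuousOn (Function.uncurry (glue (fun _ => sphBase k)
      (fun x y => rot (faceExt (fun z => soIncl k (ρ z)) x) (idLoop k y))))
      (prodBoundary (m + 1) k) := by
  refine ContinuousOn.of_unit (continuousOn_glue (T := Unit) (f := fun _ _ => sphBase k)
    (g := fun _ x y => rot (faceExt (fun z => soIncl k (ρ z)) x) (idLoop k y)) continuous_const
    (continuousOn_rot_faceExt (r := fun (_ : Unit) z => soIncl k (ρ z))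
      ((continuous_soIncl k).comp (ρ.1.continuous.comp continuous_snd)) fun _ x hx => ?_)
    fun _ x _ y hy => ?_)
  · rw [GenLoop.boundary ρ x hx, soIncl_one]
  · rw [GenLoop.boundary (idLoop k) y hy, faceExt_soIncl_base]

/-- `J ∘ ι_* = Σ ∘ J`. -/
theorem jHom_soIncl {m l : ℕ} (ρ : Ω^ (Fin m) (SOGrp (l + 1)) 1) :
    GenLoop.Homotopic (jLoop (Nat.succ_pos (l + 1))
      (loopMap ⟨soIncl (l + 1), continuous_soIncl (l + 1)⟩ (soIncl_one (l + 1)) ρ))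
      (suspLoop (jLoop (Nat.succ_pos l) ρ)) := by
  set ρ₁ := loopMap ⟨soIncl (l + 1), continuous_soIncl (l + 1)⟩ (soIncl_one (l + 1)) ρ
  have hmem : ∀ y : Fin (l + 1) → I, y 0 = 0 → y ∈ Cube.boundary (Fin (l + 1)) :=
    fun y hy => ⟨0, Or.inl hy⟩
  refine homotopic_suspLoop_bd (continuousOn_jGlue ρ)
    (fun x y _ hy => glue_left _ _ _ (hmem y hy))
    (continuousOn_jGlue ρ₁) (fun x y => ?_) _ (jLoop_apply _ ρ) _ (jLoop_apply _ ρ₁)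
  -- Matrices coming from the smaller group fix e, so the formula on ∂I^(m+1) × I^k also holds on
  -- the other piece.
  rw [glue_right (fun y hy => by
      rw [GenLoop.boundary (idLoop _) y hy, faceExt_soIncl_base]),
    glue_right (fun y hy => by
      rw [GenLoop.boundary (idLoop _) y hy, faceExt_soIncl_base])]
  have h₁ : faceExt (fun z => soIncl (l + 1) (ρ z)) x = soIncl (l + 1) (faceExt ρ x) :=
    (faceExt_soIncl ρ x).symm
  have h₂ : faceExt (fun z => soIncl (l + 1 + 1) (ρ₁ z)) x =
      soIncl (l + 1 + 1) (soIncl (l + 1) (faceExt ρ x)) := by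
    rw [← h₁]
    exact (faceExt_soIncl _ x).symm
  rw [idLoop_succ_apply, h₁, h₂, rot_suspPt]

/-! ### Points of a sphere bundle in suspension coordinates -/

/-- The midpoint of the unit interval. -/
noncomputable def half : I := ⟨1 / 2, by norm_num, by norm_num⟩

theorem suspPt_half {m : ℕ} (v : Sph m) : suspPt v half = equator v := by
  have h : Real.pi * ((half : I) : ℝ) = Real.pi / 2 := by simp only [half]; ring
  refine sph_ext ?_ ?_
  · rw [suspPt_newIdx, equator_newIdx, h, Real.cos_pi_div_two, mul_zero, zero_mul]
  · have h1 := dropNew_suspPt v half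
    rw [h, Real.sin_pi_div_two, one_pow, one_smul] at h1
    rw [dropNew_equator]
    exact sub_right_injective h1

theorem suspPt_mem_hemiPos {m : ℕ} (v : Sph m) {t : I} (ht : t ≤ half) :
    suspPt v t ∈ hemiPos m := by
  have h2 : (t : ℝ) ≤ 1 / 2 := ht
  have h0 := mul_nonneg Real.pi_pos.le t.2.1
  have h1 : Real.pi * t ≤ Real.pi / 2 := by nlinarith [Real.pi_pos]
  change 0 ≤ (suspPt v t).1 (newIdx m)
  rw [suspPt_newIdx]
  refine mul_nonneg (mul_nonneg (Real.sin_nonneg_of_nonneg_of_le_pi h0 ?_)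
    (Real.cos_nonneg_of_neg_pi_div_two_le_of_le ?_ h1)) (norm_nonneg _) <;>
  linarith [Real.pi_pos]

theorem suspPt_mem_hemiNeg {m : ℕ} (v : Sph m) {t : I} (ht : half ≤ t) :
    suspPt v t ∈ hemiNeg m := by
  have h2 : 1 / 2 ≤ (t : ℝ) := ht
  have h0 := mul_nonneg Real.pi_pos.le t.2.1
  have h1 : Real.pi / 2 ≤ Real.pi * t := by nlinarith [Real.pi_pos]
  have h3 : Real.pi * t ≤ Real.pi := by nlinarith [Real.pi_pos, t.2.2]
  change (suspPt v t).1 (newIdx m) ≤ 0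
  rw [suspPt_newIdx]
  refine mul_nonpos_of_nonpos_of_nonneg (mul_nonpos_of_nonneg_of_nonpos
    (Real.sin_nonneg_of_nonneg_of_le_pi h0 h3)
    (Real.cos_nonpos_of_pi_div_two_le_of_le h1 ?_)) (norm_nonneg _)
  linarith [Real.pi_pos]

section Bundle

variable {m q : ℕ} (ρ : C(Sph m, SOGrp (q + 1)))

theorem posPt_base (hρ : ρ (sphBase m) = 1) {b : hemiPos m} (hb : b.1 = sphBase (m + 1))
    (y : Sph q) : posPt ρ b y = fibreIncl ρ y := by
  have : b = eqPos (sphBase m) := Subtype.ext (hb.trans equator_base.symm)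
  rw [this, posPt_eqPos, hρ, rot_one]
  rfl

theorem negPt_base {b : hemiNeg m} (hb : b.1 = sphBase (m + 1)) (y : Sph q) :
    negPt ρ b y = fibreIncl ρ y := by
  have : b = eqNeg (sphBase m) := Subtype.ext (hb.trans equator_base.symm)
  rw [this]
  rfl

open Classical in
/-- The point over `suspPt v t` whose coordinate is `y₁` if it lies over `D_+`, and `y₂`
otherwise. -/
noncomputable def suspBun (v : Sph m) (t : I) (y₁ y₂ : Sph q) : SphBundle ρ :=
  if h : t ≤ half then posPt ρ ⟨suspPt v t, suspPt_mem_hemiPos v h⟩ y₁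
  else negPt ρ ⟨suspPt v t, suspPt_mem_hemiNeg v (le_of_not_ge h)⟩ y₂

theorem bundleProj_suspBun (v : Sph m) (t : I) (y₁ y₂ : Sph q) :
    bundleProj ρ (suspBun ρ v t y₁ y₂) = suspPt v t := by
  unfold suspBun
  split_ifs <;> rfl

theorem suspBun_base_left (hρ : ρ (sphBase m) = 1) {v : Sph m} {t : I}
    (h : suspPt v t = sphBase (m + 1)) (ht : t ≤ half) (y₁ y₂ : Sph q) :
    suspBun ρ v t y₁ y₂ = fibreIncl ρ y₁ := by
  rw [suspBun, dif_pos ht]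
  exact posPt_base ρ hρ h y₁

theorem suspBun_base_right {v : Sph m} {t : I}
    (h : suspPt v t = sphBase (m + 1)) (ht : ¬t ≤ half) (y₁ y₂ : Sph q) :
    suspBun ρ v t y₁ y₂ = fibreIncl ρ y₂ := by
  rw [suspBun, dif_neg ht]
  exact negPt_base ρ h y₂

theorem suspBun_base (hρ : ρ (sphBase m) = 1) {v : Sph m} {t : I}
    (h : suspPt v t = sphBase (m + 1)) (y : Sph q) : suspBun ρ v t y y = fibreIncl ρ y := by
  by_cases ht : t ≤ half
  · exact suspBun_base_left ρ hρ h ht y y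
  · exact suspBun_base_right ρ h ht y y

/-- Replacing t by min(t, 1/2) or max(t, 1/2) extends each chart formula continuously to all of X;
at t = 1/2 the hypothesis is exactly the clutching relation. -/
theorem continuous_suspBun {X : Type*} [TopologicalSpace X] {v : X → Sph m} {t : X → I}
    {y₁ y₂ : X → Sph q} (hv : Continuous v) (ht : Continuous t) (h₁ : Continuous y₁)
    (h₂ : Continuous y₂) (h : ∀ x, t x = half → y₂ x = rot (ρ (v x)) (y₁ x)) :
    Continuous fun x => suspBun ρ (v x) (t x) (y₁ x) (y₂ x) := by
  let b₁ : X → hemiPos m := fun x => ⟨suspPt (v x) (t x ⊓ half), suspPt_mem_hemiPos _ inf_le_right⟩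
  let b₂ : X → hemiNeg m := fun x => ⟨suspPt (v x) (t x ⊔ half), suspPt_mem_hemiNeg _ le_sup_right⟩
  have cb₁ : Continuous b₁ :=
    (continuous_suspPt.comp (hv.prodMk (ht.inf continuous_const))).subtype_mk _
  have cb₂ : Continuous b₂ :=
    (continuous_suspPt.comp (hv.prodMk (ht.sup continuous_const))).subtype_mk _
  have c₁ : Continuous fun x => posPt ρ (b₁ x) (y₁ x) :=
    (continuous_posPt ρ).comp (cb₁.prodMk h₁)
  have c₂ : Continuous fun x => negPt ρ (b₂ x) (y₂ x) :=
    (continuous_negPt ρ).comp (cb₂.prodMk h₂)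
  have e₁ : ∀ x, t x ≤ half → suspBun ρ (v x) (t x) (y₁ x) (y₂ x) = posPt ρ (b₁ x) (y₁ x) :=
    fun x hx => by
      rw [suspBun, dif_pos hx]
      exact congrArg (posPt ρ · (y₁ x)) (Subtype.ext (congrArg (suspPt (v x)) (inf_eq_left.2 hx).symm))
  have e₂ : ∀ x, half ≤ t x → suspBun ρ (v x) (t x) (y₁ x) (y₂ x) = negPt ρ (b₂ x) (y₂ x) :=
    fun x hx => by
      by_cases hx2 : t x ≤ half
      · have hx3 := le_antisymm hx2 hx
        have p₁ : b₁ x = eqPos (v x) := Subtype.ext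
          ((congrArg (suspPt (v x)) (inf_eq_right.2 hx)).trans (suspPt_half _))
        have p₂ : b₂ x = eqNeg (v x) := Subtype.ext
          ((congrArg (suspPt (v x)) (sup_eq_right.2 hx2)).trans (suspPt_half _))
        rw [e₁ x hx2, p₁, p₂, h x hx3, posPt_eqPos]
      · rw [suspBun, dif_neg hx2]
        exact congrArg (negPt ρ · (y₂ x))
          (Subtype.ext (congrArg (suspPt (v x)) (sup_eq_left.2 hx).symm))
  have hc := continuousOn_paste (isClosed_le ht continuous_const)
    (isClosed_le continuous_const ht)
    (F := fun x => suspBun ρ (v x) (t x) (y₁ x) (y₂ x)) c₁.continuousOn c₂.continuousOn e₁ e₂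
  rw [← continuousOn_univ]
  exact hc.mono fun x _ => le_total (t x) half

theorem posPt_injective (b : hemiPos m) : Function.Injective (posPt ρ b) := fun _ _ h =>
  Subtype.ext (congrArg (fun e => (bundleEmb ρ e).1) h)

theorem negPt_injective (b : hemiNeg m) : Function.Injective (negPt ρ b) := fun _ _ h =>
  Subtype.ext (congrArg (fun e => (bundleEmb ρ e).2) h)

theorem exists_posPt (b : hemiPos m) {e : SphBundle ρ} (he : bundleProj ρ e = b.1) :
    ∃ y, posPt ρ b y = e := by
  rcases sphBundle_cases ρ e with ⟨b', y, rfl⟩ | ⟨b', y, rfl⟩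
  · exact ⟨y, by rw [show b = b' from Subtype.ext he.symm]⟩
  · have hb' : b'.1 ∈ hemiPos m := (show b'.1 = b.1 from he) ▸ b.2
    obtain ⟨x, hx⟩ := exists_equator (le_antisymm b'.2 hb')
    refine ⟨rot (ρ x)⁻¹ y, ?_⟩
    rw [show b = eqPos x from Subtype.ext (he.symm.trans hx.symm), posPt_eqPos, rot_rot_inv,
      show b' = eqNeg x from Subtype.ext hx.symm]

theorem exists_negPt (b : hemiNeg m) {e : SphBundle ρ} (he : bundleProj ρ e = b.1) :
    ∃ y, negPt ρ b y = e := by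
  rcases sphBundle_cases ρ e with ⟨b', y, rfl⟩ | ⟨b', y, rfl⟩
  · have hb' : b'.1 ∈ hemiNeg m := (show b'.1 = b.1 from he) ▸ b.2
    obtain ⟨x, hx⟩ := exists_equator (le_antisymm hb' b'.2)
    refine ⟨rot (ρ x) y, ?_⟩
    rw [show b = eqNeg x from Subtype.ext (he.symm.trans hx.symm), ← posPt_eqPos,
      show b' = eqPos x from Subtype.ext hx.symm]
  · exact ⟨y, by rw [show b = b' from Subtype.ext he.symm]⟩

/-- A bundle whose characteristic map is homotopic to a map with values in `SO(q)` has a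
section. -/
theorem exists_basedSection (hρ : ρ (sphBase m) = 1) {ρ' : Ω^ (Fin m) (SOGrp q) 1}
    (h : GenLoop.Homotopic (loopMap ρ hρ (idLoop m))
      (loopMap ⟨soIncl q, continuous_soIncl q⟩ (soIncl_one q) ρ')) :
    ∃ s : C(Sph (m + 1), SphBundle ρ), IsBasedSection ρ s := by
  obtain ⟨H⟩ := h
  have H0 : ∀ z, H (0, z) = ρ (idLoop m z) := H.apply_zero
  have H1 : ∀ z, H (1, z) = soIncl q (ρ' z) := H.apply_one
  have Hb : ∀ t, ∀ z ∈ Cube.boundary (Fin m), H (t, z) = 1 := fun t z hz =>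
    (H.eq_fst t hz).trans (GenLoop.boundary (loopMap ρ hρ (idLoop m)) z hz)
  -- The coordinate is constantly e over D_+. Over D_- the homotopy leads from ρ(v)e, forced by
  -- clutching at the equator, to ι(ρ'(v))e = e at the end.
  let f : (Fin (m + 1) → I) → SphBundle ρ := fun z =>
    suspBun ρ (idLoop m (Fin.init z)) (z (Fin.last m)) (sphBase q)
      (rot (H (clamp (2 * z (Fin.last m) - 1), Fin.init z)) (sphBase q))
  have cH : Continuous fun z : Fin (m + 1) → I =>
      H (clamp (2 * z (Fin.last m) - 1), Fin.init z) :=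
    H.continuous.comp ((continuous_clamp.comp (by fun_prop)).prodMk continuous_init)
  have cf : Continuous f := by
    refine continuous_suspBun ρ ((idLoop m).1.continuous.comp continuous_init)
      (continuous_apply _) continuous_const (continuous_rot.comp (cH.prodMk continuous_const))
      fun z hz => ?_
    rw [hz, clamp_of_nonpos (by simp [half]), H0]
  have hf : ∀ z ∈ Cube.boundary (Fin (m + 1)), f z = fibreIncl ρ (sphBase q) := fun z hz => by
    have hb : suspPt (idLoop m (Fin.init z)) (z (Fin.last m)) = sphBase (m + 1) :=
      GenLoop.boundary (idLoop (m + 1)) z hz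
    rcases boundary_cases hz with h | h | h
    · simp only [f]
      rw [Hb _ _ h, rot_one, suspBun_base ρ hρ hb]
    · refine suspBun_base_left ρ hρ hb ?_ _ _
      rw [h]
      exact half.2.1
    · simp only [f]
      rw [h] at hb ⊢
      rw [clamp_of_one_le (by norm_num), H1, rot_soIncl_base, suspBun_base ρ hρ hb]
  obtain ⟨s, hs⟩ := exists_comp_idLoop (Nat.succ_pos m)
    (⟨⟨f, cf⟩, hf⟩ : Ω^ (Fin (m + 1)) (SphBundle ρ) (fibreIncl ρ (sphBase q)))
  refine ⟨s, fun x => ?_, ?_⟩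
  · obtain ⟨z, rfl⟩ := (isQuotientMap_idLoop (Nat.succ_pos m)).surjective x
    rw [hs]
    exact bundleProj_suspBun ρ _ _ _ _
  · have h0 : (0 : Fin (m + 1) → I) ∈ Cube.boundary (Fin (m + 1)) :=
      zero_mem_boundary (Nat.succ_pos m)
    rw [← GenLoop.boundary (idLoop (m + 1)) 0 h0, hs]
    exact hf 0 h0

/-! ### The trivialization of the pull-back to the cube -/

/-- The trivialization, over the cube, of the pull-back of the bundle along the reflection of
`I^(m+1) → S^(m+1)` in the last coordinate. -/
noncomputable def triv (x : Fin (m + 1) → I) (y : Sph q) : SphBundle ρ :=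
  suspBun ρ (idLoop m (Fin.init x)) (σ (x (Fin.last m))) (rot (ρ (idLoop m (Fin.init x)))⁻¹ y) y

theorem continuous_triv : Continuous fun p : (Fin (m + 1) → I) × Sph q => triv ρ p.1 p.2 := by
  have c1 : Continuous fun p : (Fin (m + 1) → I) × Sph q => idLoop m (Fin.init p.1) :=
    (idLoop m).1.continuous.comp (continuous_init.comp continuous_fst)
  refine continuous_suspBun ρ c1 (by fun_prop)
    (continuous_rot.comp ((continuous_inv_SO.comp (ρ.continuous.comp c1)).prodMk continuous_snd))
    continuous_snd fun p _ => (rot_rot_inv _ _).symm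

theorem idLoop_flip (x : Fin (m + 1) → I) : idLoop (m + 1) (cubeFlip (Fin.last m) x) =
    suspPt (idLoop m (Fin.init x)) (σ (x (Fin.last m))) := by
  have h : (Fin.init (cubeFlip (Fin.last m) x) : Fin m → I) = Fin.init x := by
    funext j
    simp [Fin.init, cubeFlip, Fin.castSucc_ne_last]
  rw [idLoop_succ_apply, h]
  simp [cubeFlip]

theorem triv_injective (x : Fin (m + 1) → I) : Function.Injective (triv ρ x) := fun y y' h => by
  unfold triv suspBun at h
  split_ifs at h with h1
  · have h2 := congrArg (rot (ρ (idLoop m (Fin.init x)))) (posPt_injective ρ _ h)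
    rwa [rot_rot_inv, rot_rot_inv] at h2
  · exact negPt_injective ρ _ h

theorem exists_triv (x : Fin (m + 1) → I) {e : SphBundle ρ}
    (he : bundleProj ρ e = idLoop (m + 1) (cubeFlip (Fin.last m) x)) : ∃ y, triv ρ x y = e := by
  rw [idLoop_flip] at he
  unfold triv suspBun
  by_cases h : σ (x (Fin.last m)) ≤ half
  · obtain ⟨y, hy⟩ := exists_posPt ρ ⟨_, suspPt_mem_hemiPos (idLoop m (Fin.init x)) h⟩ he
    exact ⟨rot (ρ (idLoop m (Fin.init x))) y, by rw [dif_pos h, rot_inv_rot, hy]⟩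
  · obtain ⟨y, hy⟩ := exists_negPt ρ
      ⟨_, suspPt_mem_hemiNeg (idLoop m (Fin.init x)) (le_of_not_ge h)⟩ he
    exact ⟨y, by rw [dif_neg h, hy]⟩

/-- The reflection puts D_+, where the coordinate is twisted by ρ⁻¹, at the face x_m = 1, which is
the face carrying ρ in `faceExt`. Because of the inverse, section and fibre are read as ρ̂(x)e and
ρ̂(x)[y]. -/
theorem triv_boundary (hρ : ρ (sphBase m) = 1) {x : Fin (m + 1) → I}
    (hx : x ∈ Cube.boundary (Fin (m + 1))) (y : Sph q) :
    triv ρ x y = fibreIncl ρ (rot (faceExt (fun z => ρ (idLoop m z)) x)⁻¹ y) := by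
  have hb : suspPt (idLoop m (Fin.init x)) (σ (x (Fin.last m))) = sphBase (m + 1) := by
    rw [← idLoop_flip]
    exact GenLoop.boundary (idLoop (m + 1)) _ (cubeFlip_mem _ hx)
  unfold triv
  by_cases h1 : x (Fin.last m) = 1
  · rw [faceExt_of_last _ h1]
    refine suspBun_base_left ρ hρ hb ?_ _ _
    rw [h1, unitInterval.symm_one]
    exact half.2.1
  · rw [faceExt_of_ne _ h1, inv_one, rot_one]
    rcases boundary_cases hx with h | h | h
    · have hv : idLoop m (Fin.init x) = sphBase m := GenLoop.boundary _ _ h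
      rw [hv] at hb ⊢
      rw [hρ, inv_one, rot_one, suspBun_base ρ hρ hb]
    · refine suspBun_base_right ρ hb ?_ _ _
      rw [h, unitInterval.symm_zero, not_le]
      change (1 / 2 : ℝ) < 1
      norm_num
    · exact absurd h h1

/-- A section, read in the trivialization over the cube. -/
theorem exists_triv_section (hρ : ρ (sphBase m) = 1) {s : C(Sph (m + 1), SphBundle ρ)}
    (hs : IsBasedSection ρ s) : ∃ w : C(Fin (m + 1) → I, Sph q),
      (∀ x, triv ρ x (w x) = s (idLoop (m + 1) (cubeFlip (Fin.last m) x))) ∧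
      ∀ x ∈ Cube.boundary (Fin (m + 1)),
        w x = rot (faceExt (fun z => ρ (idLoop m z)) x) (sphBase q) := by
  choose w hw using fun x => exists_triv ρ x (hs.1 (idLoop (m + 1) (cubeFlip (Fin.last m) x)))
  -- The trivialization embeds I^(m+1) × S^q as a closed subspace of I^(m+1) × E, so the pointwise
  -- choice `w` is continuous.
  have hemb := (continuous_fst.prodMk (continuous_triv ρ)).isClosedEmbedding
    fun (p p' : (Fin (m + 1) → I) × Sph q) h => by
      obtain ⟨h1, h2⟩ := Prod.mk.inj h
      rw [← h1] at h2
      exact Prod.ext h1 (triv_injective ρ p.1 h2)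
  have hc : Continuous fun x => (x, w x) := by
    refine hemb.continuous_iff.2 ?_
    have : Continuous fun x : Fin (m + 1) → I =>
        (x, s (idLoop (m + 1) (cubeFlip (Fin.last m) x))) :=
      continuous_id.prodMk (s.continuous.comp ((idLoop (m + 1)).1.continuous.comp
        (continuous_cubeFlip _)))
    convert this using 1
    exact funext fun x => Prod.ext rfl (hw x)
  refine ⟨⟨w, continuous_snd.comp hc⟩, hw, fun x hx => ?_⟩
  have h := hw x
  rw [GenLoop.boundary (idLoop (m + 1)) _ (cubeFlip_mem _ hx), hs.2, triv_boundary ρ hρ hx] at h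
  change w x = _
  rw [← fibreIncl_injective ρ h, rot_rot_inv]

end Bundle

/-! ### Twisted loops -/

/-- The generalized loop given by a map on `∂(I^(m+1) × I^l)`. -/
noncomputable def bdLoop {X : Type*} [TopologicalSpace X] {x₀ : X} {m l : ℕ}
    (G : (Fin (m + 1) → I) → (Fin l → I) → X)
    (hG : ContinuousOn (Function.uncurry G) (prodBoundary (m + 1) l)) (h0 : G 0 0 = x₀) :
    Ω^ (Fin (m + l)) X x₀ :=
  ⟨⟨fun z => G (bdX z) (bdY z), hG.comp_continuous (f := fun z => (bdX z, bdY z))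
    (continuous_bdX.prodMk continuous_bdY) bd_mem_prodBoundary⟩, fun z hz => by
    change G (bdX z) (bdY z) = x₀
    rw [bdX_boundary hz, bdY_boundary hz, h0]⟩

/-- The map on `∂(I^(m+1) × I^q)` which sends `I^(m+1) × ∂I^q` to `S^q` by `w`, and
`(x, y) ∈ ∂I^(m+1) × I^q` to `r(x) · y`. -/
noncomputable def twist {m q : ℕ} (r : (Fin m → I) → SOGrp (q + 1))
    (w : (Fin (m + 1) → I) → Sph q) : (Fin (m + 1) → I) → (Fin q → I) → Sph q :=
  glue w fun x y => rot (faceExt r x) (idLoop q y)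

theorem continuousOn_twist {T : Type*} [TopologicalSpace T] {m q : ℕ}
    {r : T → (Fin m → I) → SOGrp (q + 1)} {w : T → (Fin (m + 1) → I) → Sph q}
    (hrc : Continuous fun p : T × (Fin m → I) => r p.1 p.2)
    (hr : ∀ t, ∀ x ∈ Cube.boundary (Fin m), r t x = 1)
    (hwc : Continuous fun p : T × (Fin (m + 1) → I) => w p.1 p.2)
    (hw : ∀ t, ∀ x ∈ Cube.boundary (Fin (m + 1)),
      w t x = rot (faceExt (r t) x) (sphBase q)) :
    ContinuousOn (fun p : T × ((Fin (m + 1) → I) × (Fin q → I)) =>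
      twist (r p.1) (w p.1) p.2.1 p.2.2) {p | p.2 ∈ prodBoundary (m + 1) q} :=
  continuousOn_glue (g := fun t x y => rot (faceExt (r t) x) (idLoop q y)) hwc
    (continuousOn_rot_faceExt hrc hr) fun t x hx y hy => by
    rw [hw t x hx, GenLoop.boundary (idLoop q) y hy]

theorem twist_boundary {m q : ℕ} {r : (Fin m → I) → SOGrp (q + 1)}
    {w : (Fin (m + 1) → I) → Sph q}
    (hw : ∀ x ∈ Cube.boundary (Fin (m + 1)), w x = rot (faceExt r x) (sphBase q))
    {x : Fin (m + 1) → I} (hx : x ∈ Cube.boundary (Fin (m + 1))) (y : Fin q → I) :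
    twist r w x y = rot (faceExt r x) (idLoop q y) :=
  glue_right (fun y hy => by rw [hw x hx, GenLoop.boundary (idLoop q) y hy]) y

theorem twist_zero {m q : ℕ} (hq : 0 < q) {r : (Fin m → I) → SOGrp (q + 1)}
    {w : (Fin (m + 1) → I) → Sph q}
    (hw : ∀ x ∈ Cube.boundary (Fin (m + 1)), w x = rot (faceExt r x) (sphBase q)) :
    twist r w 0 0 = sphBase q := by
  rw [twist_boundary hw (zero_mem_boundary (Nat.succ_pos m)),
    GenLoop.boundary (idLoop q) 0 (zero_mem_boundary hq), faceExt_zero, rot_one]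

/-- The generalized loop of `twist r w`. -/
noncomputable def twistLoop {m q : ℕ} (hq : 0 < q) {r : (Fin m → I) → SOGrp (q + 1)}
    {w : (Fin (m + 1) → I) → Sph q} (hrc : Continuous r)
    (hr : ∀ x ∈ Cube.boundary (Fin m), r x = 1) (hwc : Continuous w)
    (hw : ∀ x ∈ Cube.boundary (Fin (m + 1)), w x = rot (faceExt r x) (sphBase q)) :
    Ω^ (Fin (m + q)) (Sph q) (sphBase q) :=
  bdLoop (twist r w) (ContinuousOn.of_unit (continuousOn_twist (T := Unit) (r := fun _ => r)
    (w := fun _ => w) (hrc.comp continuous_snd) (fun _ => hr) (hwc.comp continuous_snd)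
    fun _ => hw)) (twist_zero hq hw)

theorem homotopic_twistLoop {m q : ℕ} (hq : 0 < q) {r : I → (Fin m → I) → SOGrp (q + 1)}
    {w : I → (Fin (m + 1) → I) → Sph q}
    (hrc : Continuous fun p : I × (Fin m → I) => r p.1 p.2)
    (hr : ∀ t, ∀ x ∈ Cube.boundary (Fin m), r t x = 1)
    (hwc : Continuous fun p : I × (Fin (m + 1) → I) => w p.1 p.2)
    (hw : ∀ t, ∀ x ∈ Cube.boundary (Fin (m + 1)),
      w t x = rot (faceExt (r t) x) (sphBase q))
    {f g : Ω^ (Fin (m + q)) (Sph q) (sphBase q)}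
    (hf : ∀ z, f z = twist (r 0) (w 0) (bdX z) (bdY z))
    (hg : ∀ z, g z = twist (r 1) (w 1) (bdX z) (bdY z)) :
    GenLoop.Homotopic f g :=
  homotopic_of_bdFamily (fun t => twist (r t) (w t)) (continuousOn_twist hrc hr hwc hw)
    (fun t => twist_zero hq (hw t)) (fun z => (hf z).symm) fun z => (hg z).symm

/-- If `r` takes values in `SO(q)`, then `Σ[twist r w] = ΣJ(r)`. -/
theorem homotopic_suspLoop_twist {m q : ℕ} (hq : 0 < q) (ρ : Ω^ (Fin m) (SOGrp q) 1)
    {w : (Fin (m + 1) → I) → Sph q} (hwc : Continuous w)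
    (hw : ∀ x ∈ Cube.boundary (Fin (m + 1)),
      w x = rot (faceExt (fun z => soIncl q (ρ z)) x) (sphBase q))
    {g : Ω^ (Fin (m + q)) (Sph q) (sphBase q)}
    (hg : ∀ z, g z = twist (fun z => soIncl q (ρ z)) w (bdX z) (bdY z)) :
    GenLoop.Homotopic (suspLoop g) (suspLoop (jLoop hq ρ)) := by
  have hwb : ∀ x ∈ Cube.boundary (Fin (m + 1)), w x = sphBase q := fun x hx => by
    rw [hw x hx, faceExt_soIncl_base]
  have hw0 : w 0 = sphBase q := hwb 0 (zero_mem_boundary (Nat.succ_pos m))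
  -- The contribution of `w`, extended by e over ∂I^(m+1) × I^q. It factors through the cube
  -- I^(m+1), which contracts to the vertex 0.
  let f : Ω^ (Fin (m + q)) (Sph q) (sphBase q) :=
    ⟨⟨fun z => w (bdX z), hwc.comp continuous_bdX⟩, fun z hz => by
      change w (bdX z) = _
      rw [bdX_boundary hz, hw0]⟩
  have hf : GenLoop.Homotopic f GenLoop.const := by
    refine homotopic_of_family (fun p => w fun i => σ p.1 * bdX p.2 i) (hwc.comp ?_)
      (fun z => ?_) (fun z => ?_) fun t z hz => ?_
    · refine continuous_pi fun i => Continuous.mul (by fun_prop) ?_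
      exact (continuous_apply i).comp (continuous_bdX.comp continuous_snd)
    · simp only [unitInterval.symm_zero, one_mul]
      rfl
    · simp only [unitInterval.symm_one, zero_mul]
      exact hw0
    · simp only [bdX_boundary hz, Pi.zero_apply, mul_zero]
      exact hw0
  -- If y is in ∂I^q the representative of J is e; otherwise x is in ∂I^(m+1) and `w` is e.
  have h := homotopic_suspLoop_union f (jLoop hq ρ) g fun z => by
    rw [jLoop_apply, hg]
    by_cases hy : bdY z ∈ Cube.boundary (Fin q)
    · exact Or.inr ⟨glue_left _ _ _ hy, glue_left _ _ _ hy⟩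
    · refine Or.inl ⟨hwb _ ((bd_mem z).resolve_right hy), ?_⟩
      rw [twist, glue, glue, if_neg hy, if_neg hy]
  refine h.trans (Quotient.exact (s := GenLoop.Homotopic.setoid _ _) ?_)
  have h1 : Quotient.mk (GenLoop.Homotopic.setoid _ _) (suspLoop f) =
      (1 : π_ (m + q + 1) (Sph (q + 1)) (sphBase (q + 1))) :=
    (Quotient.sound (suspLoop_const (N := m + q) (k := q) ▸ homotopic_suspLoop hf)).trans
      HomotopyGroup.one_def.symm
  -- In `HomotopyGroup.mul_spec` the second factor is run through first, hence the exchanged order.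
  have h2 := HomotopyGroup.mul_spec (i := Fin.last (m + q)) (p := suspLoop (jLoop hq ρ))
    (q := suspLoop f)
  rw [h1] at h2
  exact h2.symm.trans (mul_one (M := π_ (m + q + 1) (Sph (q + 1)) (sphBase (q + 1))) _)

/-! ### The brace product of the fundamental classes -/

section Brace

variable {m q : ℕ} (ρ : C(Sph m, SOGrp (q + 1)))

/-- In the trivialization over the cube, the inverse of `[s_* Id, i_* Id]` comes from the
fibre. -/
theorem piMap_twistLoop (hm : 0 < m) (hq : 0 < q) (hρ : ρ (sphBase m) = 1)
    (hr : ∀ x ∈ Cube.boundary (Fin m), ρ (idLoop m x) = 1)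
    {s : C(Sph (m + 1), SphBundle ρ)} (hs : IsBasedSection ρ s)
    {w : (Fin (m + 1) → I) → Sph q} (hwc : Continuous w)
    (hws : ∀ x, triv ρ x (w x) = s (idLoop (m + 1) (cubeFlip (Fin.last m) x)))
    (hw : ∀ x ∈ Cube.boundary (Fin (m + 1)),
      w x = rot (faceExt (fun z => ρ (idLoop m z)) x) (sphBase q)) [Nonempty (Fin (m + q))] :
    piMap (fibreIncl ρ) (rfl : _ = fibreIncl ρ (sphBase q))
      ⟦twistLoop hq (ρ.continuous.comp (idLoop m).1.continuous) hr hwc hw⟧ =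
      (whitehead hq (piMap s hs.2 (idClass (m + 1)))
        (piMap (fibreIncl ρ) rfl (idClass q)))⁻¹ := by
  -- The last coordinate of x has to differ from x_0 in order to be reflected, and the collapse
  -- needs a coordinate y_0.
  obtain ⟨m, rfl⟩ := Nat.exists_eq_succ_of_ne_zero hm.ne'
  obtain ⟨l, rfl⟩ := Nat.exists_eq_succ_of_ne_zero hq.ne'
  set r : (Fin (m + 1) → I) → SOGrp (l + 1 + 1) := fun z => ρ (idLoop (m + 1) z) with hrdef
  have hrc : Continuous r := ρ.continuous.comp (idLoop (m + 1)).1.continuous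
  let sl := loopMap s hs.2 (idLoop (m + 1 + 1))
  let il := loopMap (fibreIncl ρ) (rfl : _ = fibreIncl ρ (sphBase (l + 1))) (idLoop (l + 1))
  let W : (Fin (m + 1 + 1) → I) → (Fin (l + 1) → I) → SphBundle ρ := glue sl fun _ y => il y
  have hWc : ContinuousOn (Function.uncurry W) (prodBoundary (m + 1 + 1) (l + 1)) := by
    refine ContinuousOn.of_unit (continuousOn_glue (T := Unit) (f := fun _ => sl)
      (g := fun _ _ y => il y) (sl.1.continuous.comp continuous_snd)
      (il.1.continuous.comp (by fun_prop)).continuousOn fun _ x hx y hy => ?_)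
    rw [GenLoop.boundary sl x hx, GenLoop.boundary il y hy]
  have hW0 : ∀ x y, x 0 = 0 → y 0 = 0 → W x y = fibreIncl ρ (sphBase (l + 1)) :=
    fun x y hx hy => (glue_left _ _ _ ⟨0, Or.inl hy⟩).trans
      (GenLoop.boundary sl x ⟨0, Or.inl hx⟩)
  have hWf : ContinuousOn (Function.uncurry fun x y => W (cubeFlip (Fin.last (m + 1)) x) y)
      (prodBoundary (m + 1 + 1) (l + 1)) :=
    hWc.comp (f := fun p : (Fin (m + 1 + 1) → I) × (Fin (l + 1) → I) =>
      (cubeFlip (Fin.last (m + 1)) p.1, p.2))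
      (((continuous_cubeFlip _).comp continuous_fst).prodMk continuous_snd).continuousOn
      fun p hp => hp.imp_left (cubeFlip_mem _)
  have hWf0 : W (cubeFlip (Fin.last (m + 1)) 0) 0 = fibreIncl ρ (sphBase (l + 1)) :=
    hW0 _ _ (by simp [cubeFlip]) rfl
  -- Reflecting the last coordinate of x inverts the Whitehead product; the minus sign of the
  -- theorem comes from here.
  obtain ⟨f', hf', hg'⟩ := homotopic_symmAt_of_flip (Fin.last m) hWc hW0
    (whiteheadLoop (Nat.succ_pos l) sl il) (bdLoop _ hWf hWf0) (fun _ => rfl)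
    fun _ => by rw [Fin.succ_last]; rfl
  let Γ := twist r w
  have hΓc : ContinuousOn (Function.uncurry Γ) (prodBoundary (m + 1 + 1) (l + 1)) :=
    ContinuousOn.of_unit (continuousOn_twist (T := Unit) (r := fun _ => r)
      (w := fun _ => w) (hrc.comp continuous_snd) (fun _ => hr) (hwc.comp continuous_snd)
      fun _ => hw)
  have htriv0 : ∀ y, triv ρ 0 y = fibreIncl ρ y := fun y => by
    rw [triv_boundary ρ hρ (zero_mem_boundary (Nat.succ_pos (m + 1))), faceExt_zero, inv_one,
      rot_one]
  have hΓW : ∀ x y, (x, y) ∈ prodBoundary (m + 1 + 1) (l + 1) →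
      triv ρ x (Γ x y) = W (cubeFlip (Fin.last (m + 1)) x) y := fun x y hxy => by
    by_cases hy : y ∈ Cube.boundary (Fin (l + 1))
    · simp only [Γ, W, twist, glue_left _ _ _ hy]
      exact hws x
    · have hx := hxy.resolve_right hy
      simp only [Γ]
      rw [twist_boundary hw hx, triv_boundary ρ hρ hx, rot_inv_rot]
      exact (if_neg hy).symm
  have hg : GenLoop.Homotopic (loopMap (fibreIncl ρ) (rfl : _ = fibreIncl ρ (sphBase (l + 1)))
      (twistLoop hq hrc hr hwc hw)) (bdLoop _ hWf hWf0) := by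
    -- Only the base variable of the trivialization is scaled. Over the vertex 0 the trivialization
    -- is the inclusion of the fibre; at time 1 the map is s ∪ i precomposed with the reflection.
    refine homotopic_of_bdFamily (fun t x y => triv ρ (fun i => t * x i) (Γ x y)) ?_ (fun t => ?_)
      (fun z => ?_) fun z => ?_
    · refine (continuous_triv ρ).comp_continuousOn (f := fun p : I × ((Fin (m + 1 + 1) → I) ×
        (Fin (l + 1) → I)) => ((fun i => p.1 * p.2.1 i), Γ p.2.1 p.2.2)) (ContinuousOn.prodMk ?_ ?_)
      · exact (continuous_pi fun i => by fun_prop).continuousOn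
      · exact hΓc.comp (f := Prod.snd) continuous_snd.continuousOn fun _ hp => hp
    · simp only [Pi.zero_apply, mul_zero]
      exact (htriv0 _).trans (congrArg _ (twist_zero hq hw))
    · simp only [zero_mul]
      exact htriv0 _
    · simp only [one_mul]
      exact hΓW _ _ (bd_mem_prodBoundary z)
  have h1 : (⟦loopMap (fibreIncl ρ) (rfl : _ = fibreIncl ρ (sphBase (l + 1)))
      (twistLoop hq hrc hr hwc hw)⟧ : π_ (m + 1 + (l + 1)) (SphBundle ρ) _) =
      ⟦GenLoop.symmAt (Fin.castAdd (l + 1) (Fin.last m)) f'⟧ := Quotient.sound (hg.trans hg')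
  have h2 : (⟦whiteheadLoop (Nat.succ_pos l) sl il⟧ :
      π_ (m + 1 + (l + 1)) (SphBundle ρ) (fibreIncl ρ (sphBase (l + 1)))) = ⟦f'⟧ :=
    Quotient.sound hf'
  refine h1.trans (HomotopyGroup.inv_spec.symm.trans ?_)
  rw [← h2]
  rfl

/-- A homotopy of the characteristic map to a map with values in `SO(q)` identifies the suspension
of `[twist r w]` with that of `J`. -/
theorem homotopic_suspLoop_of_characteristic (hq : 0 < q) (hρ : ρ (sphBase m) = 1)
    (hr : ∀ x ∈ Cube.boundary (Fin m), ρ (idLoop m x) = 1) {ρ' : Ω^ (Fin m) (SOGrp q) 1}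
    (h : GenLoop.Homotopic (loopMap ρ hρ (idLoop m))
      (loopMap ⟨soIncl q, continuous_soIncl q⟩ (soIncl_one q) ρ'))
    {w : (Fin (m + 1) → I) → Sph q} (hwc : Continuous w)
    (hw : ∀ x ∈ Cube.boundary (Fin (m + 1)),
      w x = rot (faceExt (fun z => ρ (idLoop m z)) x) (sphBase q)) :
    GenLoop.Homotopic
      (suspLoop (twistLoop hq (ρ.continuous.comp (idLoop m).1.continuous) hr hwc hw))
      (suspLoop (jLoop hq ρ')) := by
  obtain ⟨H⟩ := h
  have H0 : ∀ z, H (0, z) = ρ (idLoop m z) := H.apply_zero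
  have H1 : ∀ z, H (1, z) = soIncl q (ρ' z) := H.apply_one
  have Hb : ∀ t, ∀ z ∈ Cube.boundary (Fin m), H (t, z) = 1 := fun t z hz =>
    (H.eq_fst t hz).trans (GenLoop.boundary (loopMap ρ hρ (idLoop m)) z hz)
  -- The matrix applied to w is H(t, v)ρ(v)⁻¹ on the face x_m = 1 and 1 on the other faces, so the
  -- boundary condition for H(t, ·) holds at every time.
  obtain ⟨u, hud⟩ : ∃ u : I → (Fin (m + 1) → I) → Sph q, ∀ t x, u t x =
      rot (H (t * x (Fin.last m), Fin.init x) * (ρ (idLoop m (Fin.init x)))⁻¹) (w x) :=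
    ⟨_, fun _ _ => rfl⟩
  have cu : Continuous fun p : I × (Fin (m + 1) → I) => u p.1 p.2 := by
    have ci : Continuous fun p : I × (Fin (m + 1) → I) => (Fin.init p.2 : Fin m → I) :=
      continuous_init.comp continuous_snd
    have c1 : Continuous fun p : I × (Fin (m + 1) → I) =>
        H (p.1 * p.2 (Fin.last m), Fin.init p.2) :=
      H.continuous.comp (Continuous.prodMk (by fun_prop) ci)
    have c2 : Continuous fun p : I × (Fin (m + 1) → I) => (ρ (idLoop m (Fin.init p.2)))⁻¹ :=
      continuous_inv_SO.comp (ρ.continuous.comp ((idLoop m).1.continuous.comp ci))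
    simp only [hud]
    exact continuous_rot.comp ((c1.mul c2).prodMk (hwc.comp continuous_snd))
  have hu : ∀ t, ∀ x ∈ Cube.boundary (Fin (m + 1)),
      u t x = rot (faceExt (fun z => H (t, z)) x) (sphBase q) := fun t x hx => by
    rw [hud, hw x hx]
    by_cases h1 : x (Fin.last m) = 1
    · rw [faceExt_of_last _ h1, faceExt_of_last _ h1, h1, mul_one, ← rot_mul, inv_mul_cancel_right]
    · rw [faceExt_of_ne _ h1, faceExt_of_ne _ h1, rot_one]
      rcases boundary_cases hx with h | h | h
      · rw [Hb _ _ h, hr _ h, inv_one, mul_one, rot_one]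
      · rw [h, mul_zero, H0, mul_inv_cancel, rot_one]
      · exact absurd h h1
  have hu0 : ∀ x, u 0 x = w x := fun x => by
    rw [hud, zero_mul, H0, mul_inv_cancel, rot_one]
  have e1 : (fun z => H ((1 : I), z)) = fun z => soIncl q (ρ' z) := funext H1
  have cu1 : Continuous (u 1) := cu.comp (continuous_const.prodMk continuous_id)
  have cH1 : Continuous fun z => H ((1 : I), z) :=
    H.continuous.comp (continuous_const.prodMk continuous_id)
  have key := homotopic_twistLoop hq (r := fun t z => H (t, z)) H.continuous Hb cu hu
    (f := twistLoop hq (ρ.continuous.comp (idLoop m).1.continuous) hr hwc hw)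
    (g := twistLoop hq cH1 (Hb 1) cu1 (hu 1))
    (fun z => by
      change twist (fun z => ρ (idLoop m z)) w _ _ = _
      rw [funext hu0, funext H0])
    fun _ => rfl
  refine (homotopic_suspLoop key).trans (homotopic_suspLoop_twist hq ρ' cu1 ?_ fun z => ?_)
  · rw [← e1]
    exact hu 1
  · rw [← e1]
    rfl

end Brace

/-- Here `n = m + 1 ≥ 2` and `q ≥ 2`; the homotopy groups are written multiplicatively. -/
theorem mainTheorem10 (m q : ℕ) (hm : 1 ≤ m) (hq : 2 ≤ q) (a : π_ m (SOGrp (q + 1)) 1)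
    (ha : a ∈ Set.range
      (piMap ⟨soIncl q, continuous_soIncl q⟩ (soIncl_one q) :
        π_ m (SOGrp q) 1 → π_ m (SOGrp (q + 1)) 1)) :
    (∃ γ : π_ (m + q) (Sph q) (sphBase q), jHom (Nat.succ_pos q) a = suspension γ) ∧
    ∀ (ρ : C(Sph m, SOGrp (q + 1))) (hρ : ρ (sphBase m) = 1), mapClass ρ hρ = a →
      (∃ s : C(Sph (m + 1), SphBundle ρ), IsBasedSection ρ s) ∧
      ∀ (s : C(Sph (m + 1), SphBundle ρ)) (hs : IsBasedSection ρ s),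
        ∃ γ : π_ (m + q) (Sph q) (sphBase q),
          IsBraceProduct s hs.2 (fibreIncl ρ) rfl (lt_of_lt_of_le Nat.two_pos hq)
            (idClass (m + 1)) (idClass q) γ ∧
          jHom (Nat.succ_pos q) a = (suspension γ)⁻¹ := by
  have hq0 : 0 < q := lt_of_lt_of_le Nat.two_pos hq
  have : Nonempty (Fin (m + q)) := ⟨⟨0, by omega⟩⟩
  obtain ⟨b, rfl⟩ := ha
  induction b using Quotient.inductionOn with | _ ρ' =>
  have hJ : jHom (Nat.succ_pos q)
      (piMap ⟨soIncl q, continuous_soIncl q⟩ (soIncl_one q) (⟦ρ'⟧ : π_ m (SOGrp q) 1)) =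
      suspension (⟦jLoop hq0 ρ'⟧ : π_ (m + q) (Sph q) (sphBase q)) := by
    obtain ⟨l, rfl⟩ := Nat.exists_eq_succ_of_ne_zero hq0.ne'
    exact Quotient.sound (jHom_soIncl ρ')
  refine ⟨⟨_, hJ⟩, fun ρ hρ hmap => ?_⟩
  have h : GenLoop.Homotopic (loopMap ρ hρ (idLoop m))
      (loopMap ⟨soIncl q, continuous_soIncl q⟩ (soIncl_one q) ρ') := Quotient.exact hmap
  refine ⟨exists_basedSection ρ hρ h, fun s hs => ?_⟩
  obtain ⟨w, hws, hw⟩ := exists_triv_section ρ hρ hs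
  have hr : ∀ x ∈ Cube.boundary (Fin m), ρ (idLoop m x) = 1 := fun x hx => by
    rw [GenLoop.boundary (idLoop m) x hx, hρ]
  set θ : π_ (m + q) (Sph q) (sphBase q) :=
    ⟦twistLoop hq0 (ρ.continuous.comp (idLoop m).1.continuous) hr w.continuous hw⟧ with hθ
  have h1 := piMap_twistLoop ρ hm hq0 hρ hr hs w.continuous hws hw
  have h2 : suspension θ = suspension (⟦jLoop hq0 ρ'⟧ : π_ (m + q) (Sph q) (sphBase q)) :=
    Quotient.sound (homotopic_suspLoop_of_characteristic ρ hq0 hρ hr h w.continuous hw)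
  have h3 : piHom (N := Fin (m + q)) (fibreIncl ρ)
      (rfl : fibreIncl ρ (sphBase q) = fibreIncl ρ (sphBase q)) θ⁻¹ =
      whitehead hq0 (piMap s hs.2 (idClass (m + 1))) (piMap (fibreIncl ρ) rfl (idClass q)) := by
    rw [map_inv]
    exact inv_eq_iff_eq_inv.2 h1
  -- The fibre inclusion sends θ to the inverse of the Whitehead product, so θ⁻¹ is a preimage, and
  -- injectivity makes it the only one.
  refine ⟨θ⁻¹, fun γ' => ?_, ?_⟩
  · rw [← h3]
    exact (piMap_fibreIncl_injective hρ hs).eq_iff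
  · rw [hJ, suspension_inv, inv_inv, h2]
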